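/- Let $M$ be a smooth real manifold. A flat bundle $(E,\nabla_E)$ on $M$ is a smooth complex vector bundle $E$ with a connection $\nabla_E$ whose curvature $\nabla_E^2$ vanishes. Let $K^0_{\rm rel}(M)$ be the quotient of the free abelian group generated by the quintuples $(E,\nabla_E,F,\nabla_F,f)$, where $(E,\nabla_E)$ and $(F,\nabla_F)$ are flat bundles and $f\colon E\to F$ is a $C^\infty$ isomorphism, by the relations (i) $(E,\nabla_E,F,\nabla_F,f)=0$ if $f$ is isotopic (smoothly homotopic through isomorphisms) to a parallel isomorphism; (ii) $(E,\nabla_E,F,\nabla_F,f)+(G,\nabla_G,H,\nabla_H,h)=(E\oplus G,\nabla_E\oplus\nabla_G,F\oplus H,\nabla_F\oplus\nabla_H,f\oplus h)$; (iii) $(E,\nabla_E,E'\oplus E'',\nabla_{E'}\oplus\nabla_{E''},s\oplus p)=0$ whenever $0\to E'\xrightarrow{i}E\xrightarrow{p}E''\to0$ is a short exact sequence of flat bundles with $i$, $p$ parallel, and $s\colon E\to E'$ is a smooth bundle map with $s\circ i={\rm Id}_{E'}$. For a smooth path $(\nabla_t)_{t\in[0,1]}$ of connections on $E$ from $\nabla_0$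 to $\nabla_1$, the associated Chern–Simons form is $$\widetilde{\rm ch}(\nabla_0,\nabla_1)=-\frac1{2\pi i}\int_0^1{\rm Tr}\Big(\frac{\partial\nabla_t}{\partial t}\exp\Big(-\frac1{2\pi i}\nabla_t^2\Big)\Big)\,dt .$$ **Theorem.** For every quintuple $(E,\nabla_E,F,\nabla_F,f)$ there is a smooth path of connections on $E$ from $\nabla_E$ to $f^*\nabla_F$, and for every such path the form $\widetilde{\rm ch}(\nabla_E,f^*\nabla_F)$ is a closed smooth odd form whose cohomology class $$\mathcal N_{\rm ch}(E,\nabla_E,F,\nabla_F,f)=\big[\widetilde{\rm ch}(\nabla_E,f^*\nabla_F)\big]\in H^{\rm odd}(M,\mathbb C)$$ does not depend on the path. There is a unique group morphism $K^0_{\rm rel}(M)\to H^{\rm odd}(M,\mathbb C)$ which maps the class of each quintuple $(E,\nabla_E,F,\nabla_F,f)$ to $\mathcal N_{\rm ch}(E,\nabla_E,F,\nabla_F,f)$. -/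

import Mathlib

set_option maxSynthPendingDepth 3

open scoped Manifold ContDiff
open Set

noncomputable section

namespace RelKTheory

universe u v

/-! ## Smooth complex vector bundles -/

section Bundles

/-- A smooth complex vector bundle over the manifold `M` (modelled on `E`): a family of complex
vector spaces with, around every point `x₀`, a local trivialization
`coord x₀ x : Fib x ≃ ℂ^(Idx x₀)` for `x` in an open neighbourhood `dom x₀` of `x₀` (with inverse
`symm x₀ x`), such that all transition functions are smooth. The values of `coord x₀ x` and
`symm x₀ x` for `x` outside `dom x₀` are irrelevant. The rank is locally constant. -/
structure SmoothBundle (E : Type u) [NormedAddCommGroup E] [NormedSpace ℝ E]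
    (M : Type v) [TopologicalSpace M] [ChartedSpace E M] where
  Fib : M → Type
  [addCommGroup : ∀ x, AddCommGroup (Fib x)]
  [module : ∀ x, Module ℂ (Fib x)]
  Idx : M → Type
  [fintype : ∀ x₀, Fintype (Idx x₀)]
  [decEq : ∀ x₀, DecidableEq (Idx x₀)]
  dom : M → Set M
  isOpen_dom : ∀ x₀, IsOpen (dom x₀)
  mem_dom : ∀ x₀, x₀ ∈ dom x₀
  coord : ∀ x₀ x, Fib x →ₗ[ℂ] (Idx x₀ → ℂ)
  symm : ∀ x₀ x, (Idx x₀ → ℂ) →ₗ[ℂ] Fib x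
  coord_symm : ∀ x₀, ∀ x ∈ dom x₀, ∀ c, coord x₀ x (symm x₀ x c) = c
  symm_coord : ∀ x₀, ∀ x ∈ dom x₀, ∀ e, symm x₀ x (coord x₀ x e) = e
  smooth_transition : ∀ x₀ x₁ (c : Idx x₀ → ℂ),
    ContMDiffOn 𝓘(ℝ, E) 𝓘(ℝ, Idx x₁ → ℂ) ∞
      (fun x => coord x₁ x (symm x₀ x c)) (dom x₀ ∩ dom x₁)

attribute [instance] SmoothBundle.addCommGroup SmoothBundle.module SmoothBundle.fintype
  SmoothBundle.decEq

variable {E : Type u} [NormedAddCommGroup E] [NormedSpace ℝ E]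
  {M : Type v} [TopologicalSpace M] [ChartedSpace E M]

namespace SmoothBundle

/-- Smoothness of a section on an open set `U`: around each point of `U`, the coordinates of the
section in the local trivialization are smooth. Only values of `σ` on `U` matter. -/
def SmoothOn (V : SmoothBundle E M) (σ : ∀ x, V.Fib x) (U : Set M) : Prop :=
  ∀ x ∈ U, ContMDiffAt 𝓘(ℝ, E) 𝓘(ℝ, V.Idx x → ℂ) ∞ (fun y => V.coord x y (σ y)) x

/-- The `j`-th local frame section of the trivialization around `x₀`. -/
def frame (V : SmoothBundle E M) (x₀ : M) (j : V.Idx x₀) : ∀ x, V.Fib x :=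
  fun x => V.symm x₀ x (Pi.single j 1)

/-- The direct sum of two bundles. -/
abbrev sum (V W : SmoothBundle E M) : SmoothBundle E M where
  Fib x := V.Fib x × W.Fib x
  Idx x := V.Idx x ⊕ W.Idx x
  dom x := V.dom x ∩ W.dom x
  isOpen_dom x := (V.isOpen_dom x).inter (W.isOpen_dom x)
  mem_dom x := ⟨V.mem_dom x, W.mem_dom x⟩
  coord x₀ x :=
    { toFun := fun e => Sum.elim (V.coord x₀ x e.1) (W.coord x₀ x e.2)
      map_add' := fun e e' => by ext (i | i) <;> simp
      map_smul' := fun c e => by ext (i | i) <;> simp }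
  symm x₀ x :=
    { toFun := fun c => (V.symm x₀ x (fun i => c (Sum.inl i)), W.symm x₀ x (fun i => c (Sum.inr i)))
      map_add' := fun c c' => by
        ext
        · exact (V.symm x₀ x).map_add _ _
        · exact (W.symm x₀ x).map_add _ _
      map_smul' := fun a c => by
        ext
        · exact (V.symm x₀ x).map_smul _ _
        · exact (W.symm x₀ x).map_smul _ _ }
  coord_symm x₀ x hx c := by
    ext (i | i)
    · simp [V.coord_symm x₀ x hx.1]
    · simp [W.coord_symm x₀ x hx.2]
  symm_coord x₀ x hx e := by
    ext
    · simp [V.symm_coord x₀ x hx.1]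
    · simp [W.symm_coord x₀ x hx.2]
  smooth_transition x₀ x₁ c := by
    rw [contMDiffOn_pi_space]
    rintro (i | i)
    · exact (contMDiffOn_pi_space.1 (V.smooth_transition x₀ x₁ fun i => c (Sum.inl i)) i).mono
        fun x hx => ⟨hx.1.1, hx.2.1⟩
    · exact (contMDiffOn_pi_space.1 (W.smooth_transition x₀ x₁ fun i => c (Sum.inr i)) i).mono
        fun x hx => ⟨hx.1.2, hx.2.2⟩

/-- Smoothness of a fibrewise linear map `V → W`: its matrix entries in local trivializations are
smooth. -/
def SmoothHom (V W : SmoothBundle E M) (f : ∀ x, V.Fib x →ₗ[ℂ] W.Fib x) : Prop :=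
  ∀ x (c : V.Idx x → ℂ), ContMDiffAt 𝓘(ℝ, E) 𝓘(ℝ, W.Idx x → ℂ) ∞
    (fun y => W.coord x y (f y (V.symm x y c))) x

theorem apply_eq_sum (V : SmoothBundle E M) (x y : M) (hy : y ∈ V.dom x)
    {A : Type*} [AddCommGroup A] [Module ℂ A] (f : V.Fib y →ₗ[ℂ] A) (e : V.Fib y) :
    f e = ∑ j, V.coord x y e j • f (V.symm x y (Pi.single j 1)) := by
  conv_lhs => rw [← V.symm_coord x y hy e, pi_eq_sum_univ' (V.coord x y e)]
  simp only [map_sum, map_smul]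

theorem SmoothHom.smoothOn {V W : SmoothBundle E M} {f : ∀ x, V.Fib x →ₗ[ℂ] W.Fib x}
    (hf : V.SmoothHom W f) {σ : ∀ x, V.Fib x} {U : Set M} (hσ : V.SmoothOn σ U) :
    W.SmoothOn (fun x => f x (σ x)) U := by
  intro x hx
  have h1 : ContMDiffAt 𝓘(ℝ, E) 𝓘(ℝ, W.Idx x → ℂ) ∞
      (fun y => ∑ j, (V.coord x y (σ y) j) • W.coord x y (f y (V.symm x y (Pi.single j 1)))) x := by
    refine contMDiffAt_finsetSum fun j _ => ?_
    rw [contMDiffAt_pi_space]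
    intro i
    exact ((contDiff_mul (𝕜 := ℝ) (𝔸 := ℂ)).contMDiff.contMDiffAt).comp x
      ((contMDiffAt_pi_space.1 (hσ x hx) j).prodMk_space
        (contMDiffAt_pi_space.1 (hf x (Pi.single j 1)) i))
  refine h1.congr_of_eventuallyEq ?_
  filter_upwards [(V.isOpen_dom x).mem_nhds (V.mem_dom x)] with y hy
  exact V.apply_eq_sum x y hy ((W.coord x y) ∘ₗ (f y)) (σ y)

theorem smoothOn_sum_iff {V W : SmoothBundle E M} {σ : ∀ x, (V.sum W).Fib x} {U : Set M} :
    (V.sum W).SmoothOn σ U ↔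
      V.SmoothOn (fun x => (σ x).1) U ∧ W.SmoothOn (fun x => (σ x).2) U := by
  refine ⟨fun h => ⟨fun x hx => ?_, fun x hx => ?_⟩, fun h x hx => ?_⟩
  · exact contMDiffAt_pi_space.2 fun i => contMDiffAt_pi_space.1 (h x hx) (Sum.inl i)
  · exact contMDiffAt_pi_space.2 fun i => contMDiffAt_pi_space.1 (h x hx) (Sum.inr i)
  · refine contMDiffAt_pi_space.2 ?_
    rintro (i | i)
    · exact contMDiffAt_pi_space.1 (h.1 x hx) i
    · exact contMDiffAt_pi_space.1 (h.2 x hx) i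

theorem smoothOn_zero (V : SmoothBundle E M) (U : Set M) : V.SmoothOn 0 U := by
  intro x _
  simpa using contMDiffAt_const

theorem smoothOn_frame (V : SmoothBundle E M) (x₀ : M) (j : V.Idx x₀) :
    V.SmoothOn (V.frame x₀ j) (V.dom x₀) := fun x hx =>
  (V.smooth_transition x₀ x (Pi.single j 1)).contMDiffAt
    (((V.isOpen_dom x₀).inter (V.isOpen_dom x)).mem_nhds ⟨hx, V.mem_dom x⟩)

/-- Smooth isomorphisms of vector bundles (covering the identity of `M`). -/
structure Iso (V W : SmoothBundle E M) where
  toEquiv : ∀ x, V.Fib x ≃ₗ[ℂ] W.Fib x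
  smooth : V.SmoothHom W fun x => (toEquiv x).toLinearMap
  smooth_symm : W.SmoothHom V fun x => (toEquiv x).symm.toLinearMap

/-- The direct sum of two isomorphisms. -/
def Iso.sum {V W V' W' : SmoothBundle E M} (f : V.Iso W) (g : V'.Iso W') :
    (V.sum V').Iso (W.sum W') where
  toEquiv x := (f.toEquiv x).prodCongr (g.toEquiv x)
  smooth x c := by
    refine contMDiffAt_pi_space.2 ?_
    rintro (i | i)
    · exact contMDiffAt_pi_space.1 (f.smooth x fun i => c (Sum.inl i)) i
    · exact contMDiffAt_pi_space.1 (g.smooth x fun i => c (Sum.inr i)) i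
  smooth_symm x c := by
    refine contMDiffAt_pi_space.2 ?_
    rintro (i | i)
    · exact contMDiffAt_pi_space.1 (f.smooth_symm x fun i => c (Sum.inl i)) i
    · exact contMDiffAt_pi_space.1 (g.smooth_symm x fun i => c (Sum.inr i)) i

/-- Two isomorphisms are isotopic if there is a smooth homotopy, parametrized by `[0, 1]`, between
them through isomorphisms. -/
def Iso.Isotopic {V W : SmoothBundle E M} (f g : V.Iso W) : Prop :=
  ∃ h : ℝ → V.Iso W,
    (∀ x e, (h 0).toEquiv x e = f.toEquiv x e) ∧ (∀ x e, (h 1).toEquiv x e = g.toEquiv x e) ∧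
    ∀ t ∈ Icc (0 : ℝ) 1, ∀ (x : M) (c : V.Idx x → ℂ),
      ContMDiffWithinAt (𝓘(ℝ, ℝ).prod 𝓘(ℝ, E)) 𝓘(ℝ, W.Idx x → ℂ) ∞
        (fun p : ℝ × M => W.coord x p.2 ((h p.1).toEquiv p.2 (V.symm x p.2 c)))
        (Icc (0 : ℝ) 1 ×ˢ univ) (t, x)

end SmoothBundle

/-! ## Connections -/

/-- Endomorphisms of `ℂ^n`. -/
abbrev EndC (n : Type) [Fintype n] : Type := (n → ℂ) →L[ℂ] (n → ℂ)

theorem contDiffAt_chart_symm {F : Type*} [NormedAddCommGroup F] [NormedSpace ℝ F] {g : M → F}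
    {x : M} (h : ContMDiffAt 𝓘(ℝ, E) 𝓘(ℝ, F) ∞ g x) :
    ContDiffAt ℝ ∞ (fun z => g ((chartAt E x).symm z)) (chartAt E x x) := by
  rw [contMDiffAt_iff] at h
  have h2 := h.2
  simp only [mfld_simps, Function.comp_def] at h2
  exact h2

/-- The coordinate vector field of the chart around `x₀` with constant coordinates `w : E`, at the
point with coordinates `z : E`. -/
def coordVec (x₀ : M) (z : E) : E →L[ℝ] TangentSpace 𝓘(ℝ, E) ((chartAt E x₀).symm z) :=
  mfderiv 𝓘(ℝ, E) 𝓘(ℝ, E) (chartAt E x₀).symm z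

/-- A connection on a complex vector bundle: `toFun σ x w` is the covariant derivative of the
section `σ` at `x` along the tangent vector `w`. The operator acts on local sections: if `σ` is
smooth on an open set `U`, then so is its covariant derivative, and on `U` additivity and the
Leibniz rule for smooth complex functions hold (this contains `ℂ`-linearity and locality). Values on
non-smooth sections are irrelevant. -/
structure Connection (V : SmoothBundle E M) where
  toFun : (∀ x, V.Fib x) → ∀ x, TangentSpace 𝓘(ℝ, E) x →ₗ[ℝ] V.Fib x
  add : ∀ (U : Set M), IsOpen U → ∀ σ τ : ∀ x, V.Fib x, V.SmoothOn σ U → V.SmoothOn τ U →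
    ∀ x ∈ U, toFun (σ + τ) x = toFun σ x + toFun τ x
  leibniz : ∀ (U : Set M), IsOpen U → ∀ (g : M → ℂ) (σ : ∀ x, V.Fib x),
    ContMDiffOn 𝓘(ℝ, E) 𝓘(ℝ, ℂ) ∞ g U → V.SmoothOn σ U → ∀ x ∈ U, ∀ w : TangentSpace 𝓘(ℝ, E) x,
    toFun (fun y => g y • σ y) x w =
      mvfderiv 𝓘(ℝ, E) g x w • σ x + g x • toFun σ x w
  smooth : ∀ (U : Set M), IsOpen U → ∀ σ : ∀ x, V.Fib x, V.SmoothOn σ U → ∀ x ∈ U, ∀ w : E,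
    ContDiffAt ℝ ∞ (fun z => V.coord x ((chartAt E x).symm z)
      (toFun σ ((chartAt E x).symm z) (coordVec x z w))) (chartAt E x x)

namespace Connection

variable {V W : SmoothBundle E M}

/-- Two connections are the same if they agree on all local smooth sections. -/
def Same (D D' : Connection V) : Prop :=
  ∀ U : Set M, IsOpen U → ∀ σ, V.SmoothOn σ U → ∀ x ∈ U, D.toFun σ x = D'.toFun σ x

/-- A fibrewise linear map is parallel if it commutes with the covariant derivatives. -/
def Parallel (D : Connection V) (D' : Connection W) (f : ∀ x, V.Fib x →ₗ[ℂ] W.Fib x) : Prop :=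
  ∀ U : Set M, IsOpen U → ∀ σ, V.SmoothOn σ U → ∀ x ∈ U, ∀ w,
    D'.toFun (fun y => f y (σ y)) x w = f x (D.toFun σ x w)

/-- The pulled back connection `f^* D = f⁻¹ ∘ D ∘ f`, for an isomorphism `f`. -/
def pullback (D : Connection W) (f : V.Iso W) : Connection V where
  toFun σ x := ((f.toEquiv x).symm.toLinearMap.restrictScalars ℝ) ∘ₗ
    D.toFun (fun y => f.toEquiv y (σ y)) x
  add U hU σ τ hσ hτ x hx := by
    have h := D.add U hU _ _ (f.smooth.smoothOn hσ) (f.smooth.smoothOn hτ) x hx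
    have h' : (fun y => f.toEquiv y ((σ + τ) y)) =
        (fun y => (f.toEquiv y).toLinearMap (σ y)) + fun y => (f.toEquiv y).toLinearMap (τ y) := by
      funext y
      simp
    rw [h', h, LinearMap.comp_add]
    rfl
  leibniz U hU g σ hg hσ x hx w := by
    have h := D.leibniz U hU g _ hg (f.smooth.smoothOn hσ) x hx w
    have h' : (fun y => f.toEquiv y (g y • σ y)) =
        fun y => g y • (f.toEquiv y).toLinearMap (σ y) := by
      funext y
      simp
    rw [h']
    simp only [LinearMap.comp_apply, LinearMap.restrictScalars_apply, h]
    simp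
  smooth U hU σ hσ x hx w := by
    have h := D.smooth U hU _ (f.smooth.smoothOn hσ) x hx w
    have h1 : ContDiffAt ℝ ∞ (fun z => ∑ j,
        (W.coord x ((chartAt E x).symm z)
          (D.toFun (fun y => f.toEquiv y (σ y)) ((chartAt E x).symm z) (coordVec x z w)) j) •
        V.coord x ((chartAt E x).symm z) ((f.toEquiv ((chartAt E x).symm z)).symm
          (W.symm x ((chartAt E x).symm z) (Pi.single j 1)))) (chartAt E x x) := by
      refine ContDiffAt.sum fun j _ => contDiffAt_pi.2 fun i => ?_
      exact (contDiffAt_pi.1 h j).mul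
        (contDiffAt_pi.1 (contDiffAt_chart_symm (f.smooth_symm x (Pi.single j 1))) i)
    refine h1.congr_of_eventuallyEq ?_
    have hc : ContinuousAt (chartAt E x).symm (chartAt E x x) :=
      (chartAt E x).continuousAt_symm (mem_chart_target E x)
    have hd := hc.preimage_mem_nhds (t := W.dom x) (by
      rw [(chartAt E x).left_inv (mem_chart_source E x)]
      exact (W.isOpen_dom x).mem_nhds (W.mem_dom x))
    filter_upwards [hd] with z hz
    exact W.apply_eq_sum x _ hz ((V.coord x _) ∘ₗ (f.toEquiv _).symm.toLinearMap) _

theorem toFun_zero (D : Connection V) (x : M) : D.toFun 0 x = 0 := by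
  have h := D.add univ isOpen_univ 0 0 (V.smoothOn_zero _) (V.smoothOn_zero _) x (mem_univ x)
  simpa using h

/-- The direct sum connection. -/
def sum (D : Connection V) (D' : Connection W) : Connection (V.sum W) where
  toFun σ x := (D.toFun (fun y => (σ y).1) x).prod (D'.toFun (fun y => (σ y).2) x)
  add U hU σ τ hσ hτ x hx := by
    rw [SmoothBundle.smoothOn_sum_iff] at hσ hτ
    have h1 := D.add U hU _ _ hσ.1 hτ.1 x hx
    have h2 := D'.add U hU _ _ hσ.2 hτ.2 x hx
    ext w
    · exact LinearMap.congr_fun h1 w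
    · exact LinearMap.congr_fun h2 w
  leibniz U hU g σ hg hσ x hx w := by
    rw [SmoothBundle.smoothOn_sum_iff] at hσ
    exact Prod.ext (D.leibniz U hU g _ hg hσ.1 x hx w) (D'.leibniz U hU g _ hg hσ.2 x hx w)
  smooth U hU σ hσ x hx w := by
    rw [SmoothBundle.smoothOn_sum_iff] at hσ
    refine contDiffAt_pi.2 ?_
    rintro (i | i)
    · exact contDiffAt_pi.1 (D.smooth U hU _ hσ.1 x hx w) i
    · exact contDiffAt_pi.1 (D'.smooth U hU _ hσ.2 x hx w) i

variable [FiniteDimensional ℝ E]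

/-- The connection form of `D` in the chart and the frame around `x₀`: the matrix-valued one-form
`A` with `D frame_j = ∑ i, A_ij frame_i`, i.e. the endomorphism `A(w)` maps the basis vector `e_j`
to the coordinates of the derivative of `frame_j` along `w`. It is written in the coordinates `z` of
the chart. -/
def connForm (D : Connection V) (x₀ : M) (z : E) : E →L[ℝ] EndC (V.Idx x₀) :=
  LinearMap.toContinuousLinearMap
    { toFun := fun w => ∑ j, (ContinuousLinearMap.proj (R := ℂ) (φ := fun _ => ℂ) j).smulRight
        (V.coord x₀ ((chartAt E x₀).symm z)
          (D.toFun (V.frame x₀ j) ((chartAt E x₀).symm z) (coordVec x₀ z w)))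
      map_add' := fun w w' => by
        ext c i
        simp [Finset.sum_add_distrib]
      map_smul' := fun a w => by
        ext c i
        simp [Finset.mul_sum, mul_left_comm] }

/-- The curvature `dA + A ∧ A` of `D` in the chart and the frame around `x₀`:
`Ω(w, w') = (∂_w A)(w') - (∂_w' A)(w) + A(w) A(w') - A(w') A(w)`. -/
def curvForm (D : Connection V) (x₀ : M) (z : E) : E →L[ℝ] E →L[ℝ] EndC (V.Idx x₀) :=
  let B := fderiv ℝ (D.connForm x₀) z +
    (ContinuousLinearMap.mul ℝ (EndC (V.Idx x₀))).bilinearComp (D.connForm x₀ z) (D.connForm x₀ z)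
  B - B.flip

/-- A connection is flat if its curvature vanishes at every point. -/
def Flat (D : Connection V) : Prop :=
  ∀ x : M, D.curvForm x (chartAt E x x) = 0

theorem connForm_apply (D : Connection V) (x₀ : M) (z w : E) (c : V.Idx x₀ → ℂ) :
    D.connForm x₀ z w c = ∑ j, c j • V.coord x₀ ((chartAt E x₀).symm z)
      (D.toFun (V.frame x₀ j) ((chartAt E x₀).symm z) (coordVec x₀ z w)) := by
  simp [connForm]

theorem curvForm_apply (D : Connection V) (x₀ : M) (z w w' : E) :
    D.curvForm x₀ z w w' =
      fderiv ℝ (D.connForm x₀) z w w' - fderiv ℝ (D.connForm x₀) z w' w +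
        D.connForm x₀ z w * D.connForm x₀ z w' - D.connForm x₀ z w' * D.connForm x₀ z w := by
  simp [curvForm]
  abel

theorem differentiableAt_connForm (D : Connection V) (x : M) :
    DifferentiableAt ℝ (D.connForm x) (chartAt E x x) := by
  have key : ∀ w : E, DifferentiableAt ℝ (fun z => D.connForm x z w) (chartAt E x x) := by
    intro w
    have h1 : ∀ j, DifferentiableAt ℝ (fun z => V.coord x ((chartAt E x).symm z)
        (D.toFun (V.frame x j) ((chartAt E x).symm z) (coordVec x z w))) (chartAt E x x) :=
      fun j => (D.smooth _ (V.isOpen_dom x) _ (V.smoothOn_frame x j) x (V.mem_dom x) w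
        ).differentiableAt (by simp)
    have h2 : (fun z => D.connForm x z w) = fun z => ∑ j,
        ((ContinuousLinearMap.smulRightL ℂ (V.Idx x → ℂ) (V.Idx x → ℂ)
          (ContinuousLinearMap.proj (R := ℂ) (φ := fun _ => ℂ) j)).restrictScalars ℝ)
          (V.coord x ((chartAt E x).symm z)
            (D.toFun (V.frame x j) ((chartAt E x).symm z) (coordVec x z w))) := rfl
    rw [h2]
    exact DifferentiableAt.fun_sum fun j _ =>
      (ContinuousLinearMap.differentiableAt _).comp _ (h1 j)
  let b := Module.finBasis ℝ E
  have h3 : D.connForm x = fun z => ∑ i,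
      (ContinuousLinearMap.smulRightL ℝ E (EndC (V.Idx x))
        (LinearMap.toContinuousLinearMap (b.coord i))) (D.connForm x z (b i)) := by
    funext z
    ext1 w
    conv_lhs => rw [← b.sum_repr w, map_sum]
    simp
  rw [h3]
  exact DifferentiableAt.fun_sum fun i _ =>
    (ContinuousLinearMap.differentiableAt _).comp _ (key (b i))

end Connection

section Block

variable (n m : Type) [Fintype n] [Fintype m]

/-- The upper left diagonal block, as a map from endomorphisms of `ℂ^n` to endomorphisms of
`ℂ^(n ⊕ m)`. -/
def blockL : EndC n →L[ℝ] EndC (n ⊕ m) :=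
  ((ContinuousLinearMap.compL ℂ (n ⊕ m → ℂ) (n → ℂ) (n ⊕ m → ℂ)
      (ContinuousLinearMap.pi (Sum.elim (fun i => ContinuousLinearMap.proj i) fun _ => 0))).comp
    ((ContinuousLinearMap.compL ℂ (n ⊕ m → ℂ) (n → ℂ) (n → ℂ)).flip
      (ContinuousLinearMap.pi fun i => ContinuousLinearMap.proj (Sum.inl i)))).restrictScalars ℝ

/-- The lower right diagonal block, as a map from endomorphisms of `ℂ^m` to endomorphisms of
`ℂ^(n ⊕ m)`. -/
def blockR : EndC m →L[ℝ] EndC (n ⊕ m) :=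
  ((ContinuousLinearMap.compL ℂ (n ⊕ m → ℂ) (m → ℂ) (n ⊕ m → ℂ)
      (ContinuousLinearMap.pi (Sum.elim (fun _ => 0) fun i => ContinuousLinearMap.proj i))).comp
    ((ContinuousLinearMap.compL ℂ (n ⊕ m → ℂ) (m → ℂ) (m → ℂ)).flip
      (ContinuousLinearMap.pi fun i => ContinuousLinearMap.proj (Sum.inr i)))).restrictScalars ℝ

variable {n m}

theorem blockL_apply (P : EndC n) (c : n ⊕ m → ℂ) :
    blockL n m P c = Sum.elim (P fun i => c (Sum.inl i)) (fun _ => 0) := by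
  ext (i | i)
  · rfl
  · rfl

theorem blockR_apply (Q : EndC m) (c : n ⊕ m → ℂ) :
    blockR n m Q c = Sum.elim (fun _ => 0) (Q fun i => c (Sum.inr i)) := by
  ext (i | i)
  · rfl
  · rfl

theorem block_mul (P P' : EndC n) (Q Q' : EndC m) :
    (blockL n m P + blockR n m Q) * (blockL n m P' + blockR n m Q') =
      blockL n m (P * P') + blockR n m (Q * Q') := by
  ext c (i | i)
  · simp [blockL_apply, blockR_apply]
  · simp [blockL_apply, blockR_apply]

end Block

namespace Connection

variable {V W : SmoothBundle E M} [FiniteDimensional ℝ E]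

theorem connForm_sum (D : Connection V) (D' : Connection W) (x₀ : M) (z : E) :
    (D.sum D').connForm x₀ z =
      (blockL (V.Idx x₀) (W.Idx x₀)).comp (D.connForm x₀ z) +
        (blockR (V.Idx x₀) (W.Idx x₀)).comp (D'.connForm x₀ z) := by
  have hl : ∀ j, (fun y => ((V.sum W).frame x₀ (Sum.inl j) y).1) = V.frame x₀ j ∧
      (fun y => ((V.sum W).frame x₀ (Sum.inl j) y).2) = 0 := by
    intro j
    constructor
    · funext y
      change V.symm x₀ y _ = V.symm x₀ y _
      congr 1
      ext i
      simp [Pi.single_apply]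
    · funext y
      change W.symm x₀ y _ = 0
      convert (W.symm x₀ y).map_zero
      simp
  have hr : ∀ j, (fun y => ((V.sum W).frame x₀ (Sum.inr j) y).1) = 0 ∧
      (fun y => ((V.sum W).frame x₀ (Sum.inr j) y).2) = W.frame x₀ j := by
    intro j
    constructor
    · funext y
      change V.symm x₀ y _ = 0
      convert (V.symm x₀ y).map_zero
      simp
    · funext y
      change W.symm x₀ y _ = W.symm x₀ y _
      congr 1
      ext i
      simp [Pi.single_apply]
  ext1 w
  ext1 c
  rw [connForm_apply]
  simp only [add_apply, ContinuousLinearMap.comp_apply, blockL_apply, blockR_apply,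
    connForm_apply]
  simp only [SmoothBundle.sum, Connection.sum, LinearMap.coe_mk, AddHom.coe_mk,
    LinearMap.prod_apply, Function.prod_apply, Fintype.sum_sum_type]
  simp only [(hl _).1, (hl _).2, (hr _).1, (hr _).2, toFun_zero]
  ext (i | i)
  · simp
  · simp

theorem curvForm_sum (D : Connection V) (D' : Connection W) (x : M) (w w' : E) :
    (D.sum D').curvForm x (chartAt E x x) w w' =
      blockL (V.Idx x) (W.Idx x) (D.curvForm x (chartAt E x x) w w') +
        blockR (V.Idx x) (W.Idx x) (D'.curvForm x (chartAt E x x) w w') := by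
  have h : HasFDerivAt ((D.sum D').connForm x)
      ((ContinuousLinearMap.compL ℝ E _ _ (blockL (V.Idx x) (W.Idx x))).comp
          (fderiv ℝ (D.connForm x) (chartAt E x x)) +
        (ContinuousLinearMap.compL ℝ E _ _ (blockR (V.Idx x) (W.Idx x))).comp
          (fderiv ℝ (D'.connForm x) (chartAt E x x))) (chartAt E x x) := by
    have h1 := ((ContinuousLinearMap.compL ℝ E _ _ (blockL (V.Idx x) (W.Idx x))).hasFDerivAt).comp
      (chartAt E x x) (D.differentiableAt_connForm x).hasFDerivAt
    have h2 := ((ContinuousLinearMap.compL ℝ E _ _ (blockR (V.Idx x) (W.Idx x))).hasFDerivAt).comp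
      (chartAt E x x) (D'.differentiableAt_connForm x).hasFDerivAt
    have h3 := h1.add h2
    have h4 : (D.sum D').connForm x = _ := funext fun z => connForm_sum D D' x z
    rw [h4]
    exact h3
  rw [curvForm_apply, curvForm_apply, curvForm_apply, h.fderiv, connForm_sum]
  simp only [add_apply, ContinuousLinearMap.comp_apply,
    ContinuousLinearMap.compL_apply, map_sub, map_add]
  rw [block_mul, block_mul]
  abel

/-- The direct sum of flat connections is flat. -/
theorem Flat.sum {D : Connection V} {D' : Connection W} (h : D.Flat) (h' : D'.Flat) :
    (D.sum D').Flat := by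
  intro x
  ext1 w
  ext1 w'
  rw [curvForm_sum, h x, h' x]
  simp

end Connection
/-- A smooth path `∇_t`, `t ∈ [0, 1]`, of connections from `D₀` to `D₁`: the derivative `∇_t σ (x)`
of every local smooth section is smooth in `(t, x)`. (Equivalently: a connection, without `dt`
component, on the pull-back of the bundle to `M × [0, 1]`, restricting to `D₀` and `D₁` at the
ends.) Only the values for `t ∈ [0, 1]` matter. -/
structure ConnPath {V : SmoothBundle E M} (D₀ D₁ : Connection V) where
  conn : ℝ → Connection V
  source : (conn 0).Same D₀
  target : (conn 1).Same D₁
  smooth : ∀ (U : Set M), IsOpen U → ∀ σ : ∀ x, V.Fib x, V.SmoothOn σ U → ∀ x ∈ U, ∀ w : E,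
    ∀ t ∈ Icc (0 : ℝ) 1, ContDiffWithinAt ℝ ∞
      (fun p : ℝ × E => V.coord x ((chartAt E x).symm p.2)
        ((conn p.1).toFun σ ((chartAt E x).symm p.2) (coordVec x p.2 w)))
      (Icc (0 : ℝ) 1 ×ˢ univ) (t, chartAt E x x)

end Bundles

/-! ## Differential forms and de Rham cohomology -/

section Forms

variable (E : Type u) [NormedAddCommGroup E] [NormedSpace ℝ E]
  (M : Type v) [TopologicalSpace M] [ChartedSpace E M]

/-- Complex-valued forms of degree `k` on `M` (no smoothness). -/
abbrev Form (k : ℕ) : Type (max u v) := ∀ x : M, TangentSpace 𝓘(ℝ, E) x [⋀^Fin k]→L[ℝ] ℂ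

variable {E M}

/-- The expression of a form in the chart around `x₀`, a form on the model space. -/
def Form.inChart {k : ℕ} (α : Form E M k) (x₀ : M) (z : E) : E [⋀^Fin k]→L[ℝ] ℂ :=
  (α ((chartAt E x₀).symm z)).compContinuousLinearMap (coordVec x₀ z)

/-- Smoothness of a form: its expression in each chart is smooth. -/
def Form.Smooth {k : ℕ} (α : Form E M k) : Prop :=
  ∀ x₀ : M, ContDiffOn ℝ ∞ (α.inChart x₀) (chartAt E x₀).target

/-- The differential at `x` of the chart around `x`. -/
def chartDiff (x : M) : TangentSpace 𝓘(ℝ, E) x →L[ℝ] E :=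
  mfderiv 𝓘(ℝ, E) 𝓘(ℝ, E) (chartAt E x) x

/-- The exterior derivative, computed at `x` in the chart around `x`. -/
def Form.d {k : ℕ} (α : Form E M k) : Form E M (k + 1) := fun x =>
  (extDeriv (α.inChart x) (chartAt E x x)).compContinuousLinearMap (chartDiff x)

theorem Form.Smooth.differentiableAt {k : ℕ} {α : Form E M k} (h : α.Smooth) (x : M) :
    DifferentiableAt ℝ (α.inChart x) (chartAt E x x) :=
  ((h x).contDiffAt ((chartAt E x).open_target.mem_nhds (mem_chart_target E x))).differentiableAt
    (by simp)

theorem Form.Smooth.add {k : ℕ} {α β : Form E M k} (hα : α.Smooth) (hβ : β.Smooth) :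
    (α + β).Smooth := fun x₀ => (hα x₀).add (hβ x₀)

theorem Form.Smooth.smul {k : ℕ} {α : Form E M k} (c : ℂ) (hα : α.Smooth) :
    (c • α).Smooth := fun x₀ => (hα x₀).const_smul c

theorem Form.smooth_zero (k : ℕ) : (0 : Form E M k).Smooth := fun _ => contDiffOn_const (c := 0)

theorem Form.d_add {k : ℕ} {α β : Form E M k} (hα : α.Smooth) (hβ : β.Smooth) :
    (α + β).d = α.d + β.d := by
  funext x
  have h : (α + β).inChart x = α.inChart x + β.inChart x := rfl
  simp only [Form.d, h, extDeriv_add (hα.differentiableAt x) (hβ.differentiableAt x)]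
  rfl

theorem Form.d_smul {k : ℕ} {α : Form E M k} (c : ℂ) (hα : α.Smooth) :
    (c • α).d = c • α.d := by
  funext x
  have h : (c • α).inChart x = c • α.inChart x := rfl
  have h2 : extDeriv (c • α.inChart x) (chartAt E x x) =
      c • extDeriv (α.inChart x) (chartAt E x x) := by
    rw [extDeriv, fderiv_const_smul (hα.differentiableAt x) c,
      ContinuousAlternatingMap.alternatizeUncurryFin_smul]
    rfl
  simp only [Form.d, h, h2]
  rfl

theorem Form.d_zero (k : ℕ) : (0 : Form E M k).d = 0 := by
  have h := Form.d_add (Form.smooth_zero (E := E) (M := M) k) (Form.smooth_zero k)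
  simpa using h

variable (E M)

/-- Closed smooth forms. -/
def closedForms (k : ℕ) : Submodule ℂ (Form E M k) where
  carrier := {α | α.Smooth ∧ α.d = 0}
  add_mem' := fun {α β} hα hβ => ⟨hα.1.add hβ.1, by rw [Form.d_add hα.1 hβ.1, hα.2, hβ.2, add_zero]⟩
  zero_mem' := ⟨Form.smooth_zero k, Form.d_zero k⟩
  smul_mem' := fun c α hα => ⟨hα.1.smul c, by rw [Form.d_smul c hα.1, hα.2, smul_zero]⟩

/-- Exact forms: exterior derivatives of smooth forms (only `0` in degree `0`). -/
def exactForms : (k : ℕ) → Submodule ℂ (Form E M k)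
  | 0 => ⊥
  | k + 1 =>
    { carrier := {α | ∃ β : Form E M k, β.Smooth ∧ β.d = α}
      add_mem' := by
        rintro _ _ ⟨β, hβ, rfl⟩ ⟨γ, hγ, rfl⟩
        exact ⟨β + γ, hβ.add hγ, Form.d_add hβ hγ⟩
      zero_mem' := ⟨0, Form.smooth_zero k, Form.d_zero k⟩
      smul_mem' := by
        rintro c _ ⟨β, hβ, rfl⟩
        exact ⟨c • β, hβ.smul c, Form.d_smul c hβ⟩ }

/-- De Rham cohomology `H^k(M, ℂ)`: closed forms modulo exact forms. -/
abbrev DeRham (k : ℕ) : Type (max u v) :=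
  closedForms E M k ⧸ (exactForms E M k).submoduleOf (closedForms E M k)

/-- `H^odd(M, ℂ)`, the sum of all `H^(2k+1)(M, ℂ)`. Since there are no nonzero forms of degree
larger than the dimension, the product is the direct sum. -/
abbrev HOdd : Type (max u v) := ∀ k : ℕ, DeRham E M (2 * k + 1)

variable {E M}

/-- The class in `H^odd(M, ℂ)` of a closed odd form, given by its components of degree `2k+1`. -/
def oddClass (α : ∀ k : ℕ, Form E M (2 * k + 1)) (hα : ∀ k, α k ∈ closedForms E M (2 * k + 1)) :
    HOdd E M := fun k => Submodule.Quotient.mk ⟨α k, hα k⟩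

end Forms

/-! ## The Chern-Simons form -/

section ChernSimons

variable {E : Type u} [NormedAddCommGroup E] [NormedSpace ℝ E]

/-- The multilinear map `(v₀, …, v_2k) ↦ A(v₀) R(v₁, v₂) ⋯ R(v_(2k-1), v_2k)`. -/
def chain {𝔸 : Type} [NormedRing 𝔸] [NormedAlgebra ℝ 𝔸] (A : E →L[ℝ] 𝔸)
    (R : E →L[ℝ] E →L[ℝ] 𝔸) :
    (k : ℕ) → ContinuousMultilinearMap ℝ (fun _ : Fin (2 * k + 1) => E) 𝔸
  | 0 => ContinuousMultilinearMap.ofSubsingleton ℝ E 𝔸 (0 : Fin 1) A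
  | k + 1 =>
    let L : 𝔸 →L[ℝ] E →L[ℝ] E →L[ℝ] 𝔸 :=
      ((ContinuousLinearMap.compL ℝ E (E →L[ℝ] 𝔸) (E →L[ℝ] 𝔸)).comp
        ((ContinuousLinearMap.compL ℝ E 𝔸 𝔸).comp (ContinuousLinearMap.mul ℝ 𝔸))).flip R
    (L.compContinuousMultilinearMap (chain A R k)).uncurryRight.uncurryRight

theorem chain_zero {𝔸 : Type} [NormedRing 𝔸] [NormedAlgebra ℝ 𝔸] (A : E →L[ℝ] 𝔸)
    (R : E →L[ℝ] E →L[ℝ] 𝔸) (v : Fin (2 * 0 + 1) → E) : chain A R 0 v = A (v 0) := rfl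

theorem chain_succ {𝔸 : Type} [NormedRing 𝔸] [NormedAlgebra ℝ 𝔸] (A : E →L[ℝ] 𝔸)
    (R : E →L[ℝ] E →L[ℝ] 𝔸) (k : ℕ) (v : Fin (2 * (k + 1) + 1) → E) :
    chain A R (k + 1) v = chain A R k (Fin.init (Fin.init v)) *
      R (v (Fin.last (2 * k + 1)).castSucc) (v (Fin.last (2 * k + 2))) := rfl

/-- The trace of an endomorphism of `ℂ^n`. -/
def traceC (n : Type) [Fintype n] [DecidableEq n] : EndC n →L[ℝ] ℂ :=
  (∑ i, (ContinuousLinearMap.proj (R := ℂ) (φ := fun _ : n => ℂ) i).comp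
    (ContinuousLinearMap.apply ℂ (n → ℂ) (Pi.single i 1))).restrictScalars ℝ

theorem traceC_apply {n : Type} [Fintype n] [DecidableEq n] (f : EndC n) :
    traceC n f = LinearMap.trace ℂ (n → ℂ) f.toLinearMap := by
  rw [LinearMap.trace_eq_matrix_trace ℂ (Pi.basisFun ℂ n)]
  simp [traceC, Matrix.trace]

/-- The degree `2k+1` component of `-(2πi)⁻¹ Tr (A ∧ exp (-(2πi)⁻¹ R))`, that is
`(-(2πi)⁻¹)^(k+1) (k!)⁻¹ Tr (A ∧ R ∧ ⋯ ∧ R)`, for a matrix-valued one-form `A` and a matrix-valued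
two-form `R`. The wedge product is normalized by
`(A ∧ R ∧ ⋯ ∧ R)(v₀, …, v_2k) = 2^(-k) ∑_s sign(s) A(v_s(0)) R(v_s(1), v_s(2)) ⋯`. -/
def csDensity {n : Type} [Fintype n] [DecidableEq n] (A : E →L[ℝ] EndC n)
    (R : E →L[ℝ] E →L[ℝ] EndC n) (k : ℕ) : E [⋀^Fin (2 * k + 1)]→L[ℝ] ℂ :=
  ((-(2 * (Real.pi : ℂ) * Complex.I)⁻¹) ^ (k + 1) * (k.factorial : ℂ)⁻¹ * ((2 : ℂ) ^ k)⁻¹) •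
    ContinuousMultilinearMap.alternatization
      ((traceC n).compContinuousMultilinearMap (chain A R k))

variable [FiniteDimensional ℝ E]
  {M : Type v} [TopologicalSpace M] [ChartedSpace E M]

/-- The degree `2k+1` component of the Chern-Simons form of a path `∇_t` of connections,
`-(2πi)⁻¹ ∫₀¹ Tr ((∂∇_t/∂t) exp (-(2πi)⁻¹ ∇_t²)) dt`.
At the point `x` it is computed in the chart and the frame around `x`. -/
def ConnPath.csForm {V : SmoothBundle E M} {D₀ D₁ : Connection V} (P : ConnPath D₀ D₁) (k : ℕ) :
    Form E M (2 * k + 1) := fun x =>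
  (∫ t in (0 : ℝ)..1,
    csDensity (derivWithin (fun s => (P.conn s).connForm x (chartAt E x x)) (Icc 0 1) t)
      ((P.conn t).curvForm x (chartAt E x x)) k).compContinuousLinearMap (chartDiff x)

end ChernSimons

/-! ## Relative K-theory -/

section Relative

variable (E : Type u) [NormedAddCommGroup E] [NormedSpace ℝ E] [FiniteDimensional ℝ E]
  (M : Type v) [TopologicalSpace M] [ChartedSpace E M]

/-- Flat vector bundles `(E, ∇_E)`. -/
structure FlatBundle where
  bundle : SmoothBundle E M
  conn : Connection bundle
  flat : conn.Flat

/-- Quintuples `(E, ∇_E, F, ∇_F, f)`: two flat vector bundles and a smooth isomorphism. -/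
structure Quintuple where
  src : FlatBundle E M
  tgt : FlatBundle E M
  iso : src.bundle.Iso tgt.bundle

variable {E M}

/-- The direct sum of flat bundles. -/
def FlatBundle.sum (A B : FlatBundle E M) : FlatBundle E M where
  bundle := A.bundle.sum B.bundle
  conn := A.conn.sum B.conn
  flat := A.flat.sum B.flat

/-- The direct sum of quintuples. -/
def Quintuple.sum (Q Q' : Quintuple E M) : Quintuple E M where
  src := Q.src.sum Q'.src
  tgt := Q.tgt.sum Q'.tgt
  iso := Q.iso.sum Q'.iso

/-- A short exact sequence `0 → E' → E → E'' → 0` of flat bundles: `i` and `p` are smooth parallel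
bundle maps, and the sequence is exact on each fibre. -/
structure ShortExact (E' E₀ E'' : FlatBundle E M)
    (i : ∀ x, E'.bundle.Fib x →ₗ[ℂ] E₀.bundle.Fib x)
    (p : ∀ x, E₀.bundle.Fib x →ₗ[ℂ] E''.bundle.Fib x) : Prop where
  smooth_i : E'.bundle.SmoothHom E₀.bundle i
  smooth_p : E₀.bundle.SmoothHom E''.bundle p
  parallel_i : E'.conn.Parallel E₀.conn i
  parallel_p : E₀.conn.Parallel E''.conn p
  injective : ∀ x, Function.Injective (i x)
  exact : ∀ x, Function.Exact (i x) (p x)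
  surjective : ∀ x, Function.Surjective (p x)

/-- The defining relations of the relative K-group, as elements that are to vanish. -/
inductive KRelation : FreeAbelianGroup (Quintuple E M) → Prop
  /-- `(E, ∇_E, F, ∇_F, f) = 0` if `f` is isotopic to a parallel isomorphism. -/
  | parallel (Q : Quintuple E M) (g : Q.src.bundle.Iso Q.tgt.bundle)
      (hg : Q.src.conn.Parallel Q.tgt.conn fun x => (g.toEquiv x).toLinearMap)
      (h : Q.iso.Isotopic g) : KRelation (FreeAbelianGroup.of Q)
  /-- Additivity for direct sums. -/
  | sum (Q Q' : Quintuple E M) :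
      KRelation (FreeAbelianGroup.of Q + FreeAbelianGroup.of Q' - FreeAbelianGroup.of (Q.sum Q'))
  /-- `(E, ∇_E, E' ⊕ E'', ∇_E' ⊕ ∇_E'', s ⊕ p) = 0` for a short exact sequence of flat bundles
  `0 → E' → E → E'' → 0` and a smooth bundle map `s : E → E'` with `s ∘ i = id`. -/
  | exact (E' E₀ E'' : FlatBundle E M)
      (i : ∀ x, E'.bundle.Fib x →ₗ[ℂ] E₀.bundle.Fib x)
      (p : ∀ x, E₀.bundle.Fib x →ₗ[ℂ] E''.bundle.Fib x) (h : ShortExact E' E₀ E'' i p)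
      (s : ∀ x, E₀.bundle.Fib x →ₗ[ℂ] E'.bundle.Fib x)
      (hs : E₀.bundle.SmoothHom E'.bundle s) (hsi : ∀ x e, s x (i x e) = e)
      (f : E₀.bundle.Iso (E'.bundle.sum E''.bundle))
      (hf : ∀ x e, f.toEquiv x e = (s x e, p x e)) :
      KRelation (FreeAbelianGroup.of ⟨E₀, E'.sum E'', f⟩)

variable (E M)

/-- The relative K-group `K⁰_rel(M)`. -/
abbrev KRel : Type (max u v 1) :=
  FreeAbelianGroup (Quintuple E M) ⧸
    AddSubgroup.closure {a : FreeAbelianGroup (Quintuple E M) | KRelation a}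

variable {E M}

/-- The class of a quintuple in `K⁰_rel(M)`. -/
def KRel.mk (Q : Quintuple E M) : KRel E M := QuotientAddGroup.mk (FreeAbelianGroup.of Q)

/-- Smooth paths of connections on `E` from `∇_E` to `f^* ∇_F`. -/
abbrev Quintuple.Path (Q : Quintuple E M) : Type (max u v) :=
  ConnPath Q.src.conn (Q.tgt.conn.pullback Q.iso)

end Relative
end RelKTheory

end

open RelKTheory

/-!
The value of the morphism on a quintuple is computed with the affine path of connections, and
everything else follows from two facts about families of connection forms.

*Closedness and independence of the path.* A family `A_t` of matrix-valued one-forms on an open set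
`U` of the model space is a connection form on `ℝ × U` without `dt` component. Its Chern character
forms `Tr Ω^(k+1)` are closed (`extDeriv_traceCurv`, by the Bianchi identity and the cyclicity of
the trace), and contracting them with `∂/∂t` gives the Chern-Simons integrand
(`contractSlice_traceCurv`), because `Ω = R_t + dt ∧ ∂A_t/∂t`. So the Chern-Simons form is the fibre
integral over `[0, 1]` of a closed form, and by Stokes' formula (`extDeriv_fibreIntegral`) its
exterior derivative is the difference of the Chern character forms at the ends, which vanish for
flat ends (`extDeriv_localCS`). Given two paths with the same flat ends, the affine interpolation
between them is a path of connection forms on `ℝ × U` with flat ends; its Chern-Simons form is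
closed on `ℝ × U`, and Stokes' formula in the interpolation parameter exhibits the difference of the
two Chern-Simons forms as the exterior derivative of `localPrim` (`extDeriv_localPrim`). Paths are
only defined for `t ∈ [0, 1]`; they are extended to `ℝ` by the reparametrization
`Real.smoothTransition`, which does not change the Chern-Simons form (`localCS_reparam`).

The identities between alternating sums behind these two facts, `sum_sign_trace_curvWordDeriv` and
`sum_sign_trace_curvWord_succ`, are proved at a point: the values of the forms on vectors
`v₀, …, v_(N-1)` are the coefficients of elements of the algebra `𝔸 ⊗ Λ(ℝ^N)` of matrix-valued
forms, where the Bianchi identity reads `dR = R A - A R` (`threeForm_bianchi`) and a sum with signs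
over all permutations is the top-degree coefficient of a product (`sum_tmul_alternating`).

All these local forms are natural under changes of coordinates and of frames (`localCS_gauge`,
`localPrim_gauge`), so they glue to forms on the manifold (`LocalForms`). The relation between the
connection forms in two frames is the special case of the identity in `connForm_gauge`, which says
that a parallel bundle map intertwines connection forms.

*The relations.* If `f` is isotopic to a parallel isomorphism, the pull-back of `∇_F` along the
isotopy `H` is a path of flat connections from `∇_E` to `f^* ∇_F`. Its Chern-Simons form vanishes in
degrees at least three, and in degree one it is, up to a constant, the derivative of
`∫ Tr (H⁻¹ ∂H/∂t) dt`, since the form `Tr (H⁻¹ dH)` on `ℝ × U` is closed (`extDeriv_logForm`,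
`SmoothIsoFamily.csForm_path_mem_exactForms`). For direct sums all matrices are block diagonal
(`localCS_block`). For a short exact sequence, `i` and `p` are parallel both for `∇_E` and for the
pull-back of `∇_E' ⊕ ∇_E''`, so the difference `a` of these connections maps the bundle to the image
of `i` and vanishes there (`connForm_sub_mul_sub_eq_zero`); hence `Tr a = 0` and all connections on
the affine path are flat, and its Chern-Simons form is zero (`csForm_affine_eq_zero`).
-/

set_option linter.unusedSectionVars false

noncomputable section

namespace RelKTheory

/-! ### Matrix-valued forms as elements of a Grassmann algebra -/

section Words

variable {𝔸 : Type*} [Ring 𝔸] {ι : Type*}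

/-- The word `R(v₀, v₁) R(v₂, v₃) ⋯` with `m` factors. -/
def curvWord (R : ι → ι → 𝔸) : (m : ℕ) → (Fin (2 * m) → ι) → 𝔸
  | 0, _ => 1
  | m + 1, v => curvWord R m (Fin.init (Fin.init v)) *
      R (v (Fin.last (2 * m)).castSucc) (v (Fin.last (2 * m + 1)))

/-- The derivative of `curvWord R m`, when `R' u` is the derivative of `R` along `u`. -/
def curvWordDeriv (R : ι → ι → 𝔸) (R' : ι → ι → ι → 𝔸) : (m : ℕ) → ι → (Fin (2 * m) → ι) → 𝔸
  | 0, _, _ => 0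
  | m + 1, u, v => curvWordDeriv R R' m u (Fin.init (Fin.init v)) *
        R (v (Fin.last (2 * m)).castSucc) (v (Fin.last (2 * m + 1))) +
      curvWord R m (Fin.init (Fin.init v)) *
        R' u (v (Fin.last (2 * m)).castSucc) (v (Fin.last (2 * m + 1)))

/-- The word `a(v₀) R(v₁, v₂) R(v₃, v₄) ⋯` with `m` factors `R`. -/
def csWord (a : ι → 𝔸) (R : ι → ι → 𝔸) : (m : ℕ) → (Fin (2 * m + 1) → ι) → 𝔸
  | 0, v => a (v 0)
  | m + 1, v => csWord a R m (Fin.init (Fin.init v)) *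
      R (v (Fin.last (2 * m + 1)).castSucc) (v (Fin.last (2 * m + 2)))

theorem curvWord_comp {κ : Type*} (g : κ → ι) (R : ι → ι → 𝔸) (m : ℕ) (v : Fin (2 * m) → κ) :
    curvWord (fun i j => R (g i) (g j)) m v = curvWord R m (g ∘ v) := by
  induction m with
  | zero => rfl
  | succ m ih => simp only [curvWord, ih]; rfl

theorem curvWordDeriv_comp {κ : Type*} (g : κ → ι) (R : ι → ι → 𝔸) (R' : ι → ι → ι → 𝔸) (m : ℕ)
    (u : κ) (v : Fin (2 * m) → κ) :
    curvWordDeriv (fun i j => R (g i) (g j)) (fun i j k => R' (g i) (g j) (g k)) m u v =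
      curvWordDeriv R R' m (g u) (g ∘ v) := by
  induction m with
  | zero => rfl
  | succ m ih => simp only [curvWordDeriv, ih, curvWord_comp]; rfl

theorem csWord_comp {κ : Type*} (g : κ → ι) (a : ι → 𝔸) (R : ι → ι → 𝔸) (m : ℕ)
    (v : Fin (2 * m + 1) → κ) :
    csWord (fun i => a (g i)) (fun i j => R (g i) (g j)) m v = csWord a R m (g ∘ v) := by
  induction m with
  | zero => rfl
  | succ m ih => simp only [csWord, ih]; rfl

end Words

section Grassmann

open scoped TensorProduct
open ExteriorAlgebra (ιMulti)

variable {𝔸 : Type*} [Ring 𝔸] [Algebra ℝ 𝔸]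
variable {W : Type*} [AddCommGroup W] [Module ℝ W] {ι : Type*} [Fintype ι]

/-- An alternating map kills the multi-indices with a repetition, so a sum over all multi-indices
reduces to a sum with signs over permutations. -/
theorem sum_tmul_alternating {C : Type*} [AddCommGroup C] [Module ℝ C] {m : ℕ}
    {Λ : Type*} [AddCommGroup Λ] [Module ℝ Λ]
    (l : W [⋀^Fin m]→ₗ[ℝ] Λ) (e : Fin m → W) (f : (Fin m → Fin m) → C) :
    ∑ i, f i ⊗ₜ[ℝ] l (e ∘ i) =
      (∑ s : Equiv.Perm (Fin m), (Equiv.Perm.sign s : ℤ) • f s) ⊗ₜ[ℝ] l e := by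
  classical
  have h1 : ∑ i ∈ Finset.univ.filter (fun i : Fin m → Fin m => Function.Bijective i),
      f i ⊗ₜ[ℝ] l (e ∘ i) = ∑ i, f i ⊗ₜ[ℝ] l (e ∘ i) := by
    refine Finset.sum_subset (Finset.subset_univ _) fun i _ hi => ?_
    have hni : ¬ Function.Injective i := fun h =>
      hi (Finset.mem_filter.2 ⟨Finset.mem_univ _, Finite.injective_iff_bijective.1 h⟩)
    rw [l.map_eq_zero_of_not_injective _ fun h => hni h.of_comp, TensorProduct.tmul_zero]
  rw [← h1, TensorProduct.sum_tmul]
  symm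
  refine Finset.sum_bij (fun s _ => (s : Fin m → Fin m)) (fun s _ => ?_) (fun s _ t _ h => ?_)
    (fun i hi => ?_) (fun s _ => ?_)
  · exact Finset.mem_filter.2 ⟨Finset.mem_univ _, s.bijective⟩
  · exact Equiv.ext fun x => congrFun h x
  · exact ⟨Equiv.ofBijective i (Finset.mem_filter.1 hi).2, Finset.mem_univ _, rfl⟩
  · rw [l.map_perm, Units.smul_def, TensorProduct.tmul_smul, TensorProduct.smul_tmul']

theorem ιMulti_init {m : ℕ} (v : Fin (m + 1) → W) :
    ιMulti ℝ (m + 1) v = ιMulti ℝ m (Fin.init v) * ExteriorAlgebra.ι ℝ (v (Fin.last m)) := by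
  rw [ExteriorAlgebra.ιMulti_apply, ExteriorAlgebra.ιMulti_apply, List.ofFn_succ', List.concat_eq_append,
    List.prod_append]
  simp [Fin.init]

theorem ι_mul_ι_swap (x y : W) : ExteriorAlgebra.ι ℝ x * ExteriorAlgebra.ι ℝ y =
    -(ExteriorAlgebra.ι ℝ y * ExteriorAlgebra.ι ℝ x) :=
  eq_neg_of_add_eq_zero_left (ExteriorAlgebra.ι_add_mul_swap x y)

theorem commute_ι_ιMulti_even (x : W) (m : ℕ) (v : Fin (2 * m) → W) :
    ExteriorAlgebra.ι ℝ x * ιMulti ℝ (2 * m) v = ιMulti ℝ (2 * m) v * ExteriorAlgebra.ι ℝ x := by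
  induction m with
  | zero => simp [ExteriorAlgebra.ιMulti_apply]
  | succ m ih =>
    have h : ιMulti ℝ (2 * (m + 1)) v = ιMulti ℝ (2 * m) (Fin.init (Fin.init v)) *
        ExteriorAlgebra.ι ℝ (v (Fin.last (2 * m)).castSucc) *
          ExteriorAlgebra.ι ℝ (v (Fin.last (2 * m + 1))) := by
      rw [show ιMulti ℝ (2 * (m + 1)) v = _ from ιMulti_init (m := 2 * m + 1) v, ιMulti_init]
      rfl
    have h2 : ∀ y z : W, ExteriorAlgebra.ι ℝ x * (ExteriorAlgebra.ι ℝ y * ExteriorAlgebra.ι ℝ z) =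
        ExteriorAlgebra.ι ℝ y * ExteriorAlgebra.ι ℝ z * ExteriorAlgebra.ι ℝ x := fun y z => by
      rw [← mul_assoc, ι_mul_ι_swap x, neg_mul, mul_assoc, ι_mul_ι_swap x, mul_neg, neg_neg,
        mul_assoc]
    rw [h, mul_assoc (ιMulti ℝ (2 * m) _), ← mul_assoc, ih, mul_assoc, h2]
    simp only [mul_assoc]

/-- Matrix-valued forms: the Grassmann algebra with coefficients in `𝔸`. -/
abbrev GrassmannAlg (𝔸 : Type*) [Ring 𝔸] [Algebra ℝ 𝔸] (W : Type*) [AddCommGroup W]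
    [Module ℝ W] : Type _ := 𝔸 ⊗[ℝ] ExteriorAlgebra ℝ W

/-- The form `∑ a_i θ_i` of degree one. -/
def oneForm (θ : ι → W) (a : ι → 𝔸) : GrassmannAlg 𝔸 W := ∑ i, a i ⊗ₜ ExteriorAlgebra.ι ℝ (θ i)

/-- The form `∑ b_ij θ_i θ_j` of degree two. -/
def twoForm (θ : ι → W) : (ι → ι → 𝔸) →ₗ[ℝ] GrassmannAlg 𝔸 W where
  toFun b := ∑ i, ∑ j, b i j ⊗ₜ (ExteriorAlgebra.ι ℝ (θ i) * ExteriorAlgebra.ι ℝ (θ j))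
  map_add' b c := by simp [TensorProduct.add_tmul, Finset.sum_add_distrib]
  map_smul' r b := by simp [TensorProduct.smul_tmul', Finset.smul_sum]

/-- The form `∑ f_ijk θ_i θ_j θ_k` of degree three. -/
def threeForm (θ : ι → W) : (ι → ι → ι → 𝔸) →ₗ[ℝ] GrassmannAlg 𝔸 W where
  toFun f := ∑ i, ∑ j, ∑ k, f i j k ⊗ₜ (ExteriorAlgebra.ι ℝ (θ i) * ExteriorAlgebra.ι ℝ (θ j) *
    ExteriorAlgebra.ι ℝ (θ k))
  map_add' b c := by simp [TensorProduct.add_tmul, Finset.sum_add_distrib]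
  map_smul' r b := by simp [TensorProduct.smul_tmul', Finset.smul_sum]

/-- The form `∑ f_i θ_i(0) ⋯ θ_i(m-1)` of degree `m`, the sum being over all multi-indices `i`. -/
def multiForm (θ : ι → W) {m : ℕ} (f : (Fin m → ι) → 𝔸) : GrassmannAlg 𝔸 W :=
  ∑ i, f i ⊗ₜ ιMulti ℝ m (θ ∘ i)

theorem twoForm_apply (θ : ι → W) (b : ι → ι → 𝔸) : twoForm θ b =
    ∑ i, ∑ j, b i j ⊗ₜ (ExteriorAlgebra.ι ℝ (θ i) * ExteriorAlgebra.ι ℝ (θ j)) := rfl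

theorem threeForm_apply (θ : ι → W) (f : ι → ι → ι → 𝔸) : threeForm θ f =
    ∑ i, ∑ j, ∑ k, f i j k ⊗ₜ (ExteriorAlgebra.ι ℝ (θ i) * ExteriorAlgebra.ι ℝ (θ j) *
    ExteriorAlgebra.ι ℝ (θ k)) := rfl

theorem twoForm_mul_oneForm (θ : ι → W) (b : ι → ι → 𝔸) (a : ι → 𝔸) :
    twoForm θ b * oneForm θ a = threeForm θ fun i j k => b i j * a k := by
  simp only [twoForm_apply, threeForm_apply, oneForm, Finset.sum_mul, Finset.mul_sum,
    Algebra.TensorProduct.tmul_mul_tmul]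
  rw [Finset.sum_comm]
  exact Finset.sum_congr rfl fun i _ => Finset.sum_comm

theorem oneForm_mul_twoForm (θ : ι → W) (b : ι → ι → 𝔸) (a : ι → 𝔸) :
    oneForm θ a * twoForm θ b = threeForm θ fun i j k => a i * b j k := by
  simp only [twoForm_apply, threeForm_apply, oneForm, Finset.sum_mul, Finset.mul_sum,
    Algebra.TensorProduct.tmul_mul_tmul, mul_assoc]
  rw [Finset.sum_comm_cycle]

theorem threeForm_swap_left (θ : ι → W) (f : ι → ι → ι → 𝔸) :
    threeForm θ (fun i j k => f j i k) = -threeForm θ f := by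
  simp only [threeForm_apply]
  rw [Finset.sum_comm, ← Finset.sum_neg_distrib]
  refine Finset.sum_congr rfl fun i _ => ?_
  rw [← Finset.sum_neg_distrib]
  refine Finset.sum_congr rfl fun j _ => ?_
  rw [← Finset.sum_neg_distrib]
  refine Finset.sum_congr rfl fun k _ => ?_
  rw [ι_mul_ι_swap (θ j), neg_mul, TensorProduct.tmul_neg]

theorem threeForm_swap_right (θ : ι → W) (f : ι → ι → ι → 𝔸) :
    threeForm θ (fun i j k => f i k j) = -threeForm θ f := by
  simp only [threeForm_apply]
  rw [← Finset.sum_neg_distrib]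
  refine Finset.sum_congr rfl fun i _ => ?_
  rw [Finset.sum_comm, ← Finset.sum_neg_distrib]
  refine Finset.sum_congr rfl fun j _ => ?_
  rw [← Finset.sum_neg_distrib]
  refine Finset.sum_congr rfl fun k _ => ?_
  rw [mul_assoc, ι_mul_ι_swap (θ k), mul_neg, TensorProduct.tmul_neg, mul_assoc]

theorem sum_snoc {C : Type*} [AddCommMonoid C] {m : ℕ} (F : (Fin (m + 1) → ι) → C) :
    ∑ v, F v = ∑ v : Fin m → ι, ∑ i, F (Fin.snoc (α := fun _ => ι) v i) := by
  rw [← (Fin.snocEquiv fun _ => ι).sum_comp, Fintype.sum_prod_type, Finset.sum_comm]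
  rfl

theorem multiForm_mul_twoForm (θ : ι → W) {m : ℕ} (f : (Fin m → ι) → 𝔸) (b : ι → ι → 𝔸) :
    multiForm θ (fun v : Fin (m + 2) → ι => f (Fin.init (Fin.init v)) *
        b (v (Fin.last m).castSucc) (v (Fin.last (m + 1)))) =
      multiForm θ f * twoForm θ b := by
  simp only [multiForm, twoForm_apply, Finset.sum_mul, Finset.mul_sum,
    Algebra.TensorProduct.tmul_mul_tmul]
  rw [sum_snoc, sum_snoc, Finset.sum_comm]
  refine Finset.sum_congr rfl fun i _ => ?_
  rw [Finset.sum_comm]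
  refine Finset.sum_congr rfl fun j _ => Finset.sum_congr rfl fun k _ => ?_
  rw [Fin.comp_snoc, Fin.comp_snoc, ιMulti_init, ιMulti_init]
  simp [Fin.init_snoc, mul_assoc]

theorem multiForm_curvWord (θ : ι → W) (R : ι → ι → 𝔸) (m : ℕ) :
    multiForm θ (curvWord R m) = twoForm θ R ^ m := by
  induction m with
  | zero =>
    simp only [multiForm, curvWord, pow_zero]
    let _ : Unique (Fin (2 * 0) → ι) := inferInstanceAs (Unique (Fin 0 → ι))
    rw [Fintype.sum_unique]
    simp [ExteriorAlgebra.ιMulti_apply, Algebra.TensorProduct.one_def]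
  | succ m ih =>
    rw [pow_succ, ← ih]
    exact multiForm_mul_twoForm θ (curvWord R m) R

theorem multiForm_csWord (θ : ι → W) (a : ι → 𝔸) (R : ι → ι → 𝔸) (m : ℕ) :
    multiForm θ (csWord a R m) = oneForm θ a * twoForm θ R ^ m := by
  induction m with
  | zero =>
    simp only [multiForm, csWord, pow_zero, oneForm, mul_one]
    rw [← (Equiv.funUnique (Fin 1) ι).symm.sum_comp]
    simp [ExteriorAlgebra.ιMulti_apply]
  | succ m ih =>
    rw [pow_succ, ← mul_assoc, ← ih]
    exact multiForm_mul_twoForm θ (csWord a R m) R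

/-- The Bianchi identity `dR = R A - A R`, for a curvature `R = dA + A ∧ A` given by the two-jet of
`A` at a point: `b i j` is the derivative of `A_j` in direction `i`, and `S` collects the second
derivatives. -/
theorem threeForm_bianchi (θ : ι → W) (a : ι → 𝔸) (b : ι → ι → 𝔸) (S : ι → ι → ι → 𝔸)
    (hS : ∀ i j k, S i j k = S j i k) (R : ι → ι → 𝔸) (R' : ι → ι → ι → 𝔸)
    (hR : ∀ i j, R i j = b i j - b j i + a i * a j - a j * a i)
    (hR' : ∀ u i j, R' u i j = S u i j - S u j i + (b u i * a j + a i * b u j)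
      - (b u j * a i + a j * b u i)) :
    threeForm θ R' = twoForm θ R * oneForm θ a - oneForm θ a * twoForm θ R := by
  rw [twoForm_mul_oneForm, oneForm_mul_twoForm]
  have hS0 : threeForm θ S = 0 := by
    have h : threeForm θ S = -threeForm θ S := by
      rw [← threeForm_swap_left]
      congr 1
      funext i j k
      exact hS i j k
    have h2 : (2 : ℝ) • threeForm θ S = 0 := by
      rw [two_smul]
      nth_rewrite 1 [h]
      exact neg_add_cancel _
    simpa using h2
  have e1 : R' = S - (fun i j k => S i k j) + ((fun i j k => b i j * a k) +
      (fun i j k => a j * b i k)) - ((fun i j k => b i k * a j) + fun i j k => a k * b i j) := by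
    funext i j k
    exact hR' i j k
  have e2 : (fun i j k => R i j * a k) = (fun i j k => b i j * a k) - (fun i j k => b j i * a k) +
      (fun i j k => a i * a j * a k) - (fun i j k => a j * a i * a k) := by
    funext i j k
    simp only [hR, Pi.sub_apply, Pi.add_apply]
    noncomm_ring
  have e3 : (fun i j k => a i * R j k) = (fun i j k => a i * b j k) - (fun i j k => a i * b k j) +
      (fun i j k => a i * a j * a k) - (fun i j k => a i * a k * a j) := by
    funext i j k
    simp only [hR, Pi.sub_apply, Pi.add_apply]
    noncomm_ring
  have s1 := threeForm_swap_right θ S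
  have s2 := threeForm_swap_left θ fun i j k => a i * b j k
  have s3 := threeForm_swap_right θ fun i j k => b i j * a k
  have s4 := threeForm_swap_right θ fun i j k => a j * b i k
  have s5 := threeForm_swap_left θ fun i j k => b i j * a k
  have s6 := threeForm_swap_left θ fun i j k => a i * a j * a k
  have s7 := threeForm_swap_right θ fun i j k => a i * b j k
  have s8 := threeForm_swap_right θ fun i j k => a i * a j * a k
  rw [e1, e2, e3]
  simp only [map_sub, map_add]
  rw [s1, s2, s3, s4, s2, s5, s6, s7, s8, hS0]
  abel

/-- The form `∑ g_u(i) θ_u θ_i(0) ⋯ θ_i(m-1)` of degree `m + 1`. -/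
def derivForm (θ : ι → W) {m : ℕ} (g : ι → (Fin m → ι) → 𝔸) : GrassmannAlg 𝔸 W :=
  ∑ u, ∑ i, g u i ⊗ₜ (ExteriorAlgebra.ι ℝ (θ u) * ιMulti ℝ m (θ ∘ i))

theorem derivForm_curvWordDeriv (θ : ι → W) (R : ι → ι → 𝔸) (R' : ι → ι → ι → 𝔸) (m : ℕ) :
    derivForm θ (curvWordDeriv R R' (m + 1)) =
      derivForm θ (curvWordDeriv R R' m) * twoForm θ R + twoForm θ R ^ m * threeForm θ R' := by
  rw [← multiForm_curvWord]
  simp only [derivForm, curvWordDeriv, TensorProduct.add_tmul, Finset.sum_add_distrib]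
  congr 1
  · rw [Finset.sum_mul]
    refine Finset.sum_congr rfl fun u _ => ?_
    have h := congrArg (fun y => ((1 : 𝔸) ⊗ₜ[ℝ] ExteriorAlgebra.ι ℝ (θ u)) * y)
      (multiForm_mul_twoForm θ (curvWordDeriv R R' m u) R)
    simp only [multiForm, ← mul_assoc, Finset.mul_sum, Algebra.TensorProduct.tmul_mul_tmul,
      one_mul] at h
    exact h
  · rw [threeForm_apply, Finset.mul_sum]
    refine Finset.sum_congr rfl fun u _ => ?_
    have h := congrArg (fun y => ((1 : 𝔸) ⊗ₜ[ℝ] ExteriorAlgebra.ι ℝ (θ u)) * y)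
      (multiForm_mul_twoForm θ (curvWord R m) (R' u))
    simp only [multiForm, ← mul_assoc, Finset.mul_sum, Algebra.TensorProduct.tmul_mul_tmul,
      one_mul, commute_ι_ιMulti_even] at h
    refine Eq.trans ?_ (h.trans ?_)
    · rfl
    · simp only [multiForm, twoForm_apply, Finset.sum_mul, Finset.mul_sum,
        Algebra.TensorProduct.tmul_mul_tmul, mul_assoc]

/-- By Leibniz' rule, the Bianchi identity for `R` implies `d(R^m) = R^m A - A R^m`. -/
theorem derivForm_curvWordDeriv_eq (θ : ι → W) (a : ι → 𝔸) (R : ι → ι → 𝔸) (R' : ι → ι → ι → 𝔸)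
    (h : threeForm θ R' = twoForm θ R * oneForm θ a - oneForm θ a * twoForm θ R) (m : ℕ) :
    derivForm θ (curvWordDeriv R R' m) =
      twoForm θ R ^ m * oneForm θ a - oneForm θ a * twoForm θ R ^ m := by
  induction m with
  | zero => simp [derivForm, curvWordDeriv]
  | succ m ih =>
    rw [derivForm_curvWordDeriv, ih, h, pow_succ]
    noncomm_ring

/-! #### Traces -/

theorem ι_mul_ι_commute (x y : W) (z : ExteriorAlgebra ℝ W) :
    Commute (ExteriorAlgebra.ι ℝ x * ExteriorAlgebra.ι ℝ y) z := by
  induction z using ExteriorAlgebra.induction with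
  | algebraMap r => exact (Algebra.commutes r _).symm
  | ι w =>
    have := commute_ι_ιMulti_even w 1 ![x, y]
    simpa [ExteriorAlgebra.ιMulti_apply, commute_iff_eq] using this.symm
  | mul a b ha hb => exact ha.mul_right hb
  | add a b ha hb => exact ha.add_right hb

variable {C : Type*} [AddCommGroup C] [Module ℝ C] (τ : 𝔸 →ₗ[ℝ] C)

/-- The trace is cyclic for products with a form of degree two: no sign occurs because such forms
have central exterior part. -/
theorem rTensor_twoForm_mul (hτ : ∀ a b, τ (a * b) = τ (b * a)) (θ : ι → W) (b : ι → ι → 𝔸)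
    (y : GrassmannAlg 𝔸 W) :
    τ.rTensor (ExteriorAlgebra ℝ W) (twoForm θ b * y) =
      τ.rTensor (ExteriorAlgebra ℝ W) (y * twoForm θ b) := by
  induction y using TensorProduct.induction_on with
  | zero => simp
  | add y z hy hz => simp only [mul_add, add_mul, map_add, hy, hz]
  | tmul c l =>
    simp only [twoForm_apply, Finset.sum_mul, Finset.mul_sum, map_sum,
      Algebra.TensorProduct.tmul_mul_tmul, LinearMap.rTensor_tmul]
    refine Finset.sum_congr rfl fun i _ => Finset.sum_congr rfl fun j _ => ?_
    rw [hτ, (ι_mul_ι_commute (θ i) (θ j) l).eq]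

theorem rTensor_twoForm_pow_mul (hτ : ∀ a b, τ (a * b) = τ (b * a)) (θ : ι → W) (b : ι → ι → 𝔸)
    (m : ℕ) (y : GrassmannAlg 𝔸 W) :
    τ.rTensor (ExteriorAlgebra ℝ W) (twoForm θ b ^ m * y) =
      τ.rTensor (ExteriorAlgebra ℝ W) (y * twoForm θ b ^ m) := by
  induction m generalizing y with
  | zero => simp
  | succ m ih =>
    rw [pow_succ, mul_assoc, ih, mul_assoc, rTensor_twoForm_mul τ hτ, mul_assoc]

/-- The coefficient of the volume element `e₀ ∧ ⋯ ∧ e_(N-1)` is determined by the product, since the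
determinant takes the value `1` on the standard basis. -/
theorem eq_zero_of_tmul_ιMulti {N : ℕ} (c : C)
    (h : c ⊗ₜ[ℝ] ιMulti ℝ N (fun i : Fin N => (Pi.single i 1 : Fin N → ℝ)) = 0) : c = 0 := by
  classical
  have h2 := congrArg (fun y => TensorProduct.rid ℝ C ((ExteriorAlgebra.liftAlternating
    (Pi.single (M := fun i => (Fin N → ℝ) [⋀^Fin i]→ₗ[ℝ] ℝ) N Matrix.detRowAlternating)).lTensor C y)) h
  simp only [LinearMap.lTensor_tmul, ExteriorAlgebra.liftAlternating_apply_ιMulti, Pi.single_eq_same,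
    TensorProduct.rid_tmul, map_zero] at h2
  have h3 : Matrix.detRowAlternating (fun i : Fin N => (Pi.single i 1 : Fin N → ℝ)) = (1 : ℝ) := by
    have : (Matrix.of fun i : Fin N => (Pi.single i 1 : Fin N → ℝ)) = 1 := by
      ext i j
      simp [Matrix.one_apply, Pi.single_apply, eq_comm]
    change Matrix.det (Matrix.of fun i : Fin N => (Pi.single i 1 : Fin N → ℝ)) = 1
    rw [this, Matrix.det_one]
  rwa [h3, one_smul] at h2

theorem rTensor_multiForm (θ : ι → W) {m : ℕ} (f : (Fin m → ι) → 𝔸) :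
    τ.rTensor (ExteriorAlgebra ℝ W) (multiForm θ f) = ∑ i, τ (f i) ⊗ₜ ιMulti ℝ m (θ ∘ i) := by
  simp [multiForm]

/-- The closedness of `Tr R^m`, evaluated on `2m + 1` vectors. -/
theorem sum_sign_trace_curvWordDeriv (hτ : ∀ a b, τ (a * b) = τ (b * a)) {m : ℕ}
    (a : Fin (2 * m + 1) → 𝔸) (b : Fin (2 * m + 1) → Fin (2 * m + 1) → 𝔸)
    (S : Fin (2 * m + 1) → Fin (2 * m + 1) → Fin (2 * m + 1) → 𝔸)
    (hS : ∀ i j k, S i j k = S j i k) (R : Fin (2 * m + 1) → Fin (2 * m + 1) → 𝔸)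
    (R' : Fin (2 * m + 1) → Fin (2 * m + 1) → Fin (2 * m + 1) → 𝔸)
    (hR : ∀ i j, R i j = b i j - b j i + a i * a j - a j * a i)
    (hR' : ∀ u i j, R' u i j = S u i j - S u j i + (b u i * a j + a i * b u j)
      - (b u j * a i + a j * b u i)) :
    ∑ u : Fin (2 * m + 1), (-1 : ℤ) ^ u.val • ∑ s : Equiv.Perm (Fin (2 * m)),
      (Equiv.Perm.sign s : ℤ) • τ (curvWordDeriv R R' m u (u.succAbove ∘ s)) = 0 := by
  classical
  -- `θ` is the standard coframe, whose product detects top-degree coefficients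
  let θ : Fin (2 * m + 1) → (Fin (2 * m + 1) → ℝ) := fun i => Pi.single i 1
  have h0 : τ.rTensor (ExteriorAlgebra ℝ _) (derivForm θ (curvWordDeriv R R' m)) = 0 := by
    rw [derivForm_curvWordDeriv_eq θ a R R' (threeForm_bianchi θ a b S hS R R' hR hR'), map_sub,
      rTensor_twoForm_pow_mul τ hτ, sub_self]
  apply eq_zero_of_tmul_ιMulti
  rw [← h0]
  simp only [derivForm, map_sum, LinearMap.rTensor_tmul]
  rw [TensorProduct.sum_tmul]
  refine Finset.sum_congr rfl fun u _ => ?_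
  let l := (ιMulti ℝ (2 * m + 1) (M := Fin (2 * m + 1) → ℝ)).curryLeft (θ u)
  have hl : ∀ v, l v = ExteriorAlgebra.ι ℝ (θ u) * ιMulti ℝ (2 * m) v := fun v => by
    change ιMulti ℝ (2 * m + 1) (Matrix.vecCons (θ u) v) = _
    rw [ExteriorAlgebra.ιMulti_succ_apply]
    rfl
  have h1 : ∑ i : Fin (2 * m) → Fin (2 * m), τ (curvWordDeriv R R' m u (u.succAbove ∘ i)) ⊗ₜ[ℝ]
        l ((θ ∘ u.succAbove) ∘ i) =
      ∑ i, τ (curvWordDeriv R R' m u i) ⊗ₜ[ℝ]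
        (ExteriorAlgebra.ι ℝ (θ u) * ιMulti ℝ (2 * m) (θ ∘ i)) := by
    refine Finset.sum_of_injOn (fun i => u.succAbove ∘ i) ?_ (by simp) (fun i _ hi => ?_)
      (fun i _ => by rw [hl]; rfl)
    · exact fun i _ j _ h => (Fin.succAbove_right_injective.comp_left h)
    -- a multi-index which meets `u` contributes `θ_u ∧ ⋯ ∧ θ_u ∧ ⋯ = 0`
    · have hu : ∃ j, i j = u := by
        by_contra hne
        push Not at hne
        choose i' hi' using fun j => Fin.exists_succAbove_eq (hne j)
        exact hi ⟨i', by simp, funext hi'⟩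
      obtain ⟨j, hj⟩ := hu
      rw [← hl]
      have : l (θ ∘ i) = 0 := by
        refine AlternatingMap.map_eq_zero_of_eq (ιMulti ℝ (2 * m + 1))
          (Matrix.vecCons (θ u) (θ ∘ i)) (i := 0) (j := j.succ) ?_ (Fin.succ_ne_zero j).symm
        simp [hj]
      rw [this, TensorProduct.tmul_zero]
  rw [← h1, sum_tmul_alternating l (θ ∘ u.succAbove)
    (fun i => τ (curvWordDeriv R R' m u (u.succAbove ∘ i)))]
  have h2 : l (θ ∘ u.succAbove) = (-1 : ℤ) ^ u.val • ιMulti ℝ (2 * m + 1) θ := by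
    have h3 := (ιMulti ℝ (2 * m + 1)).neg_one_pow_smul_map_insertNth u (θ u) (u.removeNth θ)
    rw [Fin.insertNth_self_removeNth] at h3
    exact h3.symm
  rw [h2, TensorProduct.tmul_smul, TensorProduct.smul_tmul']

/-- The sum of the words with `n` letters, one of which is `A` and the other ones `R`. -/
def insertSum {B : Type*} [Ring B] (R A : B) : ℕ → B
  | 0 => 0
  | n + 1 => insertSum R A n * R + R ^ n * A

/-- `insertSum R A n` is odd in `A`, so it anticommutes with the odd variable `t`. -/
theorem insertSum_mul {B : Type*} [Ring B] {R A t : B} (hR : R * t = t * R) (hA : A * t = -(t * A))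
    (n : ℕ) : insertSum R A n * t = -(t * insertSum R A n) := by
  induction n with
  | zero => simp [insertSum]
  | succ n ih =>
    have hRn : R ^ n * t = t * R ^ n := ((show Commute R t from hR).pow_left n).eq
    simp only [insertSum, add_mul, mul_add, mul_assoc, hR, hA, mul_neg, neg_add]
    rw [← mul_assoc, ih, ← mul_assoc (R ^ n), hRn]
    simp only [mul_assoc, neg_mul]

/-- Expansion of a power of the curvature `R + 2 t A` of a family of connections, with `t` in the
role of `dt`: the terms of higher order vanish because `t² = 0`. -/
theorem add_two_mul_pow {B : Type*} [Ring B] {R A t : B} (hR : R * t = t * R)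
    (hA : A * t = -(t * A)) (ht : t * t = 0) (n : ℕ) :
    (R + 2 * (t * A)) ^ n = R ^ n + 2 * (t * insertSum R A n) := by
  induction n with
  | zero => simp [insertSum]
  | succ n ih =>
    have hRn : R ^ n * t = t * R ^ n := ((show Commute R t from hR).pow_left n).eq
    have h0 : t * insertSum R A n * (2 * (t * A)) = 0 := by
      rw [show t * insertSum R A n * (2 * (t * A)) = 2 * (t * (insertSum R A n * t) * A) by
        noncomm_ring, insertSum_mul hR hA, mul_neg, ← mul_assoc t t, ht]
      simp
    have h1 : R ^ n * (2 * (t * A)) = 2 * (t * (R ^ n * A)) := by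
      rw [show R ^ n * (2 * (t * A)) = 2 * ((R ^ n * t) * A) by noncomm_ring, hRn, mul_assoc]
    rw [pow_succ, ih, add_mul, mul_add, mul_add, h1, mul_assoc 2 (t * _) (2 * (t * A)), h0,
      insertSum, pow_succ]
    noncomm_ring

/-- Under the trace all the words in `insertSum` coincide, by cyclicity. -/
theorem rTensor_insertSum (hτ : ∀ a b, τ (a * b) = τ (b * a)) (θ : ι → W) (b : ι → ι → 𝔸)
    (t A : GrassmannAlg 𝔸 W) (ht : twoForm θ b * t = t * twoForm θ b) (n j : ℕ) :
    τ.rTensor (ExteriorAlgebra ℝ W) (t * (insertSum (twoForm θ b) A (n + 1) * twoForm θ b ^ j)) =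
      (n + 1) • τ.rTensor (ExteriorAlgebra ℝ W) (t * (A * twoForm θ b ^ (n + j))) := by
  have hcomm : ∀ n, twoForm θ b ^ n * t = t * twoForm θ b ^ n := fun n =>
    ((show Commute (twoForm θ b) t from ht).pow_left n).eq
  induction n generalizing j with
  | zero => simp [insertSum]
  | succ n ih =>
    have h : t * (twoForm θ b ^ (n + 1) * A * twoForm θ b ^ j) =
        twoForm θ b ^ (n + 1) * (t * (A * twoForm θ b ^ j)) := by
      rw [mul_assoc, ← mul_assoc t, ← hcomm, mul_assoc]
    rw [insertSum, add_mul, mul_add, map_add, mul_assoc (insertSum _ _ _), ← pow_succ', ih, h,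
      rTensor_twoForm_pow_mul τ hτ, mul_assoc, mul_assoc, ← pow_add, succ_nsmul _ (n + 1),
      show j + (n + 1) = n + (j + 1) by ring, show n + 1 + j = n + (j + 1) by ring]

/-- Contraction of `Tr Ω^(k+1)` with a vector `∂`, for `Ω = R + ∂* ∧ a`. -/
theorem sum_sign_trace_curvWord_succ (hτ : ∀ a b, τ (a * b) = τ (b * a)) {k : ℕ}
    (a : Fin (2 * k + 1) → 𝔸) (R : Fin (2 * k + 1) → Fin (2 * k + 1) → 𝔸)
    (Ω : Fin (2 * (k + 1)) → Fin (2 * (k + 1)) → 𝔸)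
    (h00 : Ω 0 0 = 0) (h01 : ∀ j : Fin (2 * k + 1), Ω 0 j.succ = a j)
    (h10 : ∀ j : Fin (2 * k + 1), Ω j.succ 0 = -a j)
    (h11 : ∀ i j : Fin (2 * k + 1), Ω i.succ j.succ = R i j) :
    ∑ s : Equiv.Perm (Fin (2 * (k + 1))), (Equiv.Perm.sign s : ℤ) • τ (curvWord Ω (k + 1) s) =
      (2 * (k + 1)) • ∑ s : Equiv.Perm (Fin (2 * k + 1)),
        (Equiv.Perm.sign s : ℤ) • τ (csWord a R k s) := by
  classical
  let W' := Fin (2 * (k + 1)) → ℝ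
  let θ : Fin (2 * k + 1 + 1) → W' := fun i => Pi.single i 1
  let θ' : Fin (2 * k + 1) → W' := fun i => θ i.succ
  -- `θ'` is the coframe of the slice, and `t` stands for `dt`
  let t : GrassmannAlg 𝔸 W' := 1 ⊗ₜ ExteriorAlgebra.ι ℝ (θ 0)
  have htt : t * t = 0 := by
    rw [Algebra.TensorProduct.tmul_mul_tmul, ExteriorAlgebra.ι_sq_zero, TensorProduct.tmul_zero]
  have hA : oneForm θ' a * t = -(t * oneForm θ' a) := by
    simp only [oneForm, Finset.sum_mul, Finset.mul_sum, t, Algebra.TensorProduct.tmul_mul_tmul,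
      mul_one, one_mul, ← Finset.sum_neg_distrib]
    refine Finset.sum_congr rfl fun i _ => ?_
    rw [ι_mul_ι_swap, TensorProduct.tmul_neg]
  have hR : twoForm θ' R * t = t * twoForm θ' R := by
    simp only [twoForm_apply, Finset.sum_mul, Finset.mul_sum, t,
      Algebra.TensorProduct.tmul_mul_tmul, mul_one, one_mul]
    refine Finset.sum_congr rfl fun i _ => Finset.sum_congr rfl fun j _ => ?_
    rw [(ι_mul_ι_commute _ _ _).eq]
  -- the factor `2` comes from the two orders of the indices in `twoForm`
  have hΩ : twoForm θ Ω = twoForm θ' R + 2 * (t * oneForm θ' a) := by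
    have e1 : t * oneForm θ' a = ∑ j : Fin (2 * k + 1), a j ⊗ₜ[ℝ]
        (ExteriorAlgebra.ι ℝ (θ 0) * ExteriorAlgebra.ι ℝ (θ j.succ)) := by
      simp only [oneForm, Finset.mul_sum, t, Algebra.TensorProduct.tmul_mul_tmul, one_mul]
      rfl
    have e2 : ∑ j : Fin (2 * k + 1), Ω j.succ 0 ⊗ₜ[ℝ]
        (ExteriorAlgebra.ι ℝ (θ j.succ) * ExteriorAlgebra.ι ℝ (θ 0)) = t * oneForm θ' a := by
      rw [e1]
      refine Finset.sum_congr rfl fun j _ => ?_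
      rw [ι_mul_ι_swap, h10, TensorProduct.neg_tmul, TensorProduct.tmul_neg, neg_neg]
    rw [twoForm_apply, Fin.sum_univ_succ, Fin.sum_univ_succ]
    simp only [Fin.sum_univ_succ (n := 2 * k + 1), Finset.sum_add_distrib, e2]
    simp only [h00, h01, h11, TensorProduct.zero_tmul, zero_add, twoForm_apply, ← e1]
    rw [two_mul (t * oneForm θ' a)]
    simp only [θ']
    abel
  have h1 := multiForm_curvWord θ Ω (k + 1)
  rw [hΩ, add_two_mul_pow hR hA htt] at h1
  have h2 := congrArg (τ.rTensor (ExteriorAlgebra ℝ W')) h1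
  have h3 := rTensor_insertSum τ hτ θ' R t (oneForm θ' a) hR k 0
  rw [pow_zero, mul_one, add_zero] at h3
  -- a form of degree `2k + 2` on the slice, which has dimension `2k + 1`, is zero
  have h4 : τ.rTensor (ExteriorAlgebra ℝ W') (twoForm θ' R ^ (k + 1)) = 0 := by
    rw [← multiForm_curvWord, rTensor_multiForm]
    refine Finset.sum_eq_zero fun i _ => ?_
    rw [(ιMulti ℝ (2 * (k + 1))).map_eq_zero_of_not_injective, TensorProduct.tmul_zero]
    intro hinj
    have := Fintype.card_le_of_injective i hinj.of_comp
    simp at this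
    omega
  rw [← multiForm_csWord] at h3
  rw [map_add, h4, zero_add, two_mul (t * insertSum _ _ _), map_add, h3, rTensor_multiForm] at h2
  have h5 : τ.rTensor (ExteriorAlgebra ℝ W') (t * multiForm θ' (csWord a R k)) =
      (∑ s : Equiv.Perm (Fin (2 * k + 1)), (Equiv.Perm.sign s : ℤ) • τ (csWord a R k s)) ⊗ₜ[ℝ]
        ιMulti ℝ (2 * (k + 1)) θ := by
    let l := (ιMulti ℝ (2 * k + 1 + 1) (M := W')).curryLeft (θ 0)
    have hl : ∀ v, l v = ExteriorAlgebra.ι ℝ (θ 0) * ιMulti ℝ (2 * k + 1) v := fun v => by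
      change ιMulti ℝ (2 * k + 1 + 1) (Matrix.vecCons (θ 0) v) = _
      rw [ExteriorAlgebra.ιMulti_succ_apply]
      rfl
    have h6 := sum_tmul_alternating l θ' fun i => τ (csWord a R k i)
    have h7 : l θ' = ιMulti ℝ (2 * (k + 1)) θ := by
      change ιMulti ℝ (2 * k + 1 + 1) (Matrix.vecCons (θ 0) θ') = _
      congr 1
      exact Fin.cons_self_tail θ
    rw [← h7, ← h6]
    simp only [multiForm, Finset.mul_sum, map_sum, t, Algebra.TensorProduct.tmul_mul_tmul, one_mul,
      LinearMap.rTensor_tmul, hl]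
  rw [h5] at h2
  have h6 := (sum_tmul_alternating (ιMulti ℝ (2 * (k + 1))) θ
    fun i => τ (curvWord Ω (k + 1) i)).symm.trans h2
  rw [← sub_eq_zero]
  apply eq_zero_of_tmul_ιMulti
  rw [TensorProduct.sub_tmul]
  refine sub_eq_zero.2 (h6.trans ?_)
  rw [← two_nsmul, smul_smul, TensorProduct.smul_tmul']
  rfl

end Grassmann

/-! ### Integration over the unit interval -/

section Integration

open MeasureTheory

variable {E : Type*} [NormedAddCommGroup E] [NormedSpace ℝ E] [FiniteDimensional ℝ E]
  {F : Type*} [NormedAddCommGroup F] [NormedSpace ℝ F]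

/-- Smoothness of a map with values in alternating forms can be tested on vectors. -/
theorem contDiffOn_alternating {Z : Type*} [NormedAddCommGroup Z] [NormedSpace ℝ Z]
    [FiniteDimensional ℝ F]
    {k : ℕ} {n : WithTop ℕ∞} {s : Set Z} {f : Z → E [⋀^Fin k]→L[ℝ] F}
    (h : ∀ v, ContDiffOn ℝ n (fun z => f z v) s) : ContDiffOn ℝ n f s := by
  let b := Module.finBasis ℝ E
  let ev : (E [⋀^Fin k]→L[ℝ] F) →ₗ[ℝ] ((Fin k → Fin (Module.finrank ℝ E)) → F) :=
    { toFun := fun α i => α fun j => b (i j)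
      map_add' := fun _ _ => rfl
      map_smul' := fun _ _ => rfl }
  have hev : Function.Injective ev := by
    intro α β hαβ
    apply ContinuousAlternatingMap.toAlternatingMap_injective
    refine Module.Basis.ext_alternating b fun i _ => ?_
    exact congrFun hαβ i
  obtain ⟨g, hg⟩ := LinearMap.exists_leftInverse_of_injective ev (LinearMap.ker_eq_bot.2 hev)
  have h1 : f = fun z => LinearMap.toContinuousLinearMap g (ev (f z)) := by
    funext z
    exact (LinearMap.congr_fun hg (f z)).symm
  rw [h1]
  exact (ContinuousLinearMap.contDiff _).comp_contDiffOn (contDiffOn_pi.2 fun i => h _)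

theorem continuousOn_slice {f : ℝ × E → F} {U : Set E}
    (hf : ContinuousOn f (univ ×ˢ U)) {z : E} (hz : z ∈ U) : Continuous fun t => f (t, z) :=
  continuousOn_univ.1 (hf.comp (by fun_prop) fun _ _ => ⟨mem_univ _, hz⟩)

theorem hasFDerivAt_integral_param {f : ℝ × E → F} {U : Set E} (hU : IsOpen U)
    (hf : ContDiffOn ℝ 1 f (univ ×ˢ U)) {z : E} (hz : z ∈ U) :
    HasFDerivAt (fun y => ∫ t in (0 : ℝ)..1, f (t, y))
      (∫ t in (0 : ℝ)..1, (fderiv ℝ f (t, z)).comp (ContinuousLinearMap.inr ℝ ℝ E)) z := by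
  have hO : IsOpen ((univ : Set ℝ) ×ˢ U) := isOpen_univ.prod hU
  have hf' : ContinuousOn (fun p => (fderiv ℝ f p).comp (ContinuousLinearMap.inr ℝ ℝ E))
      (univ ×ˢ U) :=
    (hf.continuousOn_fderiv_of_isOpen hO le_rfl).clm_comp continuousOn_const
  obtain ⟨r, hr, hrU⟩ := Metric.nhds_basis_closedBall.mem_iff.1 (hU.mem_nhds hz)
  obtain ⟨C, hC⟩ := (isCompact_Icc.prod (isCompact_closedBall z r)).exists_bound_of_continuousOn
    (f := fun p => (fderiv ℝ f p).comp (ContinuousLinearMap.inr ℝ ℝ E))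
    (s := Icc (0 : ℝ) 1 ×ˢ Metric.closedBall z r)
    (hf'.mono (prod_mono (subset_univ _) hrU))
  refine intervalIntegral.hasFDerivAt_integral_of_dominated_of_fderiv_le (μ := volume)
    (F := fun y t => f (t, y)) (bound := fun _ => C)
    (F' := fun y t => (fderiv ℝ f (t, y)).comp (ContinuousLinearMap.inr ℝ ℝ E))
    (Metric.closedBall_mem_nhds z hr) ?_ ?_ ?_ ?_ ?_ ?_
  · filter_upwards [hU.mem_nhds hz] with y hy
    exact (continuousOn_slice hf.continuousOn hy).aestronglyMeasurable
  · exact (continuousOn_slice hf.continuousOn hz).intervalIntegrable _ _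
  · exact (continuousOn_slice hf' hz).aestronglyMeasurable
  · refine Filter.Eventually.of_forall fun t ht y hy => ?_
    rw [uIoc_of_le zero_le_one] at ht
    exact hC (t, y) ⟨Ioc_subset_Icc_self ht, hy⟩
  · exact intervalIntegrable_const
  · refine Filter.Eventually.of_forall fun t _ y hy => ?_
    have h1 : DifferentiableAt ℝ f (t, y) :=
      (hf.contDiffAt (hO.mem_nhds ⟨mem_univ _, hrU hy⟩)).differentiableAt one_ne_zero
    have h2 : HasFDerivAt (fun y : E => (t, y)) (ContinuousLinearMap.inr ℝ ℝ E) y :=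
      hasFDerivAt_prodMk_right t y
    exact h1.hasFDerivAt.comp y h2

theorem fderiv_integral_param_apply [CompleteSpace F] {f : ℝ × E → F} {U : Set E} (hU : IsOpen U)
    (hf : ContDiffOn ℝ 1 f (univ ×ˢ U)) {z : E} (hz : z ∈ U) (w : E) :
    fderiv ℝ (fun y => ∫ t in (0 : ℝ)..1, f (t, y)) z w =
      ∫ t in (0 : ℝ)..1, fderiv ℝ f (t, z) (0, w) := by
  rw [(hasFDerivAt_integral_param hU hf hz).fderiv, ContinuousLinearMap.intervalIntegral_apply]
  · rfl
  · have hf' : ContinuousOn (fun p => (fderiv ℝ f p).comp (ContinuousLinearMap.inr ℝ ℝ E))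
        (univ ×ˢ U) :=
      (hf.continuousOn_fderiv_of_isOpen (isOpen_univ.prod hU) le_rfl).clm_comp continuousOn_const
    exact (continuousOn_slice hf' hz).intervalIntegrable _ _

theorem contDiffOn_integral_param [CompleteSpace F] {f : ℝ × E → F} {U : Set E} (hU : IsOpen U)
    (hf : ContDiffOn ℝ ∞ f (univ ×ˢ U)) :
    ContDiffOn ℝ ∞ (fun y => ∫ t in (0 : ℝ)..1, f (t, y)) U := by
  rw [contDiffOn_infty]
  intro n
  induction n generalizing f with
  | zero =>
    refine contDiffOn_zero.2 fun y hy => ContinuousAt.continuousWithinAt ?_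
    exact (hasFDerivAt_integral_param hU (hf.of_le (by simp)) hy).continuousAt
  | succ n ih =>
    refine (contDiffOn_succ_iff_fderiv_of_isOpen (n := n) hU).2 ⟨fun y hy => ?_, by simp, ?_⟩
    · exact (hasFDerivAt_integral_param hU (hf.of_le (by simp)) hy
        ).differentiableAt.differentiableWithinAt
    · refine contDiffOn_clm_apply.2 fun w => ?_
      have h1 : ContDiffOn ℝ ∞ (fun p => fderiv ℝ f p (0, w)) (univ ×ˢ U) :=
        (hf.fderiv_of_isOpen (isOpen_univ.prod hU) (by simp)).clm_apply contDiffOn_const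
      refine (ih h1).congr fun y hy => ?_
      exact fderiv_integral_param_apply hU (hf.of_le (by simp)) hy w

/-- The contraction of a form on `ℝ × E` with the vector field `∂/∂t`, restricted to the slice
`{t} × E`. -/
def contractSlice {k : ℕ} (θ : (ℝ × E) [⋀^Fin (k + 1)]→L[ℝ] F) : E [⋀^Fin k]→L[ℝ] F :=
  (θ.curryLeft (1, 0)).compContinuousLinearMap (ContinuousLinearMap.inr ℝ ℝ E)

/-- The restriction of a form on `ℝ × E` to a slice `{t} × E`. -/
def restrictSlice {k : ℕ} (θ : (ℝ × E) [⋀^Fin k]→L[ℝ] F) : E [⋀^Fin k]→L[ℝ] F :=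
  θ.compContinuousLinearMap (ContinuousLinearMap.inr ℝ ℝ E)

theorem contractSlice_apply {k : ℕ} (θ : (ℝ × E) [⋀^Fin (k + 1)]→L[ℝ] F) (v : Fin k → E) :
    contractSlice θ v = θ (Fin.cons (1, 0) fun i => (0, v i)) := rfl

theorem restrictSlice_apply {k : ℕ} (θ : (ℝ × E) [⋀^Fin k]→L[ℝ] F) (v : Fin k → E) :
    restrictSlice θ v = θ fun i => (0, v i) := rfl

/-- The fibre integral over `[0, 1]` of a form on `ℝ × E`. -/
def fibreIntegral {k : ℕ} (θ : ℝ × E → (ℝ × E) [⋀^Fin (k + 1)]→L[ℝ] F) (z : E) :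
    E [⋀^Fin k]→L[ℝ] F :=
  ∫ t in (0 : ℝ)..1, contractSlice (θ (t, z))

variable [FiniteDimensional ℝ F]

theorem contDiffOn_alternating_apply {Z : Type*} [NormedAddCommGroup Z] [NormedSpace ℝ Z] {k : ℕ}
    {n : WithTop ℕ∞} {s : Set Z} {f : Z → E [⋀^Fin k]→L[ℝ] F} (h : ContDiffOn ℝ n f s)
    (v : Fin k → E) : ContDiffOn ℝ n (fun z => f z v) s :=
  (ContinuousAlternatingMap.apply ℝ E F v).contDiff.comp_contDiffOn h

theorem contDiffOn_contractSlice {k : ℕ} {θ : ℝ × E → (ℝ × E) [⋀^Fin (k + 1)]→L[ℝ] F}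
    {s : Set (ℝ × E)} {n : WithTop ℕ∞} (hθ : ContDiffOn ℝ n θ s) :
    ContDiffOn ℝ n (fun p => contractSlice (θ p)) s :=
  contDiffOn_alternating fun v =>
    contDiffOn_alternating_apply hθ (Fin.cons (1, 0) fun i => (0, v i))

theorem contDiffOn_fibreIntegral {k : ℕ} {θ : ℝ × E → (ℝ × E) [⋀^Fin (k + 1)]→L[ℝ] F} {U : Set E}
    (hU : IsOpen U) (hθ : ContDiffOn ℝ ∞ θ (univ ×ˢ U)) :
    ContDiffOn ℝ ∞ (fibreIntegral θ) U := by
  have : CompleteSpace F := FiniteDimensional.complete ℝ F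
  exact contDiffOn_integral_param hU (contDiffOn_contractSlice hθ)

theorem fibreIntegral_apply {k : ℕ} {θ : ℝ × E → (ℝ × E) [⋀^Fin (k + 1)]→L[ℝ] F} {U : Set E}
    (hθ : ContDiffOn ℝ ∞ θ (univ ×ˢ U)) {z : E} (hz : z ∈ U) (v : Fin k → E) :
    fibreIntegral θ z v = ∫ t in (0 : ℝ)..1, θ (t, z) (Fin.cons (1, 0) fun i => (0, v i)) := by
  have : CompleteSpace F := FiniteDimensional.complete ℝ F
  have h := (ContinuousAlternatingMap.apply ℝ E F v).intervalIntegral_comp_comm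
    (μ := volume) (a := 0) (b := 1) (f := fun t => contractSlice (θ (t, z)))
    ((continuousOn_slice (contDiffOn_contractSlice hθ).continuousOn hz).intervalIntegrable _ _)
  exact h.symm

/-- Stokes' formula for the fibre integral of a closed form on `ℝ × U`: the exterior derivative of
the fibre integral is the difference of the restrictions to the ends. -/
theorem extDeriv_fibreIntegral {k : ℕ} {θ : ℝ × E → (ℝ × E) [⋀^Fin (k + 1)]→L[ℝ] F} {U : Set E}
    (hU : IsOpen U) (hθ : ContDiffOn ℝ ∞ θ (univ ×ˢ U))
    (hd : ∀ t, ∀ z ∈ U, extDeriv θ (t, z) = 0) {z : E} (hz : z ∈ U) :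
    extDeriv (fibreIntegral θ) z = restrictSlice (θ (1, z)) - restrictSlice (θ (0, z)) := by
  have : CompleteSpace F := FiniteDimensional.complete ℝ F
  have hO : IsOpen ((univ : Set ℝ) ×ˢ U) := isOpen_univ.prod hU
  have hn : ∀ t : ℝ, (univ : Set ℝ) ×ˢ U ∈ nhds (t, z) := fun t => hO.mem_nhds ⟨mem_univ t, hz⟩
  ext v
  rw [extDeriv_apply (((contDiffOn_fibreIntegral hU hθ).contDiffAt (hU.mem_nhds hz)
    ).differentiableAt (by simp))]
  let V : Fin (k + 1) → ℝ × E := fun i => (0, v i)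
  let f : Fin (k + 1) → ℝ × E → F := fun i p =>
    θ p (Fin.cons (1, 0) fun j => (0, i.removeNth v j))
  have hf : ∀ i, ContDiffOn ℝ ∞ (f i) (univ ×ˢ U) := fun i =>
    contDiffOn_alternating_apply hθ _
  have hg : ContDiffOn ℝ ∞ (fun p => θ p V) (univ ×ˢ U) := contDiffOn_alternating_apply hθ V
  have h1 : ∀ i : Fin (k + 1), fderiv ℝ (fun y => fibreIntegral θ y (i.removeNth v)) z (v i) =
      ∫ t in (0 : ℝ)..1, fderiv ℝ (f i) (t, z) (0, v i) := by
    intro i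
    rw [← fderiv_integral_param_apply hU ((hf i).of_le (by simp)) hz]
    congr 1
    apply Filter.EventuallyEq.fderiv_eq
    filter_upwards [hU.mem_nhds hz] with y hy
    exact fibreIntegral_apply hθ hy _
  have h2 : ∀ t : ℝ, ∑ i : Fin (k + 1), (-1 : ℤ) ^ i.val • fderiv ℝ (f i) (t, z) (0, v i) =
      fderiv ℝ (fun p => θ p V) (t, z) (1, 0) := by
    intro t
    have h3 := congrArg (fun α => α (Fin.cons (1, 0) V)) (hd t z hz)
    simp only [extDeriv_apply ((hθ.contDiffAt (hn t)).differentiableAt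
      (by simp)), Fin.sum_univ_succ (n := k + 1)] at h3
    have h4 : ∀ i : Fin (k + 1), i.succ.removeNth (Fin.cons (1, 0) V : Fin (k + 2) → ℝ × E) =
        Fin.cons (1, 0) fun j => (0, i.removeNth v j) := by
      intro i
      funext j
      refine Fin.cases ?_ (fun j => ?_) j
      · simp [Fin.removeNth]
      · simp [Fin.removeNth, V]
    simp only [h4, Fin.cons_zero, Fin.cons_succ, Fin.val_zero, pow_zero, one_smul,
      Fin.removeNth_zero, Fin.tail_cons, Fin.val_succ, pow_succ, mul_neg, mul_one, neg_smul,
      Finset.sum_neg_distrib] at h3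
    exact (eq_of_sub_eq_zero (by rw [sub_eq_add_neg]; exact h3)).symm
  have hint : ∀ i, IntervalIntegrable (fun t : ℝ => fderiv ℝ (f i) (t, z) (0, v i))
      volume 0 1 := fun i => (continuousOn_slice (((hf i).continuousOn_fderiv_of_isOpen hO
        (by simp)).clm_apply continuousOn_const) hz).intervalIntegrable _ _
  calc ∑ i : Fin (k + 1), (-1 : ℤ) ^ i.val •
        fderiv ℝ (fun y => fibreIntegral θ y (i.removeNth v)) z (v i)
      = ∑ i : Fin (k + 1), ∫ t in (0 : ℝ)..1, (-1 : ℤ) ^ i.val • fderiv ℝ (f i) (t, z) (0, v i) := by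
        refine Finset.sum_congr rfl fun i _ => ?_
        rw [h1]
        simp only [← Int.cast_smul_eq_zsmul ℝ]
        rw [intervalIntegral.integral_smul]
    _ = ∫ t in (0 : ℝ)..1, fderiv ℝ (fun p => θ p V) (t, z) (1, 0) := by
        rw [← intervalIntegral.integral_finsetSum fun i _ => ?_]
        · simp only [h2]
        · simp only [← Int.cast_smul_eq_zsmul ℝ]
          exact ⟨(hint i).1.smul _, (hint i).2.smul _⟩
    _ = θ (1, z) V - θ (0, z) V := by
        refine intervalIntegral.integral_eq_sub_of_hasDerivAt (f := fun t => θ (t, z) V)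
          (fun t _ => ?_) ?_
        · have h5 := ((hg.contDiffAt (hn t)).differentiableAt
            (by simp)).hasFDerivAt
          have h6 : HasDerivAt (fun t : ℝ => (t, z)) ((1 : ℝ), (0 : E)) t :=
            (hasDerivAt_id t).prodMk (hasDerivAt_const t z)
          exact h5.comp_hasDerivAt t h6
        · exact (continuousOn_slice ((hg.continuousOn_fderiv_of_isOpen hO
            (by simp)).clm_apply continuousOn_const) hz).intervalIntegrable _ _

end Integration

/-! ### Curvature and Chern character of a connection form -/

section Curvature

variable {X : Type*} [NormedAddCommGroup X] [NormedSpace ℝ X]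
  {𝔸 : Type} [NormedRing 𝔸] [NormedAlgebra ℝ 𝔸]

/-- The curvature `dA + A ∧ A` of a matrix-valued one-form `A` on a normed space. -/
def localCurv (A : X → X →L[ℝ] 𝔸) (z : X) : X →L[ℝ] X →L[ℝ] 𝔸 :=
  let B := fderiv ℝ A z + (ContinuousLinearMap.mul ℝ 𝔸).bilinearComp (A z) (A z)
  B - B.flip

theorem localCurv_apply (A : X → X →L[ℝ] 𝔸) (z u v : X) :
    localCurv A z u v = fderiv ℝ A z u v - fderiv ℝ A z v u + A z u * A z v - A z v * A z u := by
  simp [localCurv]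
  abel

/-- The multilinear map `(v₀, …, v_(2m-1)) ↦ R(v₀, v₁) ⋯ R(v_(2m-2), v_(2m-1))`. -/
def curvChain (R : X →L[ℝ] X →L[ℝ] 𝔸) :
    (m : ℕ) → ContinuousMultilinearMap ℝ (fun _ : Fin (2 * m) => X) 𝔸
  | 0 => ContinuousMultilinearMap.constOfIsEmpty ℝ (fun _ : Fin 0 => X) 1
  | m + 1 =>
    let L : 𝔸 →L[ℝ] X →L[ℝ] X →L[ℝ] 𝔸 :=
      ((ContinuousLinearMap.compL ℝ X (X →L[ℝ] 𝔸) (X →L[ℝ] 𝔸)).comp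
        ((ContinuousLinearMap.compL ℝ X 𝔸 𝔸).comp (ContinuousLinearMap.mul ℝ 𝔸))).flip R
    (L.compContinuousMultilinearMap (curvChain R m)).uncurryRight.uncurryRight

theorem curvChain_apply (R : X →L[ℝ] X →L[ℝ] 𝔸) (m : ℕ) (v : Fin (2 * m) → X) :
    curvChain R m v = curvWord (fun x y => R x y) m v := by
  induction m with
  | zero => rfl
  | succ m ih =>
    rw [curvWord, ← ih]
    rfl

theorem chain_apply (a : X →L[ℝ] 𝔸) (R : X →L[ℝ] X →L[ℝ] 𝔸) (k : ℕ) (v : Fin (2 * k + 1) → X) :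
    chain a R k v = csWord (fun x => a x) (fun x y => R x y) k v := by
  induction k with
  | zero => rfl
  | succ k ih => rw [csWord, ← ih, chain_succ]

/-- The form `Tr R^m`, with the normalization `(v₁, …, v_2m) ↦ ∑_s sign(s) Tr (R(v_s(1), v_s(2)) ⋯)`.
-/
def traceCurv (τ : 𝔸 →L[ℝ] ℂ) (R : X →L[ℝ] X →L[ℝ] 𝔸) (m : ℕ) : X [⋀^Fin (2 * m)]→L[ℝ] ℂ :=
  ContinuousMultilinearMap.alternatization (τ.compContinuousMultilinearMap (curvChain R m))

theorem traceCurv_apply (τ : 𝔸 →L[ℝ] ℂ) (R : X →L[ℝ] X →L[ℝ] 𝔸) (m : ℕ) (v : Fin (2 * m) → X) :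
    traceCurv τ R m v = ∑ s : Equiv.Perm (Fin (2 * m)), (Equiv.Perm.sign s : ℤ) •
      τ (curvWord (fun x y => R x y) m (v ∘ s)) := by
  simp only [traceCurv, ContinuousMultilinearMap.alternatization_apply_apply,
    ContinuousLinearMap.compContinuousMultilinearMap_coe, Function.comp_apply, curvChain_apply,
    Units.smul_def]

theorem hasFDerivAt_curvWord {R : X → X →L[ℝ] X →L[ℝ] 𝔸} {z : X} (hR : DifferentiableAt ℝ R z)
    (m : ℕ) (v : Fin (2 * m) → X) :
    ∃ L : X →L[ℝ] 𝔸, HasFDerivAt (fun y => curvWord (fun a b => R y a b) m v) L z ∧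
      ∀ u, L u = curvWordDeriv (fun a b => R z a b) (fun u a b => fderiv ℝ R z u a b) m u v := by
  induction m with
  | zero => exact ⟨0, hasFDerivAt_const _ _, fun u => rfl⟩
  | succ m ih =>
    obtain ⟨L, hL, hLu⟩ := ih (Fin.init (Fin.init v))
    have h := hL.mul' ((hR.hasFDerivAt.clm_apply (hasFDerivAt_const
      (v (Fin.last (2 * m)).castSucc) z)).clm_apply (hasFDerivAt_const
      (v (Fin.last (2 * m + 1))) z))
    refine ⟨_, h, fun u => ?_⟩
    rw [curvWordDeriv, ← hLu]
    simp [add_comm]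

theorem contDiffOn_curvWord {Z : Type*} [NormedAddCommGroup Z] [NormedSpace ℝ Z]
    {R : Z → X →L[ℝ] X →L[ℝ] 𝔸} {s : Set Z} {n : WithTop ℕ∞} (hR : ContDiffOn ℝ n R s) (m : ℕ)
    (v : Fin (2 * m) → X) : ContDiffOn ℝ n (fun y => curvWord (fun a b => R y a b) m v) s := by
  induction m with
  | zero => exact contDiffOn_const
  | succ m ih =>
    exact (ih _).mul ((hR.clm_apply contDiffOn_const).clm_apply contDiffOn_const)

theorem contDiffOn_localCurv [FiniteDimensional ℝ X] {A : X → X →L[ℝ] 𝔸} {s : Set X}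
    (hs : IsOpen s) (hA : ContDiffOn ℝ ∞ A s) : ContDiffOn ℝ ∞ (localCurv A) s := by
  have hA' : ContDiffOn ℝ ∞ (fderiv ℝ A) s := hA.fderiv_of_isOpen hs (by simp)
  refine contDiffOn_clm_apply.2 fun u => contDiffOn_clm_apply.2 fun v => ?_
  simp only [localCurv_apply]
  have e : ∀ w, ContDiffOn ℝ ∞ (fun z => A z w) s := fun w => hA.clm_apply contDiffOn_const
  have e' : ∀ w w', ContDiffOn ℝ ∞ (fun z => fderiv ℝ A z w w') s := fun w w' =>
    (hA'.clm_apply contDiffOn_const).clm_apply contDiffOn_const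
  exact (((e' u v).sub (e' v u)).add ((e u).mul (e v))).sub ((e v).mul (e u))

theorem contDiffOn_traceCurv [FiniteDimensional ℝ X] {Z : Type*} [NormedAddCommGroup Z]
    [NormedSpace ℝ Z] (τ : 𝔸 →L[ℝ] ℂ) {R : Z → X →L[ℝ] X →L[ℝ] 𝔸} {s : Set Z} {n : WithTop ℕ∞}
    (hR : ContDiffOn ℝ n R s) (m : ℕ) : ContDiffOn ℝ n (fun y => traceCurv τ (R y) m) s := by
  refine contDiffOn_alternating fun v => ?_
  simp only [traceCurv_apply, ← Int.cast_smul_eq_zsmul ℝ]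
  exact ContDiffOn.sum fun i _ => contDiffOn_const.smul
    (τ.contDiff.comp_contDiffOn (contDiffOn_curvWord hR m _))

theorem fderiv_localCurv [FiniteDimensional ℝ X] {A : X → X →L[ℝ] 𝔸} {s : Set X} (hs : IsOpen s)
    (hA : ContDiffOn ℝ ∞ A s) {z : X} (hz : z ∈ s) (u v w : X) :
    fderiv ℝ (localCurv A) z u v w =
      fderiv ℝ (fderiv ℝ A) z u v w - fderiv ℝ (fderiv ℝ A) z u w v +
        (fderiv ℝ A z u v * A z w + A z v * fderiv ℝ A z u w) -
        (fderiv ℝ A z u w * A z v + A z w * fderiv ℝ A z u v) := by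
  have hz' := hs.mem_nhds hz
  have h1 := ((hA.contDiffAt hz').differentiableAt (by simp)).hasFDerivAt
  have h2 := (((hA.fderiv_of_isOpen hs (m := ∞) (by simp)).contDiffAt hz').differentiableAt
    (by simp)).hasFDerivAt
  have e : ∀ w, HasFDerivAt (fun y => A y w) _ z := fun w =>
    h1.clm_apply (hasFDerivAt_const w z)
  have e' : ∀ w w', HasFDerivAt (fun y => fderiv ℝ A y w w') _ z := fun w w' =>
    (h2.clm_apply (hasFDerivAt_const w z)).clm_apply (hasFDerivAt_const w' z)
  have h3 := (((e' v w).sub (e' w v)).add ((e v).mul' (e w))).sub ((e w).mul' (e v))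
  have h4 := ((((contDiffOn_localCurv hs hA).contDiffAt hz').differentiableAt
    (by simp)).hasFDerivAt.clm_apply (hasFDerivAt_const v z)).clm_apply (hasFDerivAt_const w z)
  have h5 : (fun y => localCurv A y v w) = _ := funext fun y => localCurv_apply A y v w
  rw [h5] at h4
  have h6 := DFunLike.congr_fun (h4.unique h3) u
  simp at h6
  rw [h6]
  abel

theorem two_le_infty : (2 : WithTop ℕ∞) ≤ ∞ := WithTop.coe_le_coe.2 (le_top : (2 : ℕ∞) ≤ ⊤)

/-- The Chern character forms are closed. -/
theorem extDeriv_traceCurv [FiniteDimensional ℝ X] {τ : 𝔸 →L[ℝ] ℂ}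
    (hτ : ∀ a b, τ (a * b) = τ (b * a)) {A : X → X →L[ℝ] 𝔸} {s : Set X} (hs : IsOpen s)
    (hA : ContDiffOn ℝ ∞ A s) (m : ℕ) {z : X} (hz : z ∈ s) :
    extDeriv (fun y => traceCurv τ (localCurv A y) m) z = 0 := by
  have hz' := hs.mem_nhds hz
  have hR := contDiffOn_localCurv hs hA
  have hRz := (hR.contDiffAt hz').differentiableAt (by simp)
  ext v
  rw [extDeriv_apply (((contDiffOn_traceCurv τ hR m).contDiffAt hz').differentiableAt (by simp))]
  have h1 : ∀ i : Fin (2 * m + 1),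
      fderiv ℝ (fun y => traceCurv τ (localCurv A y) m (i.removeNth v)) z (v i) =
        ∑ σ : Equiv.Perm (Fin (2 * m)), (Equiv.Perm.sign σ : ℤ) • (τ : 𝔸 →ₗ[ℝ] ℂ)
          (curvWordDeriv (fun j k => localCurv A z (v j) (v k))
            (fun l j k => fderiv ℝ (localCurv A) z (v l) (v j) (v k)) m i (i.succAbove ∘ σ)) := by
    intro i
    choose L hL hLu using fun σ : Equiv.Perm (Fin (2 * m)) =>
      hasFDerivAt_curvWord hRz m (i.removeNth v ∘ σ)
    have h2 := HasFDerivAt.fun_sum (u := Finset.univ) fun σ _ =>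
      ((τ.hasFDerivAt.comp z (hL σ)).const_smul ((Equiv.Perm.sign σ : ℤ) : ℝ))
    have h3 : (fun y => traceCurv τ (localCurv A y) m (i.removeNth v)) = _ :=
      funext fun y => traceCurv_apply τ (localCurv A y) m (i.removeNth v)
    simp only [← Int.cast_smul_eq_zsmul ℝ] at h3 ⊢
    rw [h3]
    erw [h2.fderiv]
    rw [sum_apply]
    refine Finset.sum_congr rfl fun σ _ => ?_
    rw [smul_apply, ContinuousLinearMap.comp_apply, hLu,
      curvWordDeriv_comp v (fun a b => localCurv A z a b)
        (fun u a b => fderiv ℝ (localCurv A) z u a b)]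
    rfl
  simp only [h1]
  refine sum_sign_trace_curvWordDeriv (τ : 𝔸 →ₗ[ℝ] ℂ) hτ (fun i => A z (v i))
    (fun i j => fderiv ℝ A z (v i) (v j)) (fun i j k => fderiv ℝ (fderiv ℝ A) z (v i) (v j) (v k))
    (fun i j k => ?_) _ _ (fun i j => localCurv_apply A z _ _)
    (fun u i j => fderiv_localCurv hs hA hz _ _ _)
  have hsym := (hA.contDiffAt hz').isSymmSndFDerivAt (by simpa using two_le_infty)
  rw [hsym.eq]

end Curvature

/-! ### The local Chern-Simons form -/

section LocalChernSimons

variable {E : Type*} [NormedAddCommGroup E] [NormedSpace ℝ E] [FiniteDimensional ℝ E]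

theorem traceC_mul_comm {n : Type} [Fintype n] [DecidableEq n] (a b : EndC n) :
    traceC n (a * b) = traceC n (b * a) := by
  rw [traceC_apply, traceC_apply]
  exact LinearMap.trace_mul_comm ℂ a.toLinearMap b.toLinearMap

section Total

variable {𝔸 : Type} [NormedRing 𝔸] [NormedAlgebra ℝ 𝔸]

/-- A family `A_t` of one-forms on `E`, seen as a one-form on `ℝ × E` without `dt` component. -/
def totalForm (A : ℝ × E → E →L[ℝ] 𝔸) (p : ℝ × E) : ℝ × E →L[ℝ] 𝔸 :=
  (A p).comp (ContinuousLinearMap.snd ℝ ℝ E)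

theorem contDiffOn_totalForm {A : ℝ × E → E →L[ℝ] 𝔸} {s : Set (ℝ × E)} {n : WithTop ℕ∞}
    (hA : ContDiffOn ℝ n A s) : ContDiffOn ℝ n (totalForm A) s :=
  hA.clm_comp contDiffOn_const

/-- The curvature of the total form is `R_t + dt ∧ ∂A_t/∂t`. -/
theorem localCurv_totalForm {A : ℝ × E → E →L[ℝ] 𝔸} {t : ℝ} {z : E}
    (hA : DifferentiableAt ℝ A (t, z)) (p q : ℝ × E) :
    localCurv (totalForm A) (t, z) p q = localCurv (fun y => A (t, y)) z p.2 q.2 +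
      p.1 • deriv (fun s => A (s, z)) t q.2 - q.1 • deriv (fun s => A (s, z)) t p.2 := by
  have h1 : ∀ p q : ℝ × E, fderiv ℝ (totalForm A) (t, z) p q = fderiv ℝ A (t, z) p q.2 := by
    intro p q
    have h := (hA.hasFDerivAt.clm_comp
      (hasFDerivAt_const (ContinuousLinearMap.snd ℝ ℝ E) (t, z))).fderiv
    change fderiv ℝ (fun p => (A p).comp (ContinuousLinearMap.snd ℝ ℝ E)) (t, z) p q = _
    rw [h]
    simp
  have h2 : ∀ u, fderiv ℝ (fun y => A (t, y)) z u = fderiv ℝ A (t, z) (0, u) := by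
    intro u
    change fderiv ℝ (A ∘ Prod.mk t) z u = _
    rw [(hA.hasFDerivAt.comp z (hasFDerivAt_prodMk_right t z)).fderiv]
    rfl
  have h3 : deriv (fun s => A (s, z)) t = fderiv ℝ A (t, z) (1, 0) := by
    have h6 : HasDerivAt (fun t : ℝ => (t, z)) ((1 : ℝ), (0 : E)) t :=
      (hasDerivAt_id t).prodMk (hasDerivAt_const t z)
    exact (hA.hasFDerivAt.comp_hasDerivAt t h6).deriv
  have h4 : ∀ p : ℝ × E, fderiv ℝ A (t, z) p =
      p.1 • fderiv ℝ A (t, z) (1, 0) + fderiv ℝ A (t, z) (0, p.2) := by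
    intro p
    rw [← map_smul, ← map_add]
    simp
  rw [localCurv_apply, localCurv_apply, h1, h1, h2, h2, h3, h4 p, h4 q]
  simp [totalForm]
  abel

/-- Contracting the Chern character form of the total connection with `∂/∂t` gives the
Chern-Simons integrand. -/
theorem contractSlice_traceCurv {τ : 𝔸 →L[ℝ] ℂ} (hτ : ∀ a b, τ (a * b) = τ (b * a))
    {A : ℝ × E → E →L[ℝ] 𝔸} {t : ℝ} {z : E}
    (hA : DifferentiableAt ℝ A (t, z)) (k : ℕ) :
    contractSlice (k := 2 * k + 1) (traceCurv τ (localCurv (totalForm A) (t, z)) (k + 1)) =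
      (2 * (k + 1)) • ContinuousMultilinearMap.alternatization
        (τ.compContinuousMultilinearMap
          (chain (deriv (fun s => A (s, z)) t) (localCurv (fun y => A (t, y)) z) k)) := by
  ext v
  rw [contractSlice_apply]
  let V : Fin (2 * (k + 1)) → ℝ × E := Fin.cons (n := 2 * k + 1) (1, 0) fun i => (0, v i)
  have h1 := traceCurv_apply τ (localCurv (totalForm A) (t, z)) (k + 1) V
  simp only [← curvWord_comp V] at h1
  have h2 := sum_sign_trace_curvWord_succ (τ : 𝔸 →ₗ[ℝ] ℂ) hτ
    (fun i => deriv (fun s => A (s, z)) t (v i)) (fun i j => localCurv (fun y => A (t, y)) z (v i) (v j))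
    (fun i j => localCurv (totalForm A) (t, z) (V i) (V j)) ?_ ?_ ?_ ?_
  · refine (h1.trans h2).trans ?_
    rw [ContinuousAlternatingMap.smul_apply, ContinuousMultilinearMap.alternatization_apply_apply]
    congr 1
    refine Finset.sum_congr rfl fun σ _ => ?_
    rw [csWord_comp v (fun x => deriv (fun s => A (s, z)) t x)
      (fun x y => localCurv (fun y => A (t, y)) z x y), ← chain_apply]
    rfl
  · rw [localCurv_totalForm hA]
    simp [V]
  · intro j
    rw [localCurv_totalForm hA]
    change _ + (1 : ℝ) • _ - (0 : ℝ) • _ = _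
    simp [V]
  · intro j
    rw [localCurv_totalForm hA]
    change _ + (0 : ℝ) • _ - (1 : ℝ) • _ = _
    simp [V]
  · intro i j
    rw [localCurv_totalForm hA]
    change _ + (0 : ℝ) • _ - (0 : ℝ) • _ = _
    simp [V]

end Total

variable {n : Type} [Fintype n] [DecidableEq n]

/-- The degree `2k+1` component of the Chern-Simons form of a family `A_t`, `t ∈ [0, 1]`, of
connection forms on an open subset of `E`. -/
def localCS (A : ℝ × E → E →L[ℝ] EndC n) (k : ℕ) (z : E) : E [⋀^Fin (2 * k + 1)]→L[ℝ] ℂ :=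
  ∫ t in (0 : ℝ)..1, csDensity (derivWithin (fun s => A (s, z)) (Icc 0 1) t)
    (localCurv (fun y => A (t, y)) z) k

/-- The degree `2k+2` component of the Chern character form on `ℝ × E` of the total connection. -/
def chernForm (A : ℝ × E → E →L[ℝ] EndC n) (k : ℕ) (p : ℝ × E) :
    (ℝ × E) [⋀^Fin (2 * k + 1 + 1)]→L[ℝ] ℂ :=
  ((-(2 * (Real.pi : ℂ) * Complex.I)⁻¹) ^ (k + 1) * (k.factorial : ℂ)⁻¹ * ((2 : ℂ) ^ k)⁻¹ *
    (2 * (k + 1) : ℂ)⁻¹) • traceCurv (traceC n) (localCurv (totalForm A) p) (k + 1)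

theorem contractSlice_chernForm {A : ℝ × E → E →L[ℝ] EndC n} {t : ℝ} {z : E}
    (hA : DifferentiableAt ℝ A (t, z)) (k : ℕ) :
    contractSlice (chernForm A k (t, z)) =
      csDensity (deriv (fun s => A (s, z)) t) (localCurv (fun y => A (t, y)) z) k := by
  have h := contractSlice_traceCurv traceC_mul_comm hA k
  have h2 : ∀ (c : ℂ) (α : (ℝ × E) [⋀^Fin (2 * k + 1 + 1)]→L[ℝ] ℂ),
      contractSlice (c • α) = c • contractSlice α := fun c α => rfl
  rw [chernForm, h2, h, csDensity, ← Nat.cast_smul_eq_nsmul ℂ, smul_smul]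
  congr 1
  have h3 : ((2 * (k + 1) : ℕ) : ℂ) ≠ 0 := Nat.cast_ne_zero.2 (by omega)
  push_cast at h3 ⊢
  rw [mul_assoc, inv_mul_cancel₀ h3, mul_one]

theorem localCS_eq_fibreIntegral {A : ℝ × E → E →L[ℝ] EndC n} {z : E}
    (hA : ∀ t, DifferentiableAt ℝ A (t, z)) (k : ℕ) :
    localCS A k z = fibreIntegral (chernForm A k) z := by
  refine intervalIntegral.integral_congr fun t ht => ?_
  rw [uIcc_of_le zero_le_one] at ht
  rw [contractSlice_chernForm (hA t)]
  congr 1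
  have h6 : HasDerivAt (fun t : ℝ => (t, z)) ((1 : ℝ), (0 : E)) t :=
    (hasDerivAt_id t).prodMk (hasDerivAt_const t z)
  exact ((hA t).hasFDerivAt.comp_hasDerivAt t h6).differentiableAt.derivWithin
    (uniqueDiffOn_Icc zero_lt_one t ht)

variable {A : ℝ × E → E →L[ℝ] EndC n} {U : Set E}

theorem contDiffOn_chernForm (hU : IsOpen U) (hA : ContDiffOn ℝ ∞ A (univ ×ˢ U)) (k : ℕ) :
    ContDiffOn ℝ ∞ (chernForm A k) (univ ×ˢ U) :=
  (contDiffOn_traceCurv _ (contDiffOn_localCurv (isOpen_univ.prod hU)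
    (contDiffOn_totalForm hA)) (k + 1)).const_smul _

theorem differentiableAt_of_contDiffOn (hU : IsOpen U) (hA : ContDiffOn ℝ ∞ A (univ ×ˢ U)) {z : E}
    (hz : z ∈ U) (t : ℝ) : DifferentiableAt ℝ A (t, z) :=
  (hA.contDiffAt ((isOpen_univ.prod hU).mem_nhds ⟨mem_univ _, hz⟩)).differentiableAt (by simp)

theorem contDiffOn_localCS (hU : IsOpen U) (hA : ContDiffOn ℝ ∞ A (univ ×ˢ U)) (k : ℕ) :
    ContDiffOn ℝ ∞ (localCS A k) U :=
  (contDiffOn_fibreIntegral hU (contDiffOn_chernForm hU hA k)).congr fun _ hz =>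
    localCS_eq_fibreIntegral (differentiableAt_of_contDiffOn hU hA hz) k

theorem traceCurv_eq_zero {X : Type*} [NormedAddCommGroup X] [NormedSpace ℝ X]
    {𝔸 : Type} [NormedRing 𝔸] [NormedAlgebra ℝ 𝔸] (τ : 𝔸 →L[ℝ] ℂ) {R : X →L[ℝ] X →L[ℝ] 𝔸} {m : ℕ}
    {v : Fin (2 * (m + 1)) → X} (h : ∀ i j, R (v i) (v j) = 0) : traceCurv τ R (m + 1) v = 0 := by
  rw [traceCurv_apply]
  refine Finset.sum_eq_zero fun σ _ => ?_
  rw [curvWord]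
  simp [h]

/-- The Chern-Simons form of a path between flat connections is closed. -/
theorem extDeriv_localCS (hU : IsOpen U) (hA : ContDiffOn ℝ ∞ A (univ ×ˢ U))
    (h0 : ∀ z ∈ U, localCurv (fun y => A (0, y)) z = 0)
    (h1 : ∀ z ∈ U, localCurv (fun y => A (1, y)) z = 0) (k : ℕ) {z : E} (hz : z ∈ U) :
    extDeriv (localCS A k) z = 0 := by
  have e : localCS A k =ᶠ[nhds z] fibreIntegral (chernForm A k) := by
    filter_upwards [hU.mem_nhds hz] with y hy
    exact localCS_eq_fibreIntegral (differentiableAt_of_contDiffOn hU hA hy) k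
  have hO : IsOpen ((univ : Set ℝ) ×ˢ U) := isOpen_univ.prod hU
  have hs : ∀ t, localCurv (fun y => A (t, y)) z = 0 → restrictSlice (chernForm A k (t, z)) = 0 := by
    intro t ht
    ext v
    rw [restrictSlice_apply, chernForm, ContinuousAlternatingMap.smul_apply,
      traceCurv_eq_zero _ fun i j => ?_, smul_zero]
    · rfl
    · rw [localCurv_totalForm (differentiableAt_of_contDiffOn hU hA hz t), ht]
      simp
  rw [e.extDeriv_eq, extDeriv_fibreIntegral hU (contDiffOn_chernForm hU hA k) _ hz,
    hs 0 (h0 z hz), hs 1 (h1 z hz), sub_self]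
  intro t y hy
  have h2 := extDeriv_traceCurv traceC_mul_comm hO (contDiffOn_totalForm hA) (k + 1)
    (z := (t, y)) ⟨mem_univ _, hy⟩
  have h3 : DifferentiableAt ℝ (fun p => traceCurv (traceC n) (localCurv (totalForm A) p) (k + 1))
      (t, y) := ((contDiffOn_traceCurv _ (contDiffOn_localCurv hO
      (contDiffOn_totalForm hA)) (k + 1)).contDiffAt (hO.mem_nhds ⟨mem_univ _, hy⟩)).differentiableAt
        (by simp)
  change extDeriv (fun p => _ • traceCurv (traceC n) (localCurv (totalForm A) p) (k + 1)) (t, y) = 0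
  rw [extDeriv] at h2 ⊢
  rw [fderiv_fun_const_smul h3, ContinuousAlternatingMap.alternatizeUncurryFin_smul]
  erw [h2]
  exact smul_zero _

end LocalChernSimons

/-! ### Gauge transformations -/

section Gauge

variable {E : Type*} [NormedAddCommGroup E] [NormedSpace ℝ E] [FiniteDimensional ℝ E]
  {F : Type*} [NormedAddCommGroup F] [NormedSpace ℝ F] [FiniteDimensional ℝ F]
  {n m : Type} [Fintype n] [DecidableEq n] [Fintype m] [DecidableEq m]

/-- Linear maps `ℂ^n → ℂ^m`. -/
abbrev HomC (n m : Type) [Fintype n] [Fintype m] : Type := (n → ℂ) →L[ℂ] (m → ℂ)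

/-- Composition of `ℂ`-linear maps, as a bilinear map over `ℝ`. -/
def compR (n m l : Type) [Fintype n] [Fintype m] [Fintype l] :
    HomC m l →L[ℝ] HomC n m →L[ℝ] HomC n l :=
  LinearMap.mkContinuous₂
    (LinearMap.mk₂ ℝ (fun g h => g.comp h) (fun _ _ _ => rfl) (fun _ _ _ => rfl)
      (fun g h h' => by ext; simp) (fun c g h => by ext; simp)) 1
    fun g h => by
      rw [one_mul]
      exact ContinuousLinearMap.opNorm_comp_le g h

theorem compR_apply {n m l : Type} [Fintype n] [Fintype m] [Fintype l] (g : HomC m l)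
    (h : HomC n m) : compR n m l g h = g.comp h := rfl

/-- The curvature is equivariant: if `G A' = dG + (φ^* A) G` near `z`, then `G R' = (φ^* R) G`. -/
theorem localCurv_gauge {φ : E → F} {G : E → HomC n m} {A : F → F →L[ℝ] EndC m}
    {A' : E → E →L[ℝ] EndC n} {z : E} (hφ : ContDiffAt ℝ ∞ φ z) (hG : ContDiffAt ℝ ∞ G z)
    (hA : DifferentiableAt ℝ A (φ z)) (hA' : DifferentiableAt ℝ A' z)
    (h : ∀ᶠ y in nhds z, ∀ u, (G y).comp (A' y u) =
      fderiv ℝ G y u + (A (φ y) (fderiv ℝ φ y u)).comp (G y)) (u v : E) :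
    (G z).comp (localCurv A' z u v) =
      (localCurv A (φ z) (fderiv ℝ φ z u) (fderiv ℝ φ z v)).comp (G z) := by
  have dG := (hG.differentiableAt (by simp)).hasFDerivAt
  have dφ := (hφ.differentiableAt (by simp)).hasFDerivAt
  have ddG := ((hG.fderiv_right (m := ∞) (by simp)).differentiableAt (by simp)).hasFDerivAt
  have ddφ := ((hφ.fderiv_right (m := ∞) (by simp)).differentiableAt (by simp)).hasFDerivAt
  have hs : minSmoothness ℝ 2 ≤ ∞ := by simpa using two_le_infty
  have key : ∀ (u v : E) (c : n → ℂ),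
      G z (fderiv ℝ A' z u v c) = fderiv ℝ (fderiv ℝ G) z u v c +
        (fderiv ℝ A (φ z) (fderiv ℝ φ z u) (fderiv ℝ φ z v) (G z c) +
          A (φ z) (fderiv ℝ (fderiv ℝ φ) z u v) (G z c)) +
        A (φ z) (fderiv ℝ φ z v) (fderiv ℝ G z u c) - fderiv ℝ G z u (A' z v c) := by
    intro u v c
    have l1 := (compR n n m).hasFDerivAt_of_bilinear dG
      (hA'.hasFDerivAt.clm_apply (hasFDerivAt_const v z))
    have r1 := (compR n m m).hasFDerivAt_of_bilinear
      ((hA.hasFDerivAt.comp z dφ).clm_apply (ddφ.clm_apply (hasFDerivAt_const v z))) dG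
    have r2 := (ddG.clm_apply (hasFDerivAt_const v z)).add r1
    have e : (fun y => compR n n m (G y) (A' y v)) =ᶠ[nhds z]
        fun y => fderiv ℝ G y v + compR n m m (A (φ y) (fderiv ℝ φ y v)) (G y) := by
      filter_upwards [h] with y hy
      exact hy v
    have e2 := l1.unique (r2.congr_of_eventuallyEq e)
    have e3 := congrArg (fun f : HomC n m => f c) (DFunLike.congr_fun e2 u)
    simp [ContinuousLinearMap.precompR_apply, ContinuousLinearMap.precompL_apply, compR_apply] at e3
    rw [eq_sub_iff_add_eq, e3]
    abel
  have h0 : ∀ (u : E) (c : n → ℂ), G z (A' z u c) =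
      fderiv ℝ G z u c + A (φ z) (fderiv ℝ φ z u) (G z c) := fun u c =>
    congrArg (fun f : HomC n m => f c) (h.self_of_nhds u)
  have sG := hG.isSymmSndFDerivAt hs
  have sφ := hφ.isSymmSndFDerivAt hs
  ext1 c
  rw [ContinuousLinearMap.comp_apply, ContinuousLinearMap.comp_apply, localCurv_apply,
    localCurv_apply]
  have a1 : ∀ {l : Type} [Fintype l] (X Y P Q R S : EndC l) (c : l → ℂ),
      (X - Y + P * Q - R * S) c = X c - Y c + P (Q c) - R (S c) := fun _ _ _ _ _ _ _ => rfl
  rw [a1, a1]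
  simp only [map_sub, map_add]
  rw [key u v, key v u, h0 u (A' z v c), h0 v c, h0 v (A' z u c), h0 u c, sG.eq u v, sφ.eq u v]
  simp only [map_add]
  abel

theorem csDensity_apply (a : E →L[ℝ] EndC n) (R : E →L[ℝ] E →L[ℝ] EndC n) (k : ℕ)
    (v : Fin (2 * k + 1) → E) : csDensity a R k v =
      ((-(2 * (Real.pi : ℂ) * Complex.I)⁻¹) ^ (k + 1) * (k.factorial : ℂ)⁻¹ * ((2 : ℂ) ^ k)⁻¹) *
        ∑ s : Equiv.Perm (Fin (2 * k + 1)), (Equiv.Perm.sign s : ℤ) •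
          traceC n (csWord (fun x => a x) (fun x y => R x y) k (v ∘ s)) := by
  rw [csDensity, ContinuousAlternatingMap.smul_apply, smul_eq_mul,
    ContinuousMultilinearMap.alternatization_apply_apply]
  simp only [ContinuousLinearMap.compContinuousMultilinearMap_coe, Function.comp_apply, chain_apply,
    Units.smul_def]

theorem csWord_gauge {κ : Type*} {a' : κ → EndC n} {R' : κ → κ → EndC n} {a : κ → EndC m}
    {R : κ → κ → EndC m} {G : HomC n m} (ha : ∀ u, G.comp (a' u) = (a u).comp G)
    (hR : ∀ u v, G.comp (R' u v) = (R u v).comp G) (k : ℕ) (v : Fin (2 * k + 1) → κ) :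
    G.comp (csWord a' R' k v) = (csWord a R k v).comp G := by
  induction k with
  | zero => exact ha _
  | succ k ih =>
    simp only [csWord]
    change G.comp ((csWord a' R' k _).comp (R' _ _)) = ((csWord a R k _).comp (R _ _)).comp G
    rw [← ContinuousLinearMap.comp_assoc, ih, ContinuousLinearMap.comp_assoc, hR,
      ContinuousLinearMap.comp_assoc]

theorem traceC_conj {G : HomC n m} {H : HomC m n} (h2 : H.comp G = .id ℂ _)
    (h1 : G.comp H = .id ℂ _)
    {X' : EndC n} {X : EndC m} (h : G.comp X' = X.comp G) : traceC n X' = traceC m X := by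
  have e : X' = H.comp (X.comp G) := by
    rw [← h, ← ContinuousLinearMap.comp_assoc, h2, ContinuousLinearMap.id_comp]
  have e2 : X = (X.comp G).comp H := by
    rw [ContinuousLinearMap.comp_assoc, h1, ContinuousLinearMap.comp_id]
  conv_rhs => rw [e2]
  rw [e, traceC_apply, traceC_apply]
  exact LinearMap.trace_comp_comm' (X.comp G).toLinearMap H.toLinearMap

/-- The Chern-Simons integrand is invariant under conjugation and natural under pull-back. -/
theorem csDensity_gauge {a' : E →L[ℝ] EndC n} {R' : E →L[ℝ] E →L[ℝ] EndC n} {a : F →L[ℝ] EndC m}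
    {R : F →L[ℝ] F →L[ℝ] EndC m} {L : E →L[ℝ] F} {G : HomC n m} {H : HomC m n}
    (h2 : H.comp G = .id ℂ _) (h1 : G.comp H = .id ℂ _)
    (ha : ∀ u, G.comp (a' u) = (a (L u)).comp G)
    (hR : ∀ u v, G.comp (R' u v) = (R (L u) (L v)).comp G) (k : ℕ) :
    csDensity a' R' k = (csDensity a R k).compContinuousLinearMap L := by
  ext v
  rw [ContinuousAlternatingMap.compContinuousLinearMap_apply, csDensity_apply, csDensity_apply]
  congr 1
  refine Finset.sum_congr rfl fun s _ => ?_
  rw [traceC_conj h2 h1 (csWord_gauge ha hR k (v ∘ s)), csWord_comp L (fun x => a x)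
    (fun x y => R x y)]
  rfl

/-- Two families of connection forms `A'` and `A`, smooth on `ℝ × U'` and `ℝ × U`, which are related
by the map `φ : U' → U` and the invertible gauge transformation `G`: `G A'_t = dG + (φ^* A_t) G`. -/
structure GaugeRel (φ : E → F) (G : E → HomC n m) (A' : ℝ × E → E →L[ℝ] EndC n)
    (A : ℝ × F → F →L[ℝ] EndC m) (U' : Set E) (U : Set F) : Prop where
  isOpen' : IsOpen U'
  isOpen : IsOpen U
  mapsTo : MapsTo φ U' U
  contDiff_map : ContDiffOn ℝ ∞ φ U'
  contDiff_gauge : ContDiffOn ℝ ∞ G U'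
  invertible : ∀ z ∈ U', ∃ H : HomC m n, H.comp (G z) = .id ℂ _ ∧ (G z).comp H = .id ℂ _
  smooth' : ContDiffOn ℝ ∞ A' (univ ×ˢ U')
  smooth : ContDiffOn ℝ ∞ A (univ ×ˢ U)
  rel : ∀ t, ∀ z ∈ U', ∀ u, (G z).comp (A' (t, z) u) =
    fderiv ℝ G z u + (A (t, φ z) (fderiv ℝ φ z u)).comp (G z)

theorem contDiffOn_slice {Y : Type*} [NormedAddCommGroup Y] [NormedSpace ℝ Y] {f : ℝ × E → Y}
    {U : Set E} {r : WithTop ℕ∞} (hf : ContDiffOn ℝ r f (univ ×ˢ U)) (t : ℝ) :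
    ContDiffOn ℝ r (fun y => f (t, y)) U :=
  hf.comp (by fun_prop) fun _ hy => ⟨mem_univ _, hy⟩

theorem contDiff_slice_left {Y : Type*} [NormedAddCommGroup Y] [NormedSpace ℝ Y] {f : ℝ × E → Y}
    {U : Set E} {r : WithTop ℕ∞} (hf : ContDiffOn ℝ r f (univ ×ˢ U)) {z : E} (hz : z ∈ U) :
    ContDiff ℝ r (fun t => f (t, z)) :=
  contDiffOn_univ.1 (hf.comp (by fun_prop) fun _ _ => ⟨mem_univ _, hz⟩)

section
variable {φ : E → F} {G : E → HomC n m} {A' B' : ℝ × E → E →L[ℝ] EndC n}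
  {A B : ℝ × F → F →L[ℝ] EndC m} {U' : Set E} {U : Set F}

theorem GaugeRel.localCurv (h : GaugeRel φ G A' A U' U) {z : E} (hz : z ∈ U') (t : ℝ) (u v : E) :
    (G z).comp (localCurv (fun y => A' (t, y)) z u v) =
      (localCurv (fun y => A (t, y)) (φ z) (fderiv ℝ φ z u) (fderiv ℝ φ z v)).comp (G z) := by
  have hz' := h.isOpen'.mem_nhds hz
  refine localCurv_gauge (h.contDiff_map.contDiffAt hz') (h.contDiff_gauge.contDiffAt hz')
    (((contDiffOn_slice h.smooth t).contDiffAt (h.isOpen.mem_nhds (h.mapsTo hz))).differentiableAt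
      (by simp))
    (((contDiffOn_slice h.smooth' t).contDiffAt hz').differentiableAt (by simp)) ?_ u v
  filter_upwards [hz'] with y hy
  exact h.rel t y hy

/-- The local Chern-Simons form does not depend on the frame, and is natural in the chart. -/
theorem localCS_gauge (h : GaugeRel φ G A' A U' U) {z : E} (hz : z ∈ U') (k : ℕ) :
    localCS A' k z = (localCS A k (φ z)).compContinuousLinearMap (fderiv ℝ φ z) := by
  obtain ⟨H, hH1, hH2⟩ := h.invertible z hz
  rw [localCS_eq_fibreIntegral (differentiableAt_of_contDiffOn h.isOpen' h.smooth' hz) k,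
    localCS_eq_fibreIntegral (differentiableAt_of_contDiffOn h.isOpen h.smooth (h.mapsTo hz)) k]
  have e := (ContinuousAlternatingMap.compContinuousLinearMapCLM (ι := Fin (2 * k + 1))
    (F := ℂ) (fderiv ℝ φ z)).intervalIntegral_comp_comm
    (μ := MeasureTheory.volume) (a := 0) (b := 1)
    (f := fun t => contractSlice (chernForm A k (t, φ z)))
    ((continuousOn_slice (contDiffOn_contractSlice (contDiffOn_chernForm h.isOpen h.smooth k)
      ).continuousOn (h.mapsTo hz)).intervalIntegrable _ _)
  refine Eq.trans ?_ e
  refine intervalIntegral.integral_congr fun t _ => ?_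
  rw [contractSlice_chernForm (differentiableAt_of_contDiffOn h.isOpen' h.smooth' hz t),
    contractSlice_chernForm (differentiableAt_of_contDiffOn h.isOpen h.smooth (h.mapsTo hz) t)]
  refine csDensity_gauge hH1 hH2 (fun u => ?_) (h.localCurv hz t) k
  have d1 := ((contDiff_slice_left h.smooth' hz).differentiable (by simp) t).hasDerivAt
  have d2 := ((contDiff_slice_left h.smooth (h.mapsTo hz)).differentiable (by simp) t).hasDerivAt
  have d3 := ((compR n n m (G z)).hasFDerivAt).comp_hasDerivAt t
    (d1.clm_apply (hasDerivAt_const t u))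
  have d4 := (((compR n m m).flip (G z)).hasFDerivAt).comp_hasDerivAt t
    (d2.clm_apply (hasDerivAt_const t (fderiv ℝ φ z u)))
  have d5 := d4.const_add (fderiv ℝ G z u)
  have e2 : (fun t => compR n n m (G z) (A' (t, z) u)) =
      fun t => fderiv ℝ G z u + compR n m m (A (t, φ z) (fderiv ℝ φ z u)) (G z) :=
    funext fun t => h.rel t z hz u
  have e3 := d3.unique (e2 ▸ d5)
  simpa [compR_apply] using e3

end

end Gauge

/-! ### Reparametrization and the transgression between two paths -/

section Transgression

variable {E : Type*} [NormedAddCommGroup E] [NormedSpace ℝ E] [FiniteDimensional ℝ E]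
  {F : Type*} [NormedAddCommGroup F] [NormedSpace ℝ F] [FiniteDimensional ℝ F]
  {n m : Type} [Fintype n] [DecidableEq n] [Fintype m] [DecidableEq m]

theorem csDensity_smul (c : ℝ) (a : E →L[ℝ] EndC n) (R : E →L[ℝ] E →L[ℝ] EndC n) (k : ℕ) :
    csDensity (c • a) R k = c • csDensity a R k := by
  have h : ∀ (k : ℕ) (v : Fin (2 * k + 1) → E), csWord (fun x => (c • a) x) (fun x y => R x y) k v =
      c • csWord (fun x => a x) (fun x y => R x y) k v := by
    intro k
    induction k with
    | zero => exact fun v => rfl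
    | succ k ih =>
      intro v
      rw [csWord, csWord, ih, smul_mul_assoc]
  ext v
  rw [ContinuousAlternatingMap.smul_apply, csDensity_apply, csDensity_apply, ← mul_smul_comm,
    Finset.smul_sum]
  congr 1
  refine Finset.sum_congr rfl fun s _ => ?_
  rw [h, map_smul, smul_comm]

theorem smoothTransition_mem (t : ℝ) : Real.smoothTransition t ∈ Icc (0 : ℝ) 1 :=
  ⟨Real.smoothTransition.nonneg t, Real.smoothTransition.le_one t⟩

theorem image_smoothTransition : Real.smoothTransition '' Icc 0 1 = Icc (0 : ℝ) 1 := by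
  refine Subset.antisymm (image_subset_iff.2 fun t _ => smoothTransition_mem t) ?_
  have h := intermediate_value_Icc zero_le_one
    (Real.smoothTransition.contDiff (n := 0)).continuous.continuousOn
  rwa [Real.smoothTransition.zero, Real.smoothTransition.one] at h

/-- The family `A`, slowed down near the ends of `[0, 1]`, and extended to all of `ℝ`. -/
def reparam {Y : Type*} (A : ℝ × E → Y) (p : ℝ × E) : Y := A (Real.smoothTransition p.1, p.2)

theorem contDiffOn_reparam {Y : Type*} [NormedAddCommGroup Y] [NormedSpace ℝ Y] {A : ℝ × E → Y}
    {U : Set E} (hA : ContDiffOn ℝ ∞ A (Icc 0 1 ×ˢ U)) : ContDiffOn ℝ ∞ (reparam A) (univ ×ˢ U) :=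
  hA.comp ((Real.smoothTransition.contDiff.comp contDiff_fst).prodMk contDiff_snd).contDiffOn
    fun p hp => ⟨smoothTransition_mem p.1, hp.2⟩

/-- The Chern-Simons form is invariant under reparametrization of the path. -/
theorem localCS_reparam {A : ℝ × E → E →L[ℝ] EndC n} {z : E}
    (hA : DifferentiableOn ℝ (fun s => A (s, z)) (Icc 0 1)) (k : ℕ) :
    localCS (reparam A) k z = localCS A k z := by
  have hd : ∀ t, HasDerivAt Real.smoothTransition (deriv Real.smoothTransition t) t := fun t =>
    ((Real.smoothTransition.contDiff (n := 1)).differentiable (by simp) t).hasDerivAt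
  have h := MeasureTheory.integral_image_eq_integral_deriv_smul_of_monotoneOn
    (s := Icc (0 : ℝ) 1) measurableSet_Icc (fun t _ => (hd t).hasDerivWithinAt)
    (Real.smoothTransition.monotone.monotoneOn _)
    (fun t => csDensity (derivWithin (fun s => A (s, z)) (Icc 0 1) t)
      (localCurv (fun y => A (t, y)) z) k)
  rw [image_smoothTransition] at h
  rw [localCS, localCS, intervalIntegral.integral_of_le zero_le_one,
    intervalIntegral.integral_of_le zero_le_one, ← MeasureTheory.integral_Icc_eq_integral_Ioc,
    ← MeasureTheory.integral_Icc_eq_integral_Ioc, h]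
  refine MeasureTheory.setIntegral_congr_fun measurableSet_Icc fun t ht => ?_
  have h2 : derivWithin (fun s => reparam A (s, z)) (Icc 0 1) t =
      deriv Real.smoothTransition t •
        derivWithin (fun s => A (s, z)) (Icc 0 1) (Real.smoothTransition t) :=
    ((hA _ (smoothTransition_mem t)).hasDerivWithinAt.scomp t (hd t).hasDerivWithinAt
      fun s _ => smoothTransition_mem s).derivWithin (uniqueDiffOn_Icc zero_lt_one t ht)
  change csDensity (derivWithin (fun s => reparam A (s, z)) (Icc 0 1) t) _ k = _
  rw [h2, csDensity_smul]
  rfl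

/-- The affine interpolation between two families of connection forms, as a family of connection
forms on `ℝ × E`. -/
def interp (A B : ℝ × E → E →L[ℝ] EndC n) (q : ℝ × (ℝ × E)) : (ℝ × E) →L[ℝ] EndC n :=
  ((1 - q.2.1) • A (q.1, q.2.2) + q.2.1 • B (q.1, q.2.2)).comp (ContinuousLinearMap.snd ℝ ℝ E)

theorem interp_apply (A B : ℝ × E → E →L[ℝ] EndC n) (t s : ℝ) (z : E) (w : ℝ × E) :
    interp A B (t, s, z) w = (1 - s) • A (t, z) w.2 + s • B (t, z) w.2 := rfl

theorem contDiffOn_interp {A B : ℝ × E → E →L[ℝ] EndC n} {U : Set E}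
    (hA : ContDiffOn ℝ ∞ A (univ ×ˢ U)) (hB : ContDiffOn ℝ ∞ B (univ ×ˢ U)) :
    ContDiffOn ℝ ∞ (interp A B) (univ ×ˢ (univ ×ˢ U)) := by
  have h : ∀ {C : ℝ × E → E →L[ℝ] EndC n}, ContDiffOn ℝ ∞ C (univ ×ˢ U) →
      ContDiffOn ℝ ∞ (fun q : ℝ × (ℝ × E) => C (q.1, q.2.2)) (univ ×ˢ (univ ×ˢ U)) := fun hC =>
    hC.comp (by fun_prop) fun q hq => ⟨mem_univ _, hq.2.2⟩
  have f1 : ContDiffOn ℝ ∞ (fun q : ℝ × (ℝ × E) => 1 - q.2.1) (univ ×ˢ (univ ×ˢ U)) := by fun_prop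
  have f2 : ContDiffOn ℝ ∞ (fun q : ℝ × (ℝ × E) => q.2.1) (univ ×ˢ (univ ×ˢ U)) := by fun_prop
  exact ((f1.smul (h hA)).add (f2.smul (h hB))).clm_comp contDiffOn_const

/-- The transgression form between the Chern-Simons forms of two families. -/
def localPrim (A B : ℝ × E → E →L[ℝ] EndC n) (k : ℕ) (z : E) : E [⋀^Fin (2 * k)]→L[ℝ] ℂ :=
  fibreIntegral (localCS (interp A B) k) z

/-- The pull-back of a flat connection form is flat. -/
theorem localCurv_snd {A : E → E →L[ℝ] EndC n} {s : ℝ} {z : E} (hA : DifferentiableAt ℝ A z)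
    (h : localCurv A z = 0) {B : ℝ × E → (ℝ × E) →L[ℝ] EndC n}
    (hB : ∀ᶠ q in nhds (s, z), B q = (A q.2).comp (ContinuousLinearMap.snd ℝ ℝ E)) :
    localCurv B (s, z) = 0 := by
  have hB' : DifferentiableAt ℝ B (s, z) := by
    have h2 : DifferentiableAt ℝ (fun q : ℝ × E => A q.2) (s, z) :=
      hA.comp (s, z) differentiableAt_snd
    exact (h2.clm_comp (differentiableAt_const _)).congr_of_eventuallyEq hB
  refine ContinuousLinearMap.ext fun u => ContinuousLinearMap.ext fun v => ?_
  have h2 := localCurv_gauge (φ := Prod.snd) (G := fun _ => ContinuousLinearMap.id ℂ (n → ℂ))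
    (A := A) (A' := B) (z := (s, z)) contDiffAt_snd contDiffAt_const hA hB' (by
      filter_upwards [hB] with q hq u
      rw [hq, fderiv_snd, fderiv_fun_const]
      simp) u v
  rw [h] at h2
  simpa using h2

theorem contDiffOn_localPrim {A B : ℝ × E → E →L[ℝ] EndC n} {U : Set E} (hU : IsOpen U)
    (hA : ContDiffOn ℝ ∞ A (univ ×ˢ U)) (hB : ContDiffOn ℝ ∞ B (univ ×ˢ U)) (k : ℕ) :
    ContDiffOn ℝ ∞ (localPrim A B k) U :=
  contDiffOn_fibreIntegral hU
    (contDiffOn_localCS (isOpen_univ.prod hU) (contDiffOn_interp hA hB) k)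

/-- If two paths have the same flat ends, then their Chern-Simons forms differ by the exterior
derivative of the transgression form. -/
theorem extDeriv_localPrim {A B : ℝ × E → E →L[ℝ] EndC n} {U : Set E} (hU : IsOpen U)
    (hA : ContDiffOn ℝ ∞ A (univ ×ˢ U)) (hB : ContDiffOn ℝ ∞ B (univ ×ˢ U))
    (h0 : ∀ z ∈ U, localCurv (fun y => A (0, y)) z = 0)
    (h1 : ∀ z ∈ U, localCurv (fun y => A (1, y)) z = 0)
    (e0 : ∀ z ∈ U, B (0, z) = A (0, z)) (e1 : ∀ z ∈ U, B (1, z) = A (1, z)) (k : ℕ) {z : E}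
    (hz : z ∈ U) : extDeriv (localPrim A B k) z = localCS B k z - localCS A k z := by
  have hO : IsOpen ((univ : Set ℝ) ×ˢ U) := isOpen_univ.prod hU
  have hI := contDiffOn_interp hA hB
  have hf : ∀ t, (∀ z ∈ U, localCurv (fun y => A (t, y)) z = 0) → (∀ z ∈ U, B (t, z) = A (t, z)) →
      ∀ q ∈ (univ : Set ℝ) ×ˢ U, localCurv (fun y => interp A B (t, y)) q = 0 := by
    rintro t h e ⟨s, z⟩ hq
    refine localCurv_snd (A := fun y => A (t, y)) (((contDiffOn_slice hA t).contDiffAt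
      (hU.mem_nhds hq.2)).differentiableAt (by simp)) (h z hq.2) ?_
    filter_upwards [hO.mem_nhds hq] with q hq
    rw [interp, e q.2 hq.2, ← add_smul, sub_add_cancel, one_smul]
  have hs : ∀ (C : ℝ × E → E →L[ℝ] EndC n) (s : ℝ), ContDiffOn ℝ ∞ C (univ ×ˢ U) →
      (∀ p : ℝ × E, C p = (1 - s) • A p + s • B p) →
      restrictSlice (localCS (interp A B) k (s, z)) = localCS C k z := by
    intro C s hC hCs
    have hfd : ∀ z, fderiv ℝ (fun y : E => (s, y)) z = ContinuousLinearMap.inr ℝ ℝ E := fun z =>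
      (hasFDerivAt_prodMk_right s z).fderiv
    have hg : GaugeRel (fun y : E => (s, y)) (fun _ => ContinuousLinearMap.id ℂ (n → ℂ)) C
        (interp A B) U (univ ×ˢ U) :=
      { isOpen' := hU
        isOpen := hO
        mapsTo := fun y hy => ⟨mem_univ _, hy⟩
        contDiff_map := by fun_prop
        contDiff_gauge := contDiffOn_const
        invertible := fun z _ => ⟨.id ℂ _, rfl, rfl⟩
        smooth' := hC
        smooth := hI
        rel := fun t z _ u => by
          rw [hfd, fderiv_fun_const, interp_apply, hCs]
          simp }
    rw [localCS_gauge hg hz k, hfd]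
    rfl
  rw [show localPrim A B k = fibreIntegral (localCS (interp A B) k) from rfl,
    extDeriv_fibreIntegral hU (contDiffOn_localCS hO hI k) (fun s y hy =>
      extDeriv_localCS hO hI (hf 0 h0 e0) (hf 1 h1 e1) k (z := (s, y)) ⟨mem_univ _, hy⟩) hz,
    hs B 1 hB (by simp), hs A 0 hA (by simp)]

section
variable {φ : E → F} {G : E → HomC n m} {A' B' : ℝ × E → E →L[ℝ] EndC n}
  {A B : ℝ × F → F →L[ℝ] EndC m} {U' : Set E} {U : Set F}

theorem fderiv_prodMap_id {z : E} (hφ : HasFDerivAt φ (fderiv ℝ φ z) z) (s : ℝ) (w : ℝ × E) :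
    fderiv ℝ (fun q : ℝ × E => (q.1, φ q.2)) (s, z) w = (w.1, fderiv ℝ φ z w.2) := by
  have h : HasFDerivAt (fun q : ℝ × E => φ q.2) _ (s, z) :=
    HasFDerivAt.comp (f := Prod.snd) (s, z) hφ hasFDerivAt_snd
  rw [(hasFDerivAt_fst.prodMk h).fderiv]
  rfl

theorem GaugeRel.interp (hA : GaugeRel φ G A' A U' U) (hB : GaugeRel φ G B' B U' U) :
    GaugeRel (fun q : ℝ × E => (q.1, φ q.2)) (fun q : ℝ × E => G q.2) (interp A' B') (interp A B)
      (univ ×ˢ U') (univ ×ˢ U) where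
  isOpen' := isOpen_univ.prod hA.isOpen'
  isOpen := isOpen_univ.prod hA.isOpen
  mapsTo q hq := ⟨mem_univ _, hA.mapsTo hq.2⟩
  contDiff_map := contDiffOn_fst.prodMk (hA.contDiff_map.comp contDiffOn_snd fun q hq => hq.2)
  contDiff_gauge := hA.contDiff_gauge.comp contDiffOn_snd fun q hq => hq.2
  invertible q hq := hA.invertible q.2 hq.2
  smooth' := contDiffOn_interp hA.smooth' hB.smooth'
  smooth := contDiffOn_interp hA.smooth hB.smooth
  rel := by
    rintro t ⟨s, z⟩ hq ⟨σ, u⟩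
    have hz := hA.isOpen'.mem_nhds hq.2
    have dφ := ((hA.contDiff_map.contDiffAt hz).differentiableAt (by simp)).hasFDerivAt
    have dG := ((hA.contDiff_gauge.contDiffAt hz).differentiableAt (by simp)).hasFDerivAt
    have d1 : fderiv ℝ (fun q : ℝ × E => G q.2) (s, z) (σ, u) = fderiv ℝ G z u := by
      change fderiv ℝ (G ∘ Prod.snd) (s, z) (σ, u) = _
      rw [(dG.comp (s, z) hasFDerivAt_snd).fderiv]
      rfl
    have d2 := fderiv_prodMap_id dφ s (σ, u)
    have h1 := hA.rel t z hq.2 u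
    have h2 := hB.rel t z hq.2 u
    rw [d1, d2, interp_apply, interp_apply]
    ext1 c
    have h1' := DFunLike.congr_fun h1 c
    have h2' := DFunLike.congr_fun h2 c
    simp only [ContinuousLinearMap.comp_apply, add_apply, smul_apply, map_add] at h1' h2' ⊢
    have hr : ∀ (r : ℝ) (e : n → ℂ), G z (r • e) = r • G z e := fun r e =>
      ((G z).restrictScalars ℝ).map_smul r e
    rw [hr, hr, h1', h2', smul_add, smul_add]
    have e : ∀ y : m → ℂ, y = (1 - s) • y + s • y := fun y => by
      rw [← add_smul, sub_add_cancel, one_smul]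
    nth_rw 3 [e (fderiv ℝ G z u c)]
    abel

/-- The transgression form is natural. -/
theorem localPrim_gauge (hA : GaugeRel φ G A' A U' U) (hB : GaugeRel φ G B' B U' U) (k : ℕ) {z : E}
    (hz : z ∈ U') :
    localPrim A' B' k z = (localPrim A B k (φ z)).compContinuousLinearMap (fderiv ℝ φ z) := by
  have hO := isOpen_univ (X := ℝ) |>.prod hA.isOpen
  have e := (ContinuousAlternatingMap.compContinuousLinearMapCLM (ι := Fin (2 * k))
    (F := ℂ) (fderiv ℝ φ z)).intervalIntegral_comp_comm
    (μ := MeasureTheory.volume) (a := 0) (b := 1)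
    (f := fun s => contractSlice (localCS (RelKTheory.interp A B) k (s, φ z)))
    ((continuousOn_slice (contDiffOn_contractSlice (contDiffOn_localCS hO
      (contDiffOn_interp hA.smooth hB.smooth) k)).continuousOn
        (hA.mapsTo hz)).intervalIntegrable _ _)
  refine Eq.trans ?_ e
  refine intervalIntegral.integral_congr fun s _ => ?_
  have dφ := ((hA.contDiff_map.contDiffAt (hA.isOpen'.mem_nhds hz)).differentiableAt
    (by simp)).hasFDerivAt
  have d2 := fderiv_prodMap_id dφ s
  ext v
  simp only [contractSlice_apply, ContinuousAlternatingMap.compContinuousLinearMapCLM_apply,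
    ContinuousAlternatingMap.compContinuousLinearMap_apply]
  rw [localCS_gauge (hA.interp hB) (z := (s, z)) ⟨mem_univ _, hz⟩ k,
    ContinuousAlternatingMap.compContinuousLinearMap_apply]
  refine congrArg (localCS (RelKTheory.interp A B) k (s, φ z)) (funext fun i => ?_)
  refine Fin.cases ?_ (fun i => ?_) i
  · simp [d2]
  · simp [d2]

end

end Transgression

/-! ### Gluing local forms -/

section Gluing

variable {E : Type*} [NormedAddCommGroup E] [NormedSpace ℝ E]
  {M : Type*} [TopologicalSpace M] [ChartedSpace E M]

/-- The change of coordinates from the chart around `x₀` to the chart around `x₁`. -/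
def chartChange (x₀ x₁ : M) (z : E) : E := chartAt E x₁ ((chartAt E x₀).symm z)

/-- The domain of the change of coordinates. -/
def chartOverlap (x₀ x₁ : M) : Set E :=
  (chartAt E x₀).target ∩ (chartAt E x₀).symm ⁻¹' (chartAt E x₁).source

theorem isOpen_target_inter_preimage (x₀ : M) {s : Set M} (hs : IsOpen s) :
    IsOpen ((chartAt E x₀).target ∩ (chartAt E x₀).symm ⁻¹' s) :=
  (chartAt E x₀).isOpen_inter_preimage_symm hs

theorem isOpen_chartOverlap (x₀ x₁ : M) : IsOpen (chartOverlap (E := E) x₀ x₁) :=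
  isOpen_target_inter_preimage x₀ (chartAt E x₁).open_source

theorem symm_chartChange {x₀ x₁ : M} {z : E} (hz : z ∈ chartOverlap x₀ x₁) :
    (chartAt E x₁).symm (chartChange x₀ x₁ z) = (chartAt E x₀).symm z :=
  (chartAt E x₁).left_inv hz.2

theorem chartChange_mem_target {x₀ x₁ : M} {z : E} (hz : z ∈ chartOverlap x₀ x₁) :
    chartChange x₀ x₁ z ∈ (chartAt E x₁).target :=
  (chartAt E x₁).map_source hz.2

theorem mem_chartOverlap_self (x : M) : chartAt E x x ∈ chartOverlap (E := E) x x :=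
  ⟨mem_chart_target E x, by
    rw [mem_preimage, (chartAt E x).left_inv (mem_chart_source E x)]
    exact mem_chart_source E x⟩

variable [IsManifold 𝓘(ℝ, E) ∞ M]

theorem contDiffOn_chartChange (x₀ x₁ : M) :
    ContDiffOn ℝ ∞ (chartChange (E := E) x₀ x₁) (chartOverlap x₀ x₁) := by
  have h := (contMDiffOn_chart (I := 𝓘(ℝ, E)) (n := ∞) (x := x₁)).comp
    ((contMDiffOn_chart_symm (I := 𝓘(ℝ, E)) (n := ∞) (x := x₀)).mono inter_subset_left)
    (fun z hz => hz.2 : chartOverlap x₀ x₁ ⊆ _)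
  exact contMDiffOn_iff_contDiffOn.1 h

theorem mdifferentiableAt_chart {x₀ y : M} (hy : y ∈ (chartAt E x₀).source) :
    MDifferentiableAt 𝓘(ℝ, E) 𝓘(ℝ, E) (chartAt E x₀) y :=
  (contMDiffOn_chart (I := 𝓘(ℝ, E)) (n := ∞) (x := x₀)).contMDiffAt
    ((chartAt E x₀).open_source.mem_nhds hy) |>.mdifferentiableAt (by simp)

theorem mdifferentiableAt_chart_symm {x₀ : M} {z : E} (hz : z ∈ (chartAt E x₀).target) :
    MDifferentiableAt 𝓘(ℝ, E) 𝓘(ℝ, E) (chartAt E x₀).symm z :=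
  (contMDiffOn_chart_symm (I := 𝓘(ℝ, E)) (n := ∞) (x := x₀)).contMDiffAt
    ((chartAt E x₀).open_target.mem_nhds hz) |>.mdifferentiableAt (by simp)

theorem differentiableAt_chartChange {x₀ x₁ : M} {z : E} (hz : z ∈ chartOverlap x₀ x₁) :
    DifferentiableAt ℝ (chartChange (E := E) x₀ x₁) z :=
  ((contDiffOn_chartChange x₀ x₁).contDiffAt
    ((isOpen_chartOverlap x₀ x₁).mem_nhds hz)).differentiableAt (by simp)

/-- The coordinate vector fields of two charts are related by the Jacobian. -/
theorem coordVec_chartChange {x₀ x₁ : M} {z : E} (hz : z ∈ chartOverlap x₀ x₁) (w : E) :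
    (coordVec x₀ z w : E) = coordVec x₁ (chartChange x₀ x₁ z) (fderiv ℝ (chartChange x₀ x₁) z w) := by
  have h1 : (chartAt E x₀).symm =ᶠ[nhds z] (chartAt E x₁).symm ∘ chartChange (E := E) x₀ x₁ := by
    filter_upwards [(isOpen_chartOverlap x₀ x₁).mem_nhds hz] with y hy
    exact (symm_chartChange hy).symm
  have h2 := (mdifferentiableAt_chart_symm (chartChange_mem_target hz)).hasMFDerivAt.comp z
    (differentiableAt_chartChange hz).mdifferentiableAt.hasMFDerivAt
  have h3 := h2.congr_of_eventuallyEq h1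
  have h4 := h3.mfderiv
  rw [mfderiv_eq_fderiv] at h4
  exact DFunLike.congr_fun h4 w

/-- In coordinates, the differential of the chart around `x₁` is the Jacobian. -/
theorem mfderiv_chart_coordVec {x₀ x₁ : M} {z : E} (hz : z ∈ chartOverlap x₀ x₁) (w : E) :
    (mfderiv 𝓘(ℝ, E) 𝓘(ℝ, E) (chartAt E x₁) ((chartAt E x₀).symm z) (coordVec x₀ z w) : E) =
      fderiv ℝ (chartChange x₀ x₁) z w := by
  have h2 := (mdifferentiableAt_chart hz.2).hasMFDerivAt.comp z
    (mdifferentiableAt_chart_symm hz.1).hasMFDerivAt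
  have h4 := h2.mfderiv
  have h5 : mfderiv 𝓘(ℝ, E) 𝓘(ℝ, E) (chartAt E x₁ ∘ (chartAt E x₀).symm) z =
    fderiv ℝ (chartChange (E := E) x₀ x₁) z := mfderiv_eq_fderiv
  rw [h5] at h4
  exact (DFunLike.congr_fun h4 w).symm

theorem contDiff_compContinuousLinearMap {E F : Type*} [NormedAddCommGroup E] [NormedSpace ℝ E]
    [FiniteDimensional ℝ E] [NormedAddCommGroup F] [NormedSpace ℝ F] (k : ℕ) :
    ContDiff ℝ ∞ (fun p : (F [⋀^Fin k]→L[ℝ] ℂ) × (E →L[ℝ] F) =>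
      p.1.compContinuousLinearMap p.2) := by
  refine contDiffOn_univ.1 (contDiffOn_alternating fun v => contDiffOn_univ.2 ?_)
  have h1 : ContDiff ℝ ∞ (fun p : (F [⋀^Fin k]→L[ℝ] ℂ) × (E →L[ℝ] F) =>
      ContinuousMultilinearMap.compContinuousLinearMapContinuousMultilinear
        ℝ (fun _ : Fin k => E) (fun _ => F) ℂ (fun _ => p.2)) :=
    (ContinuousMultilinearMap.contDiff _).comp (contDiff_pi.2 fun _ => contDiff_snd)
  have h2 : ContDiff ℝ ∞ (fun p : (F [⋀^Fin k]→L[ℝ] ℂ) × (E →L[ℝ] F) =>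
      p.1.toContinuousMultilinearMap) :=
    (ContinuousAlternatingMap.toContinuousMultilinearMapCLM (𝕜 := ℝ) (E := F) (F := ℂ)
      (ι := Fin k) ℝ).contDiff.comp contDiff_fst
  exact (ContinuousMultilinearMap.apply ℝ (fun _ : Fin k => E) ℂ v).contDiff.comp
    (h1.clm_apply h2)

theorem Form.inChart_chartChange {k : ℕ} (α : Form E M k) {x₀ x₁ : M} {z : E}
    (hz : z ∈ chartOverlap x₀ x₁) : α.inChart x₀ z =
      (α.inChart x₁ (chartChange x₀ x₁ z)).compContinuousLinearMap
        (fderiv ℝ (chartChange x₀ x₁) z) := by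
  have key : ∀ {p q : M} (_ : p = q) (w w' : Fin k → E) (_ : w = w'), α p w = α q w' := by
    rintro p q rfl w w' rfl
    rfl
  ext v
  exact key (symm_chartChange hz).symm _ _ (funext fun i => coordVec_chartChange hz (v i))

variable [FiniteDimensional ℝ E]

/-- Smoothness of a form may be tested at the centers of the charts. -/
theorem Form.smooth_of_center {k : ℕ} {α : Form E M k}
    (h : ∀ x, ContDiffAt ℝ ∞ (α.inChart x) (chartAt E x x)) : α.Smooth := by
  intro x₀ z hz
  refine ContDiffAt.contDiffWithinAt ?_
  let x := (chartAt E x₀).symm z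
  have hz' : z ∈ chartOverlap x₀ x := ⟨hz, mem_chart_source E x⟩
  have hn := (isOpen_chartOverlap x₀ x).mem_nhds hz'
  have h1 : α.inChart x₀ =ᶠ[nhds z] fun y => (α.inChart x (chartChange x₀ x y)).compContinuousLinearMap
      (fderiv ℝ (chartChange x₀ x) y) := by
    filter_upwards [hn] with y hy
    exact α.inChart_chartChange hy
  refine ContDiffAt.congr_of_eventuallyEq ?_ h1
  have h2 := (contDiffOn_chartChange (E := E) x₀ x).contDiffAt hn
  have h3 : ContDiffAt ℝ ∞ (fderiv ℝ (chartChange (E := E) x₀ x)) z := h2.fderiv_right (by simp)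
  have h4 : ContDiffAt ℝ ∞ (fun y => α.inChart x (chartChange x₀ x y)) z := by
    refine ContDiffAt.comp (g := α.inChart x) z ?_ h2
    rw [show chartChange x₀ x z = chartAt E x x from rfl]
    exact h x
  exact (contDiff_compContinuousLinearMap k).contDiffAt.comp z (h4.prodMk h3)

/-- A compatible family of local forms: a smooth form `toFun x` on a neighbourhood `dom x` of the
center of the chart around `x`, for all `x`, such that these forms correspond to each other under
changes of coordinates. -/
structure LocalForms (E : Type*) [NormedAddCommGroup E] [NormedSpace ℝ E]
    (M : Type*) [TopologicalSpace M] [ChartedSpace E M] (k : ℕ) where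
  toFun : M → E → E [⋀^Fin k]→L[ℝ] ℂ
  dom : M → Set E
  isOpen_dom : ∀ x, IsOpen (dom x)
  mem_dom : ∀ x, chartAt E x x ∈ dom x
  smooth : ∀ x, ContDiffOn ℝ ∞ (toFun x) (dom x)
  compat : ∀ x₀ x₁, ∀ z ∈ dom x₀, z ∈ chartOverlap x₀ x₁ → chartChange x₀ x₁ z ∈ dom x₁ →
    toFun x₀ z = (toFun x₁ (chartChange x₀ x₁ z)).compContinuousLinearMap
      (fderiv ℝ (chartChange x₀ x₁) z)

namespace LocalForms

variable {k : ℕ} (B : LocalForms E M k)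

/-- The form on `M` given by a compatible family of local forms. -/
def glue : Form E M k := fun x =>
  (B.toFun x (chartAt E x x)).compContinuousLinearMap (chartDiff x)

theorem inChart_glue {x₀ : M} {z : E} (hz : z ∈ B.dom x₀) (hz' : z ∈ (chartAt E x₀).target) :
    B.glue.inChart x₀ z = B.toFun x₀ z := by
  have h : z ∈ chartOverlap x₀ ((chartAt E x₀).symm z) := ⟨hz', mem_chart_source E _⟩
  rw [B.compat x₀ _ z hz h (B.mem_dom _)]
  ext v
  exact congrArg (B.toFun ((chartAt E x₀).symm z) (chartChange x₀ _ z))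
    (funext fun i => mfderiv_chart_coordVec h (v i))

theorem inChart_glue_eventuallyEq (x : M) :
    B.glue.inChart x =ᶠ[nhds (chartAt E x x)] B.toFun x := by
  filter_upwards [(B.isOpen_dom x).mem_nhds (B.mem_dom x),
    (chartAt E x).open_target.mem_nhds (mem_chart_target E x)] with z hz hz'
  exact B.inChart_glue hz hz'

theorem smooth_glue : B.glue.Smooth := Form.smooth_of_center fun x =>
  ((B.smooth x).contDiffAt ((B.isOpen_dom x).mem_nhds (B.mem_dom x))).congr_of_eventuallyEq
    (B.inChart_glue_eventuallyEq x)

theorem d_glue (x : M) : B.glue.d x =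
    (extDeriv (B.toFun x) (chartAt E x x)).compContinuousLinearMap (chartDiff x) := by
  rw [Form.d, (B.inChart_glue_eventuallyEq x).extDeriv_eq]

end LocalForms

end Gluing

/-! ### Connections in local frames -/

section LocalFrames

variable {E : Type*} [NormedAddCommGroup E] [NormedSpace ℝ E]
  {M : Type*} [TopologicalSpace M] [ChartedSpace E M]

namespace SmoothBundle

variable {V W : SmoothBundle E M}

theorem SmoothOn.contMDiffAt_coord {σ : ∀ x, V.Fib x} {U : Set M} (hσ : V.SmoothOn σ U) {x x₁ : M}
    (hx : x ∈ U) (hx₁ : x ∈ V.dom x₁) :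
    ContMDiffAt 𝓘(ℝ, E) 𝓘(ℝ, V.Idx x₁ → ℂ) ∞ (fun y => V.coord x₁ y (σ y)) x := by
  have h1 : ContMDiffAt 𝓘(ℝ, E) 𝓘(ℝ, V.Idx x₁ → ℂ) ∞
      (fun y => ∑ j, (V.coord x y (σ y) j) • V.coord x₁ y (V.symm x y (Pi.single j 1))) x := by
    refine contMDiffAt_finsetSum fun j _ => ?_
    rw [contMDiffAt_pi_space]
    intro i
    exact ((contDiff_mul (𝕜 := ℝ) (𝔸 := ℂ)).contMDiff.contMDiffAt).comp x
      ((contMDiffAt_pi_space.1 (hσ x hx) j).prodMk_space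
        (contMDiffAt_pi_space.1 ((V.smooth_transition x x₁ (Pi.single j 1)).contMDiffAt
          (((V.isOpen_dom x).inter (V.isOpen_dom x₁)).mem_nhds ⟨V.mem_dom x, hx₁⟩)) i))
  refine h1.congr_of_eventuallyEq ?_
  filter_upwards [(V.isOpen_dom x).mem_nhds (V.mem_dom x)] with y hy
  exact V.apply_eq_sum x y hy (V.coord x₁ y) (σ y)

theorem SmoothOn.add {σ τ : ∀ x, V.Fib x} {U : Set M} (hσ : V.SmoothOn σ U)
    (hτ : V.SmoothOn τ U) : V.SmoothOn (σ + τ) U := by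
  intro x hx
  have h := (hσ x hx).add (hτ x hx)
  simpa [Pi.add_def] using h

theorem SmoothOn.smul {σ : ∀ x, V.Fib x} {g : M → ℂ} {U : Set M} (hU : IsOpen U)
    (hg : ContMDiffOn 𝓘(ℝ, E) 𝓘(ℝ, ℂ) ∞ g U) (hσ : V.SmoothOn σ U) :
    V.SmoothOn (fun y => g y • σ y) U := by
  intro x hx
  refine contMDiffAt_pi_space.2 fun i => ?_
  simp only [map_smul, Pi.smul_apply, smul_eq_mul]
  exact ((contDiff_mul (𝕜 := ℝ) (𝔸 := ℂ)).contMDiff.contMDiffAt).comp x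
    ((hg.contMDiffAt (hU.mem_nhds hx)).prodMk_space (contMDiffAt_pi_space.1 (hσ x hx) i))

theorem SmoothOn.finsetSum {ι : Type*} (s : Finset ι) {σ : ι → ∀ x, V.Fib x} {U : Set M}
    (hσ : ∀ i ∈ s, V.SmoothOn (σ i) U) : V.SmoothOn (∑ i ∈ s, σ i) U := by
  classical
  induction s using Finset.induction_on with
  | empty => simpa using V.smoothOn_zero U
  | insert a s ha ih =>
    rw [Finset.sum_insert ha]
    exact (hσ a (Finset.mem_insert_self a s)).add
      (ih fun i hi => hσ i (Finset.mem_insert_of_mem hi))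

theorem SmoothOn.mono {σ : ∀ x, V.Fib x} {U U' : Set M} (h : V.SmoothOn σ U) (hU : U' ⊆ U) :
    V.SmoothOn σ U' := fun x hx => h x (hU hx)

theorem smoothOn_symm (V : SmoothBundle E M) (x₀ : M) (c : V.Idx x₀ → ℂ) :
    V.SmoothOn (fun x => V.symm x₀ x c) (V.dom x₀) := fun x hx =>
  (V.smooth_transition x₀ x c).contMDiffAt
    (((V.isOpen_dom x₀).inter (V.isOpen_dom x)).mem_nhds ⟨hx, V.mem_dom x⟩)

theorem smoothHom_id (V : SmoothBundle E M) : V.SmoothHom V fun _ => LinearMap.id := fun x c =>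
  V.smoothOn_symm x c x (V.mem_dom x)

end SmoothBundle

namespace Connection

variable {V W : SmoothBundle E M}

/-- Locality of covariant derivatives. -/
theorem toFun_congr (D : Connection V) {U : Set M} (hU : IsOpen U) {σ τ : ∀ x, V.Fib x}
    (hσ : V.SmoothOn σ U) (hτ : V.SmoothOn τ U) (h : ∀ x ∈ U, σ x = τ x) {x : M} (hx : x ∈ U)
    (w : TangentSpace 𝓘(ℝ, E) x) : D.toFun σ x w = D.toFun τ x w := by
  classical
  -- Multiplication by the indicator function of `U` makes both sections equal, and it does not
  -- change the derivatives on `U`, by the Leibniz rule.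
  let g : M → ℂ := U.indicator 1
  have hg1 : ∀ y ∈ U, g y = 1 := fun y hy => indicator_of_mem hy 1
  have hg : ContMDiffOn 𝓘(ℝ, E) 𝓘(ℝ, ℂ) ∞ g U := contMDiffOn_const.congr hg1
  have e : (fun y => g y • σ y) = fun y => g y • τ y := by
    funext y
    by_cases hy : y ∈ U
    · rw [h y hy]
    · simp [g, hy]
  have h1 := D.leibniz U hU g σ hg hσ x hx w
  rw [e, D.leibniz U hU g τ hg hτ x hx w, h x hx, hg1 x hx, one_smul, one_smul] at h1
  exact (add_left_cancel h1).symm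

theorem toFun_sum_smul (D : Connection V) {U : Set M} (hU : IsOpen U) {ι : Type*} (s : Finset ι)
    {g : ι → M → ℂ} {σ : ι → ∀ x, V.Fib x} (hg : ∀ i, ContMDiffOn 𝓘(ℝ, E) 𝓘(ℝ, ℂ) ∞ (g i) U)
    (hσ : ∀ i, V.SmoothOn (σ i) U) {x : M} (hx : x ∈ U) (w : TangentSpace 𝓘(ℝ, E) x) :
    D.toFun (∑ i ∈ s, fun y => g i y • σ i y) x w =
      ∑ i ∈ s, (mvfderiv 𝓘(ℝ, E) (g i) x w • σ i x + g i x • D.toFun (σ i) x w) := by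
  classical
  induction s using Finset.induction_on with
  | empty => simp [D.toFun_zero]
  | insert a s ha ih =>
    rw [Finset.sum_insert ha, Finset.sum_insert ha, ← ih, ← D.leibniz U hU _ _ (hg a) (hσ a) x hx w,
      D.add U hU _ _ ((hσ a).smul hU (hg a))
        (SmoothBundle.SmoothOn.finsetSum s fun i _ => (hσ i).smul hU (hg i)) x hx]
    rfl

/-- Covariant derivatives at two expressions of the same point and tangent vector. -/
theorem toFun_transport (D : Connection V) (σ : ∀ x, V.Fib x) {p q : M} (h : p = q) {w w' : E}
    (hw : w = w') {X : Type*} (L : ∀ x, V.Fib x → X) :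
    L p (D.toFun σ p w) = L q (D.toFun σ q w') := by
  subst h hw
  rfl

end Connection

variable [IsManifold 𝓘(ℝ, E) ∞ M]

theorem mvfderiv_coordVec {g : M → ℂ} {x₀ : M} {z : E} (hz : z ∈ (chartAt E x₀).target)
    (hg : ContMDiffAt 𝓘(ℝ, E) 𝓘(ℝ, ℂ) ∞ g ((chartAt E x₀).symm z)) (w : E) :
    mvfderiv 𝓘(ℝ, E) g ((chartAt E x₀).symm z) (coordVec x₀ z w) =
      fderiv ℝ (fun y => g ((chartAt E x₀).symm y)) z w := by
  have h := ((hg.mdifferentiableAt (by simp)).hasMFDerivAt.comp z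
    (mdifferentiableAt_chart_symm hz).hasMFDerivAt).mfderiv
  rw [mfderiv_eq_fderiv] at h
  exact (DFunLike.congr_fun h w).symm

theorem contDiffAt_comp_chart_symm {F : Type*} [NormedAddCommGroup F] [NormedSpace ℝ F] {g : M → F}
    {x₀ : M} {z : E} (hz : z ∈ (chartAt E x₀).target)
    (hg : ContMDiffAt 𝓘(ℝ, E) 𝓘(ℝ, F) ∞ g ((chartAt E x₀).symm z)) :
    ContDiffAt ℝ ∞ (fun y => g ((chartAt E x₀).symm y)) z :=
  contMDiffAt_iff_contDiffAt.1 (hg.comp z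
    ((contMDiffOn_chart_symm (I := 𝓘(ℝ, E)) (n := ∞) (x := x₀)).contMDiffAt
    ((chartAt E x₀).open_target.mem_nhds hz)))

/-- The part of the chart around `x₀` over which the frame around `x₀` is defined. -/
def trivDom (V : SmoothBundle E M) (x₀ : M) : Set E :=
  (chartAt E x₀).target ∩ (chartAt E x₀).symm ⁻¹' V.dom x₀

theorem isOpen_trivDom (V : SmoothBundle E M) (x₀ : M) : IsOpen (trivDom V x₀) :=
  isOpen_target_inter_preimage x₀ (V.isOpen_dom x₀)

theorem mem_trivDom (V : SmoothBundle E M) (x : M) : chartAt E x x ∈ trivDom V x :=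
  ⟨mem_chart_target E x, by
    rw [mem_preimage, (chartAt E x).left_inv (mem_chart_source E x)]
    exact V.mem_dom x⟩

/-- The overlap of the coordinates and frame of `V` around `x₀`, and of `W` around `x₁`. -/
def transDom (V W : SmoothBundle E M) (x₀ x₁ : M) : Set E :=
  trivDom V x₀ ∩ (chartOverlap x₀ x₁ ∩ ((chartAt E x₀).target ∩ (chartAt E x₀).symm ⁻¹' W.dom x₁))

theorem isOpen_transDom (V W : SmoothBundle E M) (x₀ x₁ : M) : IsOpen (transDom V W x₀ x₁) :=
  (isOpen_trivDom V x₀).inter ((isOpen_chartOverlap x₀ x₁).inter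
    (isOpen_target_inter_preimage x₀ (W.isOpen_dom x₁)))

theorem chartChange_mem_trivDom {V W : SmoothBundle E M} {x₀ x₁ : M} {z : E}
    (hz : z ∈ transDom V W x₀ x₁) : chartChange x₀ x₁ z ∈ trivDom W x₁ :=
  ⟨chartChange_mem_target hz.2.1, by
    rw [mem_preimage, symm_chartChange hz.2.1]
    exact hz.2.2.2⟩

theorem mem_transDom_symm {V W : SmoothBundle E M} {x₀ : M} {z : E} (hz : z ∈ trivDom V x₀) :
    z ∈ transDom V W x₀ ((chartAt E x₀).symm z) :=
  ⟨hz, ⟨hz.1, mem_chart_source E _⟩, hz.1, W.mem_dom _⟩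

variable {V W : SmoothBundle E M}

/-- The matrix of a fibrewise linear map, from the frame of `V` around `x₀` to the frame of `W`
around `x₁`, in the coordinates of the chart around `x₀`. -/
def gaugeMap (f : ∀ x, V.Fib x →ₗ[ℂ] W.Fib x) (x₀ x₁ : M) (z : E) :
    HomC (V.Idx x₀) (W.Idx x₁) :=
  LinearMap.toContinuousLinearMap ((W.coord x₁ ((chartAt E x₀).symm z)) ∘ₗ
    (f ((chartAt E x₀).symm z)) ∘ₗ (V.symm x₀ ((chartAt E x₀).symm z)))

theorem gaugeMap_apply (f : ∀ x, V.Fib x →ₗ[ℂ] W.Fib x) (x₀ x₁ : M) (z : E) (c : V.Idx x₀ → ℂ) :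
    gaugeMap f x₀ x₁ z c = W.coord x₁ ((chartAt E x₀).symm z)
      (f ((chartAt E x₀).symm z) (V.symm x₀ ((chartAt E x₀).symm z) c)) := rfl

theorem contDiffWithinAt_homC {Z : Type*} [NormedAddCommGroup Z] [NormedSpace ℝ Z] {n m : Type}
    [Fintype n] [DecidableEq n] [Fintype m] {r : WithTop ℕ∞} {s : Set Z} {z : Z} {G : Z → HomC n m}
    (h : ∀ c, ContDiffWithinAt ℝ r (fun y => G y c) s z) : ContDiffWithinAt ℝ r G s z := by
  have e : G = fun y => ∑ j, ((ContinuousLinearMap.smulRightL ℂ (n → ℂ) (m → ℂ)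
      (ContinuousLinearMap.proj (R := ℂ) (φ := fun _ => ℂ) j)).restrictScalars ℝ)
        (G y (Pi.single j 1)) := by
    funext y
    ext1 c
    conv_lhs => rw [pi_eq_sum_univ' c]
    simp
  rw [e]
  exact ContDiffWithinAt.sum fun j _ =>
    (ContinuousLinearMap.contDiff _).contDiffAt.comp_contDiffWithinAt z (h (Pi.single j 1))

theorem contDiffOn_gaugeMap {f : ∀ x, V.Fib x →ₗ[ℂ] W.Fib x} (hf : V.SmoothHom W f) (x₀ x₁ : M) :
    ContDiffOn ℝ ∞ (gaugeMap f x₀ x₁) (transDom V W x₀ x₁) := fun _ hz =>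
  contDiffWithinAt_homC fun c => (contDiffAt_comp_chart_symm hz.1.1
    ((hf.smoothOn (V.smoothOn_symm x₀ c)).contMDiffAt_coord hz.1.2 hz.2.2.2)).contDiffWithinAt

variable [FiniteDimensional ℝ E]

/-- The covariant derivative in coordinates: `∇ = d + A`. -/
theorem Connection.coord_toFun (D : Connection V) {σ : ∀ x, V.Fib x} {U : Set M} (hU : IsOpen U)
    (hσ : V.SmoothOn σ U) {x₀ x₁ : M} {z : E} (hz : z ∈ chartOverlap x₀ x₁)
    (hzU : (chartAt E x₀).symm z ∈ U) (hz₁ : (chartAt E x₀).symm z ∈ V.dom x₁) (w : E) :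
    V.coord x₁ ((chartAt E x₀).symm z) (D.toFun σ ((chartAt E x₀).symm z) (coordVec x₀ z w)) =
      fderiv ℝ (fun y => V.coord x₁ ((chartAt E x₀).symm y) (σ ((chartAt E x₀).symm y))) z w +
        D.connForm x₁ (chartChange x₀ x₁ z) (fderiv ℝ (chartChange x₀ x₁) z w)
          (V.coord x₁ ((chartAt E x₀).symm z) (σ ((chartAt E x₀).symm z))) := by
  have hO : IsOpen (U ∩ V.dom x₁) := hU.inter (V.isOpen_dom x₁)
  have hc : ∀ x ∈ U ∩ V.dom x₁, ContMDiffAt 𝓘(ℝ, E) 𝓘(ℝ, V.Idx x₁ → ℂ) ∞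
      (fun y => V.coord x₁ y (σ y)) x := fun x hx => hσ.contMDiffAt_coord hx.1 hx.2
  have hg : ∀ j, ContMDiffOn 𝓘(ℝ, E) 𝓘(ℝ, ℂ) ∞ (fun y => V.coord x₁ y (σ y) j) (U ∩ V.dom x₁) :=
    fun j x hx => (contMDiffAt_pi_space.1 (hc x hx) j).contMDiffWithinAt
  have hfr : ∀ j, V.SmoothOn (V.frame x₁ j) (U ∩ V.dom x₁) := fun j =>
    (V.smoothOn_frame x₁ j).mono inter_subset_right
  have e : ∀ x ∈ U ∩ V.dom x₁,
      σ x = (∑ j, fun y => V.coord x₁ y (σ y) j • V.frame x₁ j y : ∀ x, V.Fib x) x := by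
    intro x hx
    rw [Finset.sum_apply]
    exact V.apply_eq_sum x₁ x hx.2 LinearMap.id (σ x)
  have hd := contDiffAt_comp_chart_symm hz.1 (hc _ ⟨hzU, hz₁⟩)
  rw [D.toFun_congr hO (hσ.mono inter_subset_left)
    (SmoothBundle.SmoothOn.finsetSum _ fun i _ => (hfr i).smul hO (hg i)) e ⟨hzU, hz₁⟩,
    D.toFun_sum_smul hO _ hg hfr ⟨hzU, hz₁⟩, map_sum, connForm_apply]
  simp only [map_add, map_smul]
  rw [Finset.sum_add_distrib]
  congr 1
  · rw [pi_eq_sum_univ' (fderiv ℝ _ z w)]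
    refine Finset.sum_congr rfl fun j _ => ?_
    rw [mvfderiv_coordVec hz.1 (contMDiffAt_pi_space.1 (hc _ ⟨hzU, hz₁⟩) j)]
    congr 1
    · have h2 := hasFDerivAt_pi'.1 (hd.differentiableAt (by simp)).hasFDerivAt j
      rw [h2.fderiv]
      rfl
    · exact V.coord_symm x₁ _ hz₁ _
  · refine Finset.sum_congr rfl fun j _ => congrArg _ ?_
    exact D.toFun_transport (V.frame x₁ j) (symm_chartChange hz).symm (coordVec_chartChange hz w)
      fun x => V.coord x₁ x

theorem chartChange_self {x₀ : M} {z : E} (hz : z ∈ (chartAt E x₀).target) :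
    chartChange x₀ x₀ z = z := (chartAt E x₀).right_inv hz

theorem fderiv_chartChange_self {x₀ : M} {z : E} (hz : z ∈ (chartAt E x₀).target) :
    fderiv ℝ (chartChange x₀ x₀) z = ContinuousLinearMap.id ℝ E := by
  have h : chartChange x₀ x₀ =ᶠ[nhds z] id := by
    filter_upwards [(chartAt E x₀).open_target.mem_nhds hz] with y hy
    exact chartChange_self hy
  rw [h.fderiv_eq, fderiv_id]

theorem Connection.symm_connForm (D : Connection V) {x₀ : M} {z : E} (hz : z ∈ trivDom V x₀) (w : E)
    (c : V.Idx x₀ → ℂ) : V.symm x₀ ((chartAt E x₀).symm z) (D.connForm x₀ z w c) =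
      D.toFun (fun y => V.symm x₀ y c) ((chartAt E x₀).symm z) (coordVec x₀ z w) := by
  have hO : z ∈ chartOverlap x₀ x₀ := ⟨hz.1, (chartAt E x₀).map_target hz.1⟩
  have h := D.coord_toFun (V.isOpen_dom x₀) (V.smoothOn_symm x₀ c) (x₁ := x₀) hO hz.2 hz.2 w
  have h2 : (fun y => V.coord x₀ ((chartAt E x₀).symm y) (V.symm x₀ ((chartAt E x₀).symm y) c))
      =ᶠ[nhds z] fun _ => c := by
    filter_upwards [(isOpen_trivDom V x₀).mem_nhds hz] with y hy
    exact V.coord_symm x₀ _ hy.2 c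
  rw [h2.fderiv_eq, fderiv_fun_const, Pi.zero_apply, zero_apply, zero_add, chartChange_self hz.1,
    fderiv_chartChange_self hz.1, V.coord_symm x₀ _ hz.2] at h
  rw [← V.symm_coord x₀ _ hz.2 (D.toFun _ _ _), h]
  rfl

/-- A parallel bundle map intertwines the connection forms. -/
theorem connForm_gauge {D : Connection V} {D' : Connection W} {f : ∀ x, V.Fib x →ₗ[ℂ] W.Fib x}
    (hf : V.SmoothHom W f) (hp : D.Parallel D' f) {x₀ x₁ : M} {z : E}
    (hz : z ∈ transDom V W x₀ x₁) (w : E) :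
    (gaugeMap f x₀ x₁ z).comp (D.connForm x₀ z w) = fderiv ℝ (gaugeMap f x₀ x₁) z w +
      (D'.connForm x₁ (chartChange x₀ x₁ z) (fderiv ℝ (chartChange x₀ x₁) z w)).comp
        (gaugeMap f x₀ x₁ z) := by
  ext1 c
  have hs := V.smoothOn_symm x₀ c
  have hG := ((contDiffOn_gaugeMap hf x₀ x₁).contDiffAt
    ((isOpen_transDom V W x₀ x₁).mem_nhds hz)).differentiableAt (by simp)
  have h1 : fderiv ℝ (fun y => gaugeMap f x₀ x₁ y c) z w = fderiv ℝ (gaugeMap f x₀ x₁) z w c := by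
    have := ((ContinuousLinearMap.apply ℂ (W.Idx x₁ → ℂ) c).restrictScalars ℝ).hasFDerivAt.comp z
      hG.hasFDerivAt
    change fderiv ℝ (((ContinuousLinearMap.apply ℂ (W.Idx x₁ → ℂ) c).restrictScalars ℝ) ∘
      gaugeMap f x₀ x₁) z w = _
    rw [this.fderiv]
    rfl
  rw [ContinuousLinearMap.comp_apply, gaugeMap_apply, D.symm_connForm hz.1,
    ← hp _ (V.isOpen_dom x₀) _ hs _ hz.1.2, D'.coord_toFun (V.isOpen_dom x₀) (hf.smoothOn hs)
      hz.2.1 hz.1.2 hz.2.2.2, add_apply, ← h1]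
  rfl

end LocalFrames

/-! ### Families of connections and their Chern-Simons forms -/

section Families

variable {E : Type*} [NormedAddCommGroup E] [NormedSpace ℝ E] [FiniteDimensional ℝ E]
  {M : Type*} [TopologicalSpace M] [ChartedSpace E M]

theorem contDiffWithinAt_clm {Z Y : Type*} [NormedAddCommGroup Z] [NormedSpace ℝ Z]
    [NormedAddCommGroup Y] [NormedSpace ℝ Y] {r : WithTop ℕ∞} {s : Set Z} {z : Z}
    {f : Z → E →L[ℝ] Y} (h : ∀ w, ContDiffWithinAt ℝ r (fun y => f y w) s z) :
    ContDiffWithinAt ℝ r f s z := by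
  let b := Module.finBasis ℝ E
  have e : f = fun y => ∑ i, (ContinuousLinearMap.smulRightL ℝ E Y
      (LinearMap.toContinuousLinearMap (b.coord i))) (f y (b i)) := by
    funext y
    ext1 w
    conv_lhs => rw [← b.sum_repr w, map_sum]
    simp
  rw [e]
  exact ContDiffWithinAt.sum fun i _ =>
    (ContinuousLinearMap.contDiff _).contDiffAt.comp_contDiffWithinAt z (h (b i))

variable {V W : SmoothBundle E M}

/-- A family of connections is smooth in `t ∈ [0, 1]` if the derivatives of local smooth sections
are smooth in `(t, x)`. -/
def SmoothFamily (D : ℝ → Connection V) : Prop :=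
  ∀ (U : Set M), IsOpen U → ∀ σ : ∀ x, V.Fib x, V.SmoothOn σ U → ∀ x ∈ U, ∀ w : E,
    ∀ t ∈ Icc (0 : ℝ) 1, ContDiffWithinAt ℝ ∞
      (fun p : ℝ × E => V.coord x ((chartAt E x).symm p.2)
        ((D p.1).toFun σ ((chartAt E x).symm p.2) (coordVec x p.2 w)))
      (Icc (0 : ℝ) 1 ×ˢ univ) (t, chartAt E x x)

theorem smoothFamily_const (D : Connection V) : SmoothFamily fun _ => D :=
  fun U hU σ hσ x hx w t _ => ContDiffAt.contDiffWithinAt <|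
    ContDiffAt.comp (f := (Prod.snd : ℝ × E → E)) (t, chartAt E x x) (D.smooth U hU σ hσ x hx w)
      contDiffAt_snd

/-- The connection forms of a family of connections, in the chart and the frame around `x₀`. -/
def connFam (D : ℝ → Connection V) (x₀ : M) (p : ℝ × E) : E →L[ℝ] EndC (V.Idx x₀) :=
  (D p.1).connForm x₀ p.2

variable [IsManifold 𝓘(ℝ, E) ∞ M]

theorem SmoothFamily.contDiffWithinAt {D : ℝ → Connection V} (hD : SmoothFamily D) {U : Set M}
    (hU : IsOpen U) {σ : ∀ x, V.Fib x} (hσ : V.SmoothOn σ U) {x₀ : M} {z : E}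
    (hz : z ∈ trivDom V x₀) (hzU : (chartAt E x₀).symm z ∈ U) (w : E) {t : ℝ}
    (ht : t ∈ Icc (0 : ℝ) 1) :
    ContDiffWithinAt ℝ ∞ (fun p : ℝ × E => V.coord x₀ ((chartAt E x₀).symm p.2)
        ((D p.1).toFun σ ((chartAt E x₀).symm p.2) (coordVec x₀ p.2 w)))
      (Icc (0 : ℝ) 1 ×ˢ univ) (t, z) := by
  let x := (chartAt E x₀).symm z
  have hzt : z ∈ transDom V V x₀ x := mem_transDom_symm hz
  have hφ : ContDiffAt ℝ ∞ (chartChange (E := E) x₀ x) z :=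
    (contDiffOn_chartChange x₀ x).contDiffAt ((isOpen_chartOverlap x₀ x).mem_nhds hzt.2.1)
  have hφ2 : ContDiffAt ℝ ∞ (fun p : ℝ × E => chartChange (E := E) x₀ x p.2) (t, z) :=
    hφ.comp (f := Prod.snd) (t, z) contDiffAt_snd
  have hdφ : ContDiffAt ℝ ∞ (fun p : ℝ × E => fderiv ℝ (chartChange (E := E) x₀ x) p.2 w) (t, z) :=
    ((hφ.fderiv_right (m := ∞) (by simp)).comp (f := Prod.snd) (t, z) contDiffAt_snd).clm_apply
      contDiffAt_const
  let F : ℝ × E → E →L[ℝ] (V.Idx x → ℂ) := fun p => LinearMap.toContinuousLinearMap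
    (((V.coord x ((chartAt E x).symm p.2)).restrictScalars ℝ) ∘ₗ
      ((D p.1).toFun σ ((chartAt E x).symm p.2)) ∘ₗ (coordVec x p.2).toLinearMap)
  have hF : ContDiffWithinAt ℝ ∞ F (Icc (0 : ℝ) 1 ×ˢ univ) (t, chartChange x₀ x z) :=
    contDiffWithinAt_clm fun w => hD U hU σ hσ x hzU w t ht
  have h1 : ContDiffWithinAt ℝ ∞ (fun p : ℝ × E => F (p.1, chartChange x₀ x p.2)
      (fderiv ℝ (chartChange (E := E) x₀ x) p.2 w)) (Icc (0 : ℝ) 1 ×ˢ univ) (t, z) := by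
    refine ContDiffWithinAt.clm_apply ?_ hdφ.contDiffWithinAt
    exact ContDiffWithinAt.comp (g := F) (f := fun p : ℝ × E => (p.1, chartChange x₀ x p.2))
      (t := Icc (0 : ℝ) 1 ×ˢ univ) (t, z) hF
      (contDiffAt_fst.prodMk hφ2).contDiffWithinAt fun p hp => ⟨hp.1, mem_univ _⟩
  have hT := (contDiffOn_gaugeMap (V.smoothHom_id) x x₀).contDiffAt (x := chartChange x₀ x z)
    ((isOpen_transDom V V x x₀).mem_nhds ⟨chartChange_mem_trivDom hzt,
      ⟨chartChange_mem_target hzt.2.1, by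
        rw [mem_preimage, symm_chartChange hzt.2.1]; exact (chartAt E x₀).map_target hz.1⟩,
      chartChange_mem_target hzt.2.1, by
        rw [mem_preimage, symm_chartChange hzt.2.1]; exact hz.2⟩)
  have hT2 : ContDiffAt ℝ ∞ (fun p : ℝ × E =>
      gaugeMap (fun y => (LinearMap.id : V.Fib y →ₗ[ℂ] V.Fib y)) x x₀ (chartChange x₀ x p.2))
      (t, z) :=
    ContDiffAt.comp (f := fun p : ℝ × E => chartChange x₀ x p.2) (t, z) hT hφ2
  have h2 : ContDiffWithinAt ℝ ∞ (fun p : ℝ × E =>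
      gaugeMap (fun y => (LinearMap.id : V.Fib y →ₗ[ℂ] V.Fib y)) x x₀ (chartChange x₀ x p.2)
        (F (p.1, chartChange x₀ x p.2) (fderiv ℝ (chartChange (E := E) x₀ x) p.2 w)))
      (Icc (0 : ℝ) 1 ×ˢ univ) (t, z) :=
    ContDiffAt.comp_contDiffWithinAt (g := fun q : HomC (V.Idx x) (V.Idx x₀) × (V.Idx x → ℂ) =>
      q.1 q.2) (t, z) ((isBoundedBilinearMap_apply (𝕜 := ℂ)).contDiff.restrict_scalars ℝ).contDiffAt
      (hT2.contDiffWithinAt.prodMk h1)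
  refine h2.congr_of_eventuallyEq_of_mem ?_ ⟨ht, mem_univ z⟩
  have hn : ∀ᶠ p : ℝ × E in nhds (t, z), p.2 ∈ transDom V V x₀ x :=
    continuousAt_snd.eventually ((isOpen_transDom V V x₀ x).mem_nhds hzt)
  filter_upwards [mem_nhdsWithin_of_mem_nhds hn] with p hp
  have e := (D p.1).toFun_transport σ (symm_chartChange hp.2.1).symm
    (coordVec_chartChange hp.2.1 w) fun y => V.coord x₀ y
  rw [e, gaugeMap_apply]
  refine congrArg _ ?_
  exact (V.symm_coord x _ (by rw [symm_chartChange hp.2.1]; exact hp.2.2.2) _).symm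

theorem SmoothFamily.contDiffOn_connFam {D : ℝ → Connection V} (hD : SmoothFamily D) (x₀ : M) :
    ContDiffOn ℝ ∞ (connFam D x₀) (Icc 0 1 ×ˢ trivDom V x₀) := by
  rintro ⟨t, z⟩ ⟨ht, hz⟩
  refine contDiffWithinAt_clm fun w => contDiffWithinAt_homC fun c => ?_
  have h : ∀ j, ContDiffWithinAt ℝ ∞ (fun p : ℝ × E => V.coord x₀ ((chartAt E x₀).symm p.2)
        ((D p.1).toFun (V.frame x₀ j) ((chartAt E x₀).symm p.2) (coordVec x₀ p.2 w)))
      (Icc (0 : ℝ) 1 ×ˢ trivDom V x₀) (t, z) := fun j =>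
    (hD.contDiffWithinAt (V.isOpen_dom x₀) (V.smoothOn_frame x₀ j) hz hz.2 w ht).mono
      (prod_mono subset_rfl (subset_univ _))
  have e : (fun p : ℝ × E => connFam D x₀ p w c) = fun p => ∑ j, c j •
      V.coord x₀ ((chartAt E x₀).symm p.2)
        ((D p.1).toFun (V.frame x₀ j) ((chartAt E x₀).symm p.2) (coordVec x₀ p.2 w)) := by
    funext p
    exact (D p.1).connForm_apply x₀ p.2 w c
  rw [e]
  exact ContDiffWithinAt.sum fun j _ => (h j).const_smul (c j)

theorem Connection.contDiffOn_connForm (D : Connection V) (x₀ : M) :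
    ContDiffOn ℝ ∞ (D.connForm x₀) (trivDom V x₀) :=
  ((smoothFamily_const D).contDiffOn_connFam x₀).comp (f := fun z => ((0 : ℝ), z))
    (contDiffOn_const.prodMk contDiffOn_id) fun _ hz => ⟨⟨le_rfl, zero_le_one⟩, hz⟩

theorem gaugeMap_left_inv {f : ∀ x, V.Fib x →ₗ[ℂ] W.Fib x} {g : ∀ x, W.Fib x →ₗ[ℂ] V.Fib x}
    (h : ∀ x e, g x (f x e) = e) {x₀ x₁ : M} {z : E} (hz : z ∈ transDom V W x₀ x₁) :
    ∃ H : HomC (W.Idx x₁) (V.Idx x₀), H.comp (gaugeMap f x₀ x₁ z) = .id ℂ _ := by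
  refine ⟨LinearMap.toContinuousLinearMap ((V.coord x₀ ((chartAt E x₀).symm z)) ∘ₗ
    (g ((chartAt E x₀).symm z)) ∘ₗ (W.symm x₁ ((chartAt E x₀).symm z))), ?_⟩
  ext1 c
  change V.coord x₀ _ (g _ (W.symm x₁ _ (W.coord x₁ _ (f _ (V.symm x₀ _ c))))) = c
  rw [W.symm_coord x₁ _ hz.2.2.2, h, V.coord_symm x₀ _ hz.1.2]

theorem gaugeMap_id_invertible {x₀ x₁ : M} {z : E} (hz : z ∈ transDom V V x₀ x₁) :
    ∃ H : HomC (V.Idx x₁) (V.Idx x₀),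
      H.comp (gaugeMap (fun y => (LinearMap.id : V.Fib y →ₗ[ℂ] V.Fib y)) x₀ x₁ z) = .id ℂ _ ∧
      (gaugeMap (fun y => (LinearMap.id : V.Fib y →ₗ[ℂ] V.Fib y)) x₀ x₁ z).comp H = .id ℂ _ := by
  refine ⟨LinearMap.toContinuousLinearMap ((V.coord x₀ ((chartAt E x₀).symm z)) ∘ₗ
    (V.symm x₁ ((chartAt E x₀).symm z))), ?_, ?_⟩
  · ext1 c
    change V.coord x₀ _ (V.symm x₁ _ (V.coord x₁ _ (V.symm x₀ _ c))) = c
    rw [V.symm_coord x₁ _ hz.2.2.2, V.coord_symm x₀ _ hz.1.2]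
  · ext1 c
    change V.coord x₁ _ (V.symm x₀ _ (V.coord x₀ _ (V.symm x₁ _ c))) = c
    rw [V.symm_coord x₀ _ hz.1.2, V.coord_symm x₁ _ hz.2.2.2]

/-- If a connection maps to a flat one under an injective parallel bundle map, then its curvature
vanishes in every frame. -/
theorem localCurv_connForm_eq_zero {D : Connection V} {D' : Connection W} (h : D'.Flat)
    {f : ∀ x, V.Fib x →ₗ[ℂ] W.Fib x} {g : ∀ x, W.Fib x →ₗ[ℂ] V.Fib x}
    (hf : V.SmoothHom W f) (hp : D.Parallel D' f) (hg : ∀ x e, g x (f x e) = e) {x₀ : M} {z : E}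
    (hz : z ∈ trivDom V x₀) : localCurv (D.connForm x₀) z = 0 := by
  let x := (chartAt E x₀).symm z
  have hzt : z ∈ transDom V W x₀ x := mem_transDom_symm hz
  have hn := (isOpen_transDom V W x₀ x).mem_nhds hzt
  refine ContinuousLinearMap.ext fun u => ContinuousLinearMap.ext fun v => ?_
  have h1 := localCurv_gauge (φ := chartChange x₀ x) (G := gaugeMap f x₀ x)
    ((contDiffOn_chartChange x₀ x).contDiffAt ((isOpen_chartOverlap x₀ x).mem_nhds hzt.2.1))
    ((contDiffOn_gaugeMap hf x₀ x).contDiffAt hn) (D'.differentiableAt_connForm x)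
    (((D.contDiffOn_connForm x₀).contDiffAt ((isOpen_trivDom V x₀).mem_nhds hz)).differentiableAt
      (by simp))
    (by filter_upwards [hn] with y hy w using connForm_gauge hf hp hy w) u v
  have h2 : localCurv (D'.connForm x) (chartChange x₀ x z) = 0 := h x
  obtain ⟨H, hH⟩ := gaugeMap_left_inv hg hzt
  rw [h2] at h1
  have h3 := congrArg (fun L => H.comp L) h1
  rw [← ContinuousLinearMap.comp_assoc, hH, ContinuousLinearMap.id_comp] at h3
  rw [h3]
  simp

theorem Connection.parallel_id {D : Connection V} : D.Parallel D fun _ => LinearMap.id :=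
  fun _ _ _ _ _ _ _ => rfl

theorem Connection.parallel_pullback (D : Connection W) (f : V.Iso W) :
    (D.pullback f).Parallel D fun x => (f.toEquiv x).toLinearMap := by
  intro U hU σ hσ x hx w
  exact ((f.toEquiv x).apply_symm_apply _).symm

theorem Connection.Flat.localCurv {D : Connection V} (h : D.Flat) {x₀ : M} {z : E}
    (hz : z ∈ trivDom V x₀) : localCurv (D.connForm x₀) z = 0 :=
  localCurv_connForm_eq_zero (g := fun _ => LinearMap.id) h V.smoothHom_id Connection.parallel_id
    (fun _ _ => rfl) hz

theorem Connection.Flat.localCurv_pullback {D : Connection W} (h : D.Flat) (f : V.Iso W) {x₀ : M}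
    {z : E} (hz : z ∈ trivDom V x₀) : RelKTheory.localCurv ((D.pullback f).connForm x₀) z = 0 :=
  localCurv_connForm_eq_zero (g := fun x => (f.toEquiv x).symm.toLinearMap) h f.smooth
    (D.parallel_pullback f) (fun x e => (f.toEquiv x).symm_apply_apply e) hz

theorem Connection.Same.connForm {D D' : Connection V} (h : D.Same D') {x₀ : M} {z : E}
    (hz : z ∈ trivDom V x₀) : D.connForm x₀ z = D'.connForm x₀ z := by
  ext1 w
  ext1 c
  rw [connForm_apply, connForm_apply]
  refine Finset.sum_congr rfl fun j _ => ?_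
  rw [h _ (V.isOpen_dom x₀) _ (V.smoothOn_frame x₀ j) _ hz.2]

theorem SmoothFamily.contDiffOn_reparam {D : ℝ → Connection V} (hD : SmoothFamily D) (x₀ : M) :
    ContDiffOn ℝ ∞ (reparam (connFam D x₀)) (univ ×ˢ trivDom V x₀) :=
  RelKTheory.contDiffOn_reparam (hD.contDiffOn_connFam x₀)

theorem SmoothFamily.gaugeRel {D : ℝ → Connection V} (hD : SmoothFamily D) (x₀ x₁ : M) :
    GaugeRel (chartChange x₀ x₁) (gaugeMap (fun y => (LinearMap.id : V.Fib y →ₗ[ℂ] V.Fib y)) x₀ x₁)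
      (reparam (connFam D x₀)) (reparam (connFam D x₁)) (transDom V V x₀ x₁) (trivDom V x₁) where
  isOpen' := isOpen_transDom V V x₀ x₁
  isOpen := isOpen_trivDom V x₁
  mapsTo _ hz := chartChange_mem_trivDom hz
  contDiff_map := (contDiffOn_chartChange x₀ x₁).mono fun _ hz => hz.2.1
  contDiff_gauge := contDiffOn_gaugeMap V.smoothHom_id x₀ x₁
  invertible _ hz := gaugeMap_id_invertible hz
  smooth' := (hD.contDiffOn_reparam x₀).mono (prod_mono subset_rfl fun _ hz => hz.1)
  smooth := hD.contDiffOn_reparam x₁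
  rel _ _ hz u := connForm_gauge V.smoothHom_id Connection.parallel_id hz u

theorem mem_transDom_of_chartChange {x₀ x₁ : M} {z : E} (hz : z ∈ trivDom V x₀)
    (hz' : z ∈ chartOverlap x₀ x₁) (h : chartChange x₀ x₁ z ∈ trivDom V x₁) :
    z ∈ transDom V V x₀ x₁ :=
  ⟨hz, hz', hz.1, by
    have h2 := h.2
    rwa [mem_preimage, symm_chartChange hz'] at h2⟩

/-- The Chern-Simons forms of a smooth family of connections in all charts. -/
def csLocal {D : ℝ → Connection V} (hD : SmoothFamily D) (k : ℕ) : LocalForms E M (2 * k + 1) where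
  toFun x := localCS (reparam (connFam D x)) k
  dom := trivDom V
  isOpen_dom := isOpen_trivDom V
  mem_dom := mem_trivDom V
  smooth x := contDiffOn_localCS (isOpen_trivDom V x) (hD.contDiffOn_reparam x) k
  compat x₀ x₁ _ hz hz' h := localCS_gauge (hD.gaugeRel x₀ x₁) (mem_transDom_of_chartChange hz hz' h) k

/-- The transgression forms between two smooth families of connections in all charts. -/
def primLocal {D D' : ℝ → Connection V} (hD : SmoothFamily D) (hD' : SmoothFamily D') (k : ℕ) :
    LocalForms E M (2 * k) where
  toFun x := localPrim (reparam (connFam D x)) (reparam (connFam D' x)) k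
  dom := trivDom V
  isOpen_dom := isOpen_trivDom V
  mem_dom := mem_trivDom V
  smooth x := contDiffOn_localPrim (isOpen_trivDom V x) (hD.contDiffOn_reparam x)
    (hD'.contDiffOn_reparam x) k
  compat x₀ x₁ _ hz hz' h := localPrim_gauge (hD.gaugeRel x₀ x₁) (hD'.gaugeRel x₀ x₁) k
    (mem_transDom_of_chartChange hz hz' h)

variable {D₀ D₁ : Connection V}

theorem ConnPath.smoothFamily (P : ConnPath D₀ D₁) : SmoothFamily P.conn := P.smooth

theorem ConnPath.csForm_eq_glue (P : ConnPath D₀ D₁) (k : ℕ) :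
    P.csForm k = (csLocal P.smoothFamily k).glue := by
  funext x
  have h : localCS (reparam (connFam P.conn x)) k (chartAt E x x) =
      localCS (connFam P.conn x) k (chartAt E x x) := by
    refine localCS_reparam ?_ k
    refine (ContDiffOn.comp (P.smoothFamily.contDiffOn_connFam x)
      (f := fun s : ℝ => (s, chartAt E x x)) (by fun_prop) fun s hs =>
        ⟨hs, mem_trivDom V x⟩).differentiableOn (by simp)
  change (localCS (connFam P.conn x) k (chartAt E x x)).compContinuousLinearMap _ =
    (localCS (reparam (connFam P.conn x)) k (chartAt E x x)).compContinuousLinearMap _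
  rw [h]

theorem reparam_zero {Y : Type*} (A : ℝ × E → Y) (z : E) : reparam A (0, z) = A (0, z) := by
  simp [reparam]

theorem reparam_one {Y : Type*} (A : ℝ × E → Y) (z : E) : reparam A (1, z) = A (1, z) := by
  simp [reparam]

theorem ConnPath.reparam_zero (P : ConnPath D₀ D₁) {x : M} {z : E} (hz : z ∈ trivDom V x) :
    reparam (connFam P.conn x) (0, z) = D₀.connForm x z :=
  (RelKTheory.reparam_zero _ z).trans (P.source.connForm hz)

theorem ConnPath.reparam_one (P : ConnPath D₀ D₁) {x : M} {z : E} (hz : z ∈ trivDom V x) :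
    reparam (connFam P.conn x) (1, z) = D₁.connForm x z :=
  (RelKTheory.reparam_one _ z).trans (P.target.connForm hz)

theorem localCurv_congr {n : Type} [Fintype n] {A B : E → E →L[ℝ] EndC n} {U : Set E} (hU : IsOpen U)
    (h : ∀ z ∈ U, A z = B z) {z : E} (hz : z ∈ U) : localCurv A z = localCurv B z := by
  have e : A =ᶠ[nhds z] B := by filter_upwards [hU.mem_nhds hz] with y hy using h y hy
  rw [localCurv, localCurv, e.fderiv_eq, h z hz]

/-- The curvature of `D` vanishes in every frame. -/
def FlatInFrames (D : Connection V) : Prop :=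
  ∀ x₀ : M, ∀ z ∈ trivDom V x₀, localCurv (D.connForm x₀) z = 0

theorem ConnPath.csForm_mem_closedForms (h₀ : FlatInFrames D₀) (h₁ : FlatInFrames D₁)
    (P : ConnPath D₀ D₁) (k : ℕ) :
    P.csForm k ∈ closedForms E M (2 * k + 1) := by
  rw [P.csForm_eq_glue k]
  refine ⟨LocalForms.smooth_glue _, ?_⟩
  funext x
  rw [LocalForms.d_glue]
  have hO := isOpen_trivDom V x
  have h := extDeriv_localCS hO (P.smoothFamily.contDiffOn_reparam x)
    (fun z hz => (localCurv_congr hO (fun y hy => P.reparam_zero hy) hz).trans (h₀ x z hz))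
    (fun z hz => (localCurv_congr hO (fun y hy => P.reparam_one hy) hz).trans (h₁ x z hz))
    k (mem_trivDom V x)
  change (extDeriv (localCS (reparam (connFam P.conn x)) k) _).compContinuousLinearMap _ = _
  rw [h]
  rfl

/-- The class of the Chern-Simons form of a path between flat connections only depends on its
ends. -/
theorem ConnPath.csForm_sub_mem_exactForms (h₀ : FlatInFrames D₀)
    (h₁ : FlatInFrames D₁) (P P' : ConnPath D₀ D₁) (k : ℕ) :
    P'.csForm k - P.csForm k ∈ exactForms E M (2 * k + 1) := by
  refine ⟨(primLocal P.smoothFamily P'.smoothFamily k).glue, LocalForms.smooth_glue _, ?_⟩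
  funext x
  rw [LocalForms.d_glue, P.csForm_eq_glue, P'.csForm_eq_glue]
  have hO := isOpen_trivDom V x
  have h := extDeriv_localPrim hO (P.smoothFamily.contDiffOn_reparam x)
    (P'.smoothFamily.contDiffOn_reparam x)
    (fun z hz => (localCurv_congr hO (fun y hy => P.reparam_zero hy) hz).trans (h₀ x z hz))
    (fun z hz => (localCurv_congr hO (fun y hy => P.reparam_one hy) hz).trans (h₁ x z hz))
    (fun z hz => (P'.reparam_zero hz).trans (P.reparam_zero hz).symm)
    (fun z hz => (P'.reparam_one hz).trans (P.reparam_one hz).symm) k (mem_trivDom V x)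
  change (extDeriv (localPrim (reparam (connFam P.conn x)) (reparam (connFam P'.conn x)) k)
    _).compContinuousLinearMap _ = _
  rw [h]
  rfl

end Families

/-! ### Affine paths, direct sums and extensions -/

section Paths

variable {E : Type*} [NormedAddCommGroup E] [NormedSpace ℝ E]
  {M : Type*} [TopologicalSpace M] [ChartedSpace E M] {V W : SmoothBundle E M}

/-- The affine combination `(1 - t) D₀ + t D₁` of two connections. -/
def Connection.lineMap (D₀ D₁ : Connection V) (t : ℝ) : Connection V where
  toFun σ x := (1 - t) • D₀.toFun σ x + t • D₁.toFun σ x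
  add U hU σ τ hσ hτ x hx := by
    rw [D₀.add U hU σ τ hσ hτ x hx, D₁.add U hU σ τ hσ hτ x hx, smul_add, smul_add]
    abel
  leibniz U hU g σ hg hσ x hx w := by
    have hr : ∀ (r : ℝ) (c : ℂ) (e : V.Fib x), r • c • e = c • r • e := fun r c e => smul_comm _ _ _
    simp only [LinearMap.add_apply, LinearMap.smul_apply, D₀.leibniz U hU g σ hg hσ x hx w,
      D₁.leibniz U hU g σ hg hσ x hx w, smul_add, hr]
    have e : ∀ y : V.Fib x, y = (1 - t) • y + t • y := fun y => by
      rw [← add_smul, sub_add_cancel, one_smul]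
    nth_rw 3 [e (σ x)]
    rw [smul_add]
    abel
  smooth U hU σ hσ x hx w := by
    have h := (contDiffAt_const (c := (1 - t))).smul (D₀.smooth U hU σ hσ x hx w) |>.add
      ((contDiffAt_const (c := t)).smul (D₁.smooth U hU σ hσ x hx w))
    refine h.congr_of_eventuallyEq (Filter.Eventually.of_forall fun z => ?_)
    change V.coord x _ ((1 - t) • _ + t • _) = _
    rw [map_add]
    exact congrArg₂ _ (((V.coord x _).restrictScalars ℝ).map_smul _ _)
      (((V.coord x _).restrictScalars ℝ).map_smul _ _)

/-- The affine path between two connections. -/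
def ConnPath.affine (D₀ D₁ : Connection V) : ConnPath D₀ D₁ where
  conn := D₀.lineMap D₁
  source := by
    intro U hU σ hσ x hx
    simp [Connection.lineMap]
  target := by
    intro U hU σ hσ x hx
    simp [Connection.lineMap]
  smooth U hU σ hσ x hx w t _ := by
    have h : ∀ D : Connection V, ContDiffAt ℝ ∞ (fun p : ℝ × E =>
        V.coord x ((chartAt E x).symm p.2)
          (D.toFun σ ((chartAt E x).symm p.2) (coordVec x p.2 w))) (t, chartAt E x x) := fun D =>
      ContDiffAt.comp (f := (Prod.snd : ℝ × E → E)) (t, chartAt E x x) (D.smooth U hU σ hσ x hx w)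
        contDiffAt_snd
    have f1 : ContDiffAt ℝ ∞ (fun p : ℝ × E => 1 - p.1) (t, chartAt E x x) := by fun_prop
    have f2 : ContDiffAt ℝ ∞ (fun p : ℝ × E => p.1) (t, chartAt E x x) := by fun_prop
    have h2 := (f1.smul (h D₀)).add (f2.smul (h D₁))
    refine (h2.congr_of_eventuallyEq (Filter.Eventually.of_forall fun p => ?_)).contDiffWithinAt
    change V.coord x _ ((1 - p.1) • _ + p.1 • _) = _
    rw [map_add]
    exact congrArg₂ _ (((V.coord x _).restrictScalars ℝ).map_smul _ _)
      (((V.coord x _).restrictScalars ℝ).map_smul _ _)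

/-- The direct sum of two paths of connections, up to changing the ends by connections which agree
with them on smooth sections. -/
def ConnPath.sum {D₀ D₁ : Connection V} {D₀' D₁' : Connection W} (P : ConnPath D₀ D₁)
    (P' : ConnPath D₀' D₁') {B : Connection (V.sum W)} (hB : (D₁.sum D₁').Same B) :
    ConnPath (D₀.sum D₀') B where
  conn t := (P.conn t).sum (P'.conn t)
  source U hU σ hσ x hx := by
    rw [SmoothBundle.smoothOn_sum_iff] at hσ
    exact congrArg₂ LinearMap.prod (P.source U hU _ hσ.1 x hx) (P'.source U hU _ hσ.2 x hx)
  target U hU σ hσ x hx := by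
    refine Eq.trans ?_ (hB U hU σ hσ x hx)
    rw [SmoothBundle.smoothOn_sum_iff] at hσ
    exact congrArg₂ LinearMap.prod (P.target U hU _ hσ.1 x hx) (P'.target U hU _ hσ.2 x hx)
  smooth U hU σ hσ x hx w t ht := by
    rw [SmoothBundle.smoothOn_sum_iff] at hσ
    refine contDiffWithinAt_pi.2 ?_
    rintro (i | i)
    · exact contDiffWithinAt_pi.1 (P.smooth U hU _ hσ.1 x hx w t ht) i
    · exact contDiffWithinAt_pi.1 (P'.smooth U hU _ hσ.2 x hx w t ht) i

theorem Connection.same_sum_pullback {V' W' : SmoothBundle E M} (D : Connection W)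
    (D' : Connection W') (f : V.Iso W) (f' : V'.Iso W') :
    ((D.pullback f).sum (D'.pullback f')).Same ((D.sum D').pullback (f.sum f')) :=
  fun _ _ _ _ _ _ => rfl

variable [FiniteDimensional ℝ E]

theorem connForm_lineMap (D₀ D₁ : Connection V) (t : ℝ) (x : M) (z : E) :
    (D₀.lineMap D₁ t).connForm x z = (1 - t) • D₀.connForm x z + t • D₁.connForm x z := by
  ext1 w
  ext1 c
  simp only [add_apply, smul_apply, Connection.connForm_apply, Finset.smul_sum]
  rw [← Finset.sum_add_distrib]
  refine Finset.sum_congr rfl fun j _ => ?_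
  rw [smul_comm (1 - t), smul_comm t, ← smul_add]
  refine congrArg _ ?_
  change V.coord x _ ((1 - t) • _ + t • _) = _
  rw [map_add]
  exact congrArg₂ _ (((V.coord x _).restrictScalars ℝ).map_smul _ _)
      (((V.coord x _).restrictScalars ℝ).map_smul _ _)

section Block

variable {n m : Type} [Fintype n] [DecidableEq n] [Fintype m] [DecidableEq m]

theorem traceC_block (P : EndC n) (Q : EndC m) :
    traceC (n ⊕ m) (blockL n m P + blockR n m Q) = traceC n P + traceC m Q := by
  have h : ∀ (l : Type) [Fintype l] [DecidableEq l] (f : EndC l),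
      traceC l f = ∑ i, f (Pi.single i 1) i := by
    intro l _ _ f
    simp [traceC]
  rw [h, h, h, Fintype.sum_sum_type]
  have e1 : ∀ i : n, (fun j : n => (Pi.single (Sum.inl i) 1 : n ⊕ m → ℂ) (Sum.inl j)) =
      Pi.single i 1 := fun i => by ext j; simp [Pi.single_apply]
  have e2 : ∀ i : m, (fun j : m => (Pi.single (Sum.inr i) 1 : n ⊕ m → ℂ) (Sum.inr j)) =
      Pi.single i 1 := fun i => by ext j; simp [Pi.single_apply]
  simp [blockL_apply, blockR_apply, e1, e2]

theorem csDensity_block (a : E →L[ℝ] EndC n) (b : E →L[ℝ] EndC m) (R : E →L[ℝ] E →L[ℝ] EndC n)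
    (S : E →L[ℝ] E →L[ℝ] EndC m) (T : E →L[ℝ] E →L[ℝ] EndC (n ⊕ m))
    (hT : ∀ u v, T u v = blockL n m (R u v) + blockR n m (S u v)) (k : ℕ) :
    csDensity ((blockL n m).comp a + (blockR n m).comp b) T k = csDensity a R k + csDensity b S k := by
  have h : ∀ (k : ℕ) (v : Fin (2 * k + 1) → E),
      csWord (fun x => ((blockL n m).comp a + (blockR n m).comp b) x) (fun x y => T x y) k v =
        blockL n m (csWord (fun x => a x) (fun x y => R x y) k v) +
          blockR n m (csWord (fun x => b x) (fun x y => S x y) k v) := by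
    intro k
    induction k with
    | zero => exact fun v => rfl
    | succ k ih =>
      intro v
      rw [csWord, ih, hT, block_mul]
      rfl
  ext v
  rw [ContinuousAlternatingMap.add_apply, csDensity_apply, csDensity_apply, csDensity_apply,
    ← mul_add, ← Finset.sum_add_distrib]
  refine congrArg _ (Finset.sum_congr rfl fun s _ => ?_)
  rw [h, traceC_block, smul_add]

theorem hasFDerivAt_block {Z X : Type*} [NormedAddCommGroup Z] [NormedSpace ℝ Z]
    [NormedAddCommGroup X] [NormedSpace ℝ X] {A : Z → X →L[ℝ] EndC n} {B : Z → X →L[ℝ] EndC m}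
    {z : Z} {A' : Z →L[ℝ] X →L[ℝ] EndC n} {B' : Z →L[ℝ] X →L[ℝ] EndC m}
    (hA : HasFDerivAt A A' z) (hB : HasFDerivAt B B' z) :
    HasFDerivAt (fun y => (blockL n m).comp (A y) + (blockR n m).comp (B y))
      ((ContinuousLinearMap.compL ℝ X _ _ (blockL n m)).comp A' +
        (ContinuousLinearMap.compL ℝ X _ _ (blockR n m)).comp B') z :=
  ((ContinuousLinearMap.compL ℝ X _ _ (blockL n m)).hasFDerivAt.comp z hA).add
    ((ContinuousLinearMap.compL ℝ X _ _ (blockR n m)).hasFDerivAt.comp z hB)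

theorem localCurv_block {A : E → E →L[ℝ] EndC n} {B : E → E →L[ℝ] EndC m} {z : E}
    (hA : DifferentiableAt ℝ A z) (hB : DifferentiableAt ℝ B z) (u v : E) :
    localCurv (fun y => (blockL n m).comp (A y) + (blockR n m).comp (B y)) z u v =
      blockL n m (localCurv A z u v) + blockR n m (localCurv B z u v) := by
  rw [localCurv_apply, localCurv_apply, localCurv_apply,
    (hasFDerivAt_block hA.hasFDerivAt hB.hasFDerivAt).fderiv]
  simp only [add_apply, ContinuousLinearMap.comp_apply,
    ContinuousLinearMap.compL_apply, map_sub, map_add]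
  rw [block_mul, block_mul]
  abel

/-- The Chern-Simons form of a direct sum is the sum of the Chern-Simons forms. -/
theorem localCS_block {A : ℝ × E → E →L[ℝ] EndC n} {B : ℝ × E → E →L[ℝ] EndC m} {U : Set E}
    (hU : IsOpen U) (hA : ContDiffOn ℝ ∞ A (univ ×ˢ U)) (hB : ContDiffOn ℝ ∞ B (univ ×ˢ U)) (k : ℕ)
    {z : E} (hz : z ∈ U) :
    localCS (fun p => (blockL n m).comp (A p) + (blockR n m).comp (B p)) k z =
      localCS A k z + localCS B k z := by
  have dA := differentiableAt_of_contDiffOn hU hA hz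
  have dB := differentiableAt_of_contDiffOn hU hB hz
  have dC : ∀ t, DifferentiableAt ℝ (fun p => (blockL n m).comp (A p) + (blockR n m).comp (B p))
      (t, z) := fun t =>
    (hasFDerivAt_block (dA t).hasFDerivAt (dB t).hasFDerivAt).differentiableAt
  rw [localCS_eq_fibreIntegral dC k, localCS_eq_fibreIntegral dA k, localCS_eq_fibreIntegral dB k]
  have hc : ∀ {l : Type} [Fintype l] [DecidableEq l] {C : ℝ × E → E →L[ℝ] EndC l},
      ContDiffOn ℝ ∞ C (univ ×ˢ U) → IntervalIntegrable
        (fun t => contractSlice (chernForm C k (t, z))) MeasureTheory.volume 0 1 := fun hC =>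
    (continuousOn_slice (contDiffOn_contractSlice
      (contDiffOn_chernForm hU hC k)).continuousOn hz).intervalIntegrable _ _
  refine Eq.trans (intervalIntegral.integral_congr fun t _ => ?_)
    (intervalIntegral.integral_add (hc hA) (hc hB))
  change contractSlice (chernForm _ k (t, z)) = _
  simp only [contractSlice_chernForm (dC t), contractSlice_chernForm (dA t),
    contractSlice_chernForm (dB t)]
  have d1 := (contDiff_slice_left hA hz).differentiable (by simp) t
  have d2 := (contDiff_slice_left hB hz).differentiable (by simp) t
  have e := (hasFDerivAt_block d1.hasFDerivAt d2.hasFDerivAt).hasDerivAt.deriv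
  rw [e]
  refine csDensity_block _ _ _ _ _ (localCurv_block
    (((contDiffOn_slice hA t).contDiffAt (hU.mem_nhds hz)).differentiableAt (by simp))
    (((contDiffOn_slice hB t).contDiffAt (hU.mem_nhds hz)).differentiableAt (by simp))) k

theorem csDensity_eq_zero {a : E →L[ℝ] EndC n} {R : E →L[ℝ] E →L[ℝ] EndC n} (hR : R = 0)
    {k : ℕ} (ha : k = 0 → ∀ w, traceC n (a w) = 0) : csDensity a R k = 0 := by
  ext v
  rw [csDensity_apply, Finset.sum_eq_zero, mul_zero]
  · rfl
  intro s _
  cases k with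
  | zero =>
    rw [csWord, ha rfl, smul_zero]
  | succ k =>
    rw [csWord, hR]
    simp

end Block

variable [IsManifold 𝓘(ℝ, E) ∞ M]

theorem ConnPath.csForm_sum {D₀ D₁ : Connection V} {D₀' D₁' : Connection W} (P : ConnPath D₀ D₁)
    (P' : ConnPath D₀' D₁') {B : Connection (V.sum W)} (hB : (D₁.sum D₁').Same B) (k : ℕ) :
    (P.sum P' hB).csForm k = P.csForm k + P'.csForm k := by
  rw [ConnPath.csForm_eq_glue, ConnPath.csForm_eq_glue, ConnPath.csForm_eq_glue]
  funext x
  have h := localCS_block ((isOpen_trivDom V x).inter (isOpen_trivDom W x))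
    ((P.smoothFamily.contDiffOn_reparam x).mono (prod_mono subset_rfl inter_subset_left))
    ((P'.smoothFamily.contDiffOn_reparam x).mono (prod_mono subset_rfl inter_subset_right)) k
    ⟨mem_trivDom V x, mem_trivDom W x⟩
  have e : reparam (connFam (P.sum P' hB).conn x) = fun p =>
      (blockL _ _).comp (reparam (connFam P.conn x) p) +
        (blockR _ _).comp (reparam (connFam P'.conn x) p) :=
    funext fun p => Connection.connForm_sum _ _ x p.2
  change (localCS (reparam (connFam (P.sum P' hB).conn x)) k (chartAt E x x)).compContinuousLinearMap
    _ = (localCS (reparam (connFam P.conn x)) k (chartAt E x x)).compContinuousLinearMap _ +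
      (localCS (reparam (connFam P'.conn x)) k (chartAt E x x)).compContinuousLinearMap _
  rw [e]
  erw [h]
  rfl

theorem mem_transDom_self (V W : SmoothBundle E M) (x : M) : chartAt E x x ∈ transDom V W x x :=
  ⟨mem_trivDom V x, mem_chartOverlap_self x, mem_trivDom W x⟩

/-- The Chern-Simons form of the affine path vanishes if the difference `a` of the two flat
connections satisfies `a ∧ a = 0`, in the strong sense that `a(u) a(v) = 0` for all `u`, `v`. -/
theorem csForm_affine_eq_zero {D₀ D₁ : Connection V} (h₀ : FlatInFrames D₀) (h₁ : FlatInFrames D₁)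
    (h : ∀ (x : M) (u v : E),
      (D₁.connForm x (chartAt E x x) u - D₀.connForm x (chartAt E x x) u) *
        (D₁.connForm x (chartAt E x x) v - D₀.connForm x (chartAt E x x) v) = 0) (k : ℕ) :
    (ConnPath.affine D₀ D₁).csForm k = 0 := by
  funext x
  let z := chartAt E x x
  have hder : ∀ t, HasDerivAt (fun s : ℝ => (D₀.lineMap D₁ s).connForm x z)
      (D₁.connForm x z - D₀.connForm x z) t := by
    intro t
    have h2 := (((hasDerivAt_id t).const_sub 1).smul_const (D₀.connForm x z)).add
      ((hasDerivAt_id t).smul_const (D₁.connForm x z))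
    have e : (fun s : ℝ => (D₀.lineMap D₁ s).connForm x z) = _ :=
      funext fun s => connForm_lineMap D₀ D₁ s x z
    rw [e]
    have e2 : D₁.connForm x z - D₀.connForm x z =
        (-1 : ℝ) • D₀.connForm x z + (1 : ℝ) • D₁.connForm x z := by module
    rw [e2]
    exact h2
  have hcurv : ∀ t, (D₀.lineMap D₁ t).curvForm x z = 0 := by
    intro t
    refine ContinuousLinearMap.ext fun u => ContinuousLinearMap.ext fun v => ?_
    have e : (D₀.lineMap D₁ t).connForm x = fun y => (1 - t) • D₀.connForm x y + t • D₁.connForm x y :=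
      funext fun y => connForm_lineMap D₀ D₁ t x y
    have hf := ((D₀.differentiableAt_connForm x).hasFDerivAt.const_smul (1 - t)).add
      ((D₁.differentiableAt_connForm x).hasFDerivAt.const_smul t)
    have k0 := DFunLike.congr_fun (DFunLike.congr_fun (h₀ x z (mem_trivDom V x)) u) v
    have k1 := DFunLike.congr_fun (DFunLike.congr_fun (h₁ x z (mem_trivDom V x)) u) v
    have h1 := h x u v
    have h2 := h x v u
    rw [localCurv_apply] at k0 k1
    rw [Connection.curvForm_apply, e]
    erw [hf.fderiv]
    simp only [add_apply, smul_apply]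
    change _ = (0 : EndC (V.Idx x))
    have k0' : _ = (0 : EndC (V.Idx x)) := k0
    have k1' : _ = (0 : EndC (V.Idx x)) := k1
    -- Both curvatures vanish, and the remaining terms are multiples of `a(u) a(v)`.
    have key : ∀ (p q p' q' a b a' b' : EndC (V.Idx x)),
        ((1 - t) • p + t • p') - ((1 - t) • q + t • q') +
          ((1 - t) • a + t • a') * ((1 - t) • b + t • b') -
          ((1 - t) • b + t • b') * ((1 - t) • a + t • a') =
        (1 - t) • (p - q + a * b - b * a) + t • (p' - q' + a' * b' - b' * a') -
          (t * (1 - t)) • ((a' - a) * (b' - b) - (b' - b) * (a' - a)) := by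
      intro p q p' q' a b a' b'
      simp only [mul_add, add_mul, mul_sub, sub_mul, smul_mul_assoc, mul_smul_comm, smul_sub,
        smul_add, smul_smul]
      module
    rw [key, k0', k1', h1, h2]
    simp
  have htr : ∀ w, traceC (V.Idx x) ((D₁.connForm x z - D₀.connForm x z) w) = 0 := by
    intro w
    rw [traceC_apply]
    refine (LinearMap.isNilpotent_trace_of_isNilpotent ⟨2, ?_⟩).eq_zero
    rw [pow_two]
    exact congrArg ContinuousLinearMap.toLinearMap (h x w w)
  have e : ∫ t in (0 : ℝ)..1,
      csDensity (derivWithin (fun s => (D₀.lineMap D₁ s).connForm x z) (Icc 0 1) t)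
        ((D₀.lineMap D₁ t).curvForm x z) k = 0 := by
    rw [intervalIntegral.integral_congr (g := fun _ => 0), intervalIntegral.integral_zero]
    intro t ht
    rw [uIcc_of_le zero_le_one] at ht
    refine csDensity_eq_zero (hcurv t) fun _ => ?_
    rw [(hder t).hasDerivWithinAt.derivWithin (uniqueDiffOn_Icc zero_lt_one t ht)]
    exact htr
  change (∫ t in (0 : ℝ)..1,
      csDensity (derivWithin (fun s => (D₀.lineMap D₁ s).connForm x z) (Icc 0 1) t)
        ((D₀.lineMap D₁ t).curvForm x z) k).compContinuousLinearMap _ = _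
  rw [e]
  rfl

/-- If `i` and `p` form a short exact sequence, and are parallel for both `D₀` and `D₁` on the
middle term, then the difference `a` of `D₀` and `D₁` maps the middle term to the image of `i`, and
it vanishes there. -/
theorem connForm_sub_mul_sub_eq_zero {V' V'' : SmoothBundle E M} {D₀ D₁ : Connection V}
    {D' : Connection V'} {D'' : Connection V''} {i : ∀ x, V'.Fib x →ₗ[ℂ] V.Fib x}
    {p : ∀ x, V.Fib x →ₗ[ℂ] V''.Fib x} (hi : V'.SmoothHom V i) (hp : V.SmoothHom V'' p)
    (hi₀ : D'.Parallel D₀ i) (hi₁ : D'.Parallel D₁ i) (hp₀ : D₀.Parallel D'' p)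
    (hp₁ : D₁.Parallel D'' p) (hex : ∀ x, Function.Exact (i x) (p x)) (x : M) (u v : E) :
    (D₁.connForm x (chartAt E x x) u - D₀.connForm x (chartAt E x x) u) *
      (D₁.connForm x (chartAt E x x) v - D₀.connForm x (chartAt E x x) v) = 0 := by
  let z := chartAt E x x
  have hx : (chartAt E x).symm z = x := (chartAt E x).left_inv (mem_chart_source E x)
  have e1 := connForm_gauge hi hi₀ (mem_transDom_self V' V x) u
  have e2 := connForm_gauge hi hi₁ (mem_transDom_self V' V x) u
  have e3 := connForm_gauge hp hp₀ (mem_transDom_self V V'' x) v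
  have e4 := connForm_gauge hp hp₁ (mem_transDom_self V V'' x) v
  have hz : z ∈ (chartAt E x).target := mem_chart_target E x
  rw [show chartChange x x (chartAt E x x) = z from chartChange_self hz,
    show fderiv ℝ (chartChange x x) (chartAt E x x) = _ from fderiv_chartChange_self hz] at e1 e2
  rw [e1] at e2
  have e5 := add_left_cancel e2
  rw [← e4] at e3
  ext1 c
  set a₀ := D₀.connForm x z
  set a₁ := D₁.connForm x z
  change (a₁ u - a₀ u) ((a₁ v - a₀ v) c) = 0
  have h1 : gaugeMap p x x z ((a₁ v - a₀ v) c) = 0 := by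
    have := DFunLike.congr_fun e3 c
    simp only [ContinuousLinearMap.comp_apply] at this
    rw [sub_apply, map_sub]
    exact sub_eq_zero.2 this.symm
  generalize (a₁ v - a₀ v) c = b at h1
  rw [gaugeMap_apply] at h1
  have hd : ∀ (B : SmoothBundle E M), (chartAt E x).symm z ∈ B.dom x := fun B => by
    rw [hx]
    exact B.mem_dom x
  have h2 : p ((chartAt E x).symm z) (V.symm x ((chartAt E x).symm z) b) = 0 := by
    rw [← V''.symm_coord x _ (hd V'') (p _ _), h1, map_zero]
  obtain ⟨e, he⟩ := (hex _ _).1 h2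
  have h3 : b = gaugeMap i x x z (V'.coord x _ e) := by
    rw [gaugeMap_apply, V'.symm_coord x _ (hd V'), he, V.coord_symm x _ (hd V)]
  rw [h3, sub_apply, sub_eq_zero]
  exact (DFunLike.congr_fun e5 (V'.coord x _ e)).symm

end Paths

/-! ### Traces of logarithmic derivatives -/

section LogDerivative

variable {X : Type*} [NormedAddCommGroup X] [NormedSpace ℝ X]
  {n m : Type} [Fintype n] [DecidableEq n] [Fintype m] [DecidableEq m]

/-- The one-form `Tr (L dK)`, for functions `K` and `L` with values in linear maps. It is used for
`L = K⁻¹`. -/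
def logForm (K : X → HomC n m) (L : X → HomC m n) (p : X) : X [⋀^Fin 1]→L[ℝ] ℂ :=
  ContinuousAlternatingMap.ofSubsingleton ℝ X ℂ (0 : Fin 1)
    ((traceC n).comp ((compR n m n (L p)).comp (fderiv ℝ K p)))

theorem logForm_apply (K : X → HomC n m) (L : X → HomC m n) (p : X) (v : Fin 1 → X) :
    logForm K L p v = traceC n ((L p).comp (fderiv ℝ K p (v 0))) := rfl

variable {K : X → HomC n m} {L : X → HomC m n} {s : Set X}

theorem contDiffOn_compR {Z : Type*} [NormedAddCommGroup Z] [NormedSpace ℝ Z] {l : Type} [Fintype l]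
    {r : WithTop ℕ∞} {s : Set Z} {g : Z → HomC m l} {h : Z → HomC n m} (hg : ContDiffOn ℝ r g s)
    (hh : ContDiffOn ℝ r h s) : ContDiffOn ℝ r (fun z => (g z).comp (h z)) s :=
  ContDiffOn.clm_apply ((compR n m l).contDiff.comp_contDiffOn hg) hh

theorem contDiffOn_logForm [FiniteDimensional ℝ X] (hs : IsOpen s) (hK : ContDiffOn ℝ ∞ K s)
    (hL : ContDiffOn ℝ ∞ L s) : ContDiffOn ℝ ∞ (logForm K L) s := by
  refine contDiffOn_alternating fun v => ?_
  have h1 : ContDiffOn ℝ ∞ (fun p => fderiv ℝ K p (v 0)) s :=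
    (hK.fderiv_of_isOpen hs (by simp)).clm_apply contDiffOn_const
  exact (traceC n).contDiff.comp_contDiffOn (contDiffOn_compR hL h1)

/-- The form `Tr (K⁻¹ dK)` is closed. -/
theorem extDeriv_logForm [FiniteDimensional ℝ X] (hs : IsOpen s) (hK : ContDiffOn ℝ ∞ K s)
    (hL : ContDiffOn ℝ ∞ L s) (hLK : ∀ p ∈ s, (L p).comp (K p) = .id ℂ _)
    (hKL : ∀ p ∈ s, (K p).comp (L p) = .id ℂ _) {p : X} (hp : p ∈ s) :
    extDeriv (logForm K L) p = 0 := by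
  have hp' := hs.mem_nhds hp
  have dK := ((hK.contDiffAt hp').differentiableAt (by simp)).hasFDerivAt
  have dL := ((hL.contDiffAt hp').differentiableAt (by simp)).hasFDerivAt
  have ddK := (((hK.fderiv_of_isOpen hs (m := ∞) (by simp)).contDiffAt hp').differentiableAt
    (by simp)).hasFDerivAt
  have hsym := (hK.contDiffAt hp').isSymmSndFDerivAt (by simpa using two_le_infty)
  have h1 : ∀ u, (fderiv ℝ L p u).comp (K p) = -(L p).comp (fderiv ℝ K p u) := by
    intro u
    have e := (compR n m n).hasFDerivAt_of_bilinear dL dK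
    have e2 : (fun q => compR n m n (L q) (K q)) =ᶠ[nhds p] fun _ => .id ℂ _ := by
      filter_upwards [hp'] with q hq using hLK q hq
    have e3 := DFunLike.congr_fun
      (e.unique ((hasFDerivAt_const (ContinuousLinearMap.id ℂ (n → ℂ)) p).congr_of_eventuallyEq e2)) u
    simp only [add_apply, ContinuousLinearMap.precompR_apply, ContinuousLinearMap.precompL_apply,
      compR_apply, zero_apply] at e3
    rw [add_comm] at e3
    exact eq_neg_of_add_eq_zero_left e3
  have h2 : ∀ u, fderiv ℝ L p u = -((L p).comp (fderiv ℝ K p u)).comp (L p) := by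
    intro u
    rw [← ContinuousLinearMap.neg_comp, ← h1, ContinuousLinearMap.comp_assoc, hKL p hp,
      ContinuousLinearMap.comp_id]
  have h3 : ∀ u w, fderiv ℝ (fun q => traceC n ((L q).comp (fderiv ℝ K q w))) p u =
      traceC n ((L p).comp (fderiv ℝ (fderiv ℝ K) p u w)) -
        traceC n (((L p).comp (fderiv ℝ K p u)) * ((L p).comp (fderiv ℝ K p w))) := by
    intro u w
    have e := (traceC n).hasFDerivAt.comp p
      ((compR n m n).hasFDerivAt_of_bilinear dL (ddK.clm_apply (hasFDerivAt_const w p)))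
    change fderiv ℝ ((traceC n) ∘ fun q => compR n m n (L q) (fderiv ℝ K q w)) p u = _
    rw [e.fderiv]
    simp only [add_apply, ContinuousLinearMap.comp_apply, ContinuousLinearMap.precompR_apply,
      ContinuousLinearMap.precompL_apply, compR_apply, h2]
    rw [map_add, ContinuousLinearMap.neg_comp, map_neg, sub_eq_add_neg]
    congr 1
    simp
    rfl
  ext v
  rw [extDeriv_apply (((contDiffOn_logForm hs hK hL).contDiffAt hp').differentiableAt (by simp)),
    Fin.sum_univ_two]
  simp only [logForm_apply]
  rw [h3, h3, traceC_mul_comm]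
  change _ • (traceC n ((L p).comp (fderiv ℝ (fderiv ℝ K) p (v 0) (v 1))) - traceC n (_ * _)) +
    _ • (traceC n ((L p).comp (fderiv ℝ (fderiv ℝ K) p (v 1) (v 0))) - traceC n (_ * _)) = (0 : ℂ)
  rw [hsym.eq (v 0) (v 1)]
  simp [Fin.removeNth]

end LogDerivative

/-! ### Isotopies -/

theorem _root_.ContDiffAt.homC_apply {Z : Type*} [NormedAddCommGroup Z] [NormedSpace ℝ Z]
    {n m : Type} [Fintype n] [Fintype m] {r : WithTop ℕ∞} {g : Z → HomC n m} {c : Z → n → ℂ} {p : Z}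
    (hg : ContDiffAt ℝ r g p) (hc : ContDiffAt ℝ r c p) : ContDiffAt ℝ r (fun q => g q (c q)) p :=
  ContDiffAt.comp (g := fun q : HomC n m × (n → ℂ) => q.1 q.2) p
    ((isBoundedBilinearMap_apply (𝕜 := ℂ) (E := n → ℂ) (F := m → ℂ)).contDiff.restrict_scalars
      ℝ).contDiffAt (hg.prodMk hc)

section LowestDegree

variable {E : Type*} [NormedAddCommGroup E] [NormedSpace ℝ E] [FiniteDimensional ℝ E]
  {n : Type} [Fintype n] [DecidableEq n]

/-- The component of degree one of the Chern-Simons form is the difference of the traces. -/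
theorem localCS_zero_apply {A : ℝ × E → E →L[ℝ] EndC n} {U : Set E} (hU : IsOpen U)
    (hA : ContDiffOn ℝ ∞ A (univ ×ˢ U)) {z : E} (hz : z ∈ U) (v : Fin (2 * 0 + 1) → E) :
    localCS A 0 z v = -(2 * (Real.pi : ℂ) * Complex.I)⁻¹ *
      (traceC n (A (1, z) (v 0)) - traceC n (A (0, z) (v 0))) := by
  have dA := differentiableAt_of_contDiffOn hU hA hz
  rw [localCS_eq_fibreIntegral dA, fibreIntegral_apply (contDiffOn_chernForm hU hA 0) hz]
  have hs : ContDiff ℝ ∞ (fun t => traceC n (A (t, z) (v 0))) :=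
    (traceC n).contDiff.comp ((contDiff_slice_left hA hz).clm_apply contDiff_const)
  have h : ∀ t, chernForm A 0 (t, z) (Fin.cons (1, 0) fun i => (0, v i)) =
      -(2 * (Real.pi : ℂ) * Complex.I)⁻¹ * deriv (fun t => traceC n (A (t, z) (v 0))) t := by
    intro t
    have h1 := congrArg (fun α => α v) (contractSlice_chernForm (dA t) 0)
    change chernForm A 0 (t, z) (Fin.cons (1, 0) fun i => (0, v i)) = _ at h1
    have h2 := (((contDiff_slice_left hA hz).differentiable (by simp) t).hasDerivAt.clm_apply
      (hasDerivAt_const t (v 0)))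
    have h3 := ((traceC n).hasFDerivAt.comp_hasDerivAt t h2).deriv
    change deriv (fun t => traceC n (A (t, z) (v 0))) t = _ at h3
    rw [h1, h3]
    simp [csDensity_apply, csWord]
  simp only [h]
  rw [intervalIntegral.integral_const_mul, intervalIntegral.integral_deriv_eq_sub]
  · exact fun t _ => hs.differentiable (by simp) t
  · exact (hs.continuous_deriv (by simp)).intervalIntegrable _ _

end LowestDegree

section Isotopy

variable {E : Type*} [NormedAddCommGroup E] [NormedSpace ℝ E] [FiniteDimensional ℝ E]
  {M : Type*} [TopologicalSpace M] [ChartedSpace E M] {V W : SmoothBundle E M}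

/-- A family of isomorphisms, parametrized by `ℝ`, is smooth if its matrix entries are. -/
def SmoothIsoFamily (H : ℝ → V.Iso W) : Prop :=
  ∀ (t : ℝ) (x : M) (c : V.Idx x → ℂ), ContDiffAt ℝ ∞
    (fun p : ℝ × E => W.coord x ((chartAt E x).symm p.2)
      ((H p.1).toEquiv _ (V.symm x ((chartAt E x).symm p.2) c))) (t, chartAt E x x)

/-- The matrices of a family of isomorphisms in the chart and frames around `x`. -/
def isoFam (H : ℝ → V.Iso W) (x : M) (p : ℝ × E) : HomC (V.Idx x) (W.Idx x) :=
  gaugeMap (fun y => ((H p.1).toEquiv y).toLinearMap) x x p.2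

/-- The matrices of the inverses of a family of isomorphisms in the chart and frames around `x`. -/
def isoFamInv (H : ℝ → V.Iso W) (x : M) (p : ℝ × E) : HomC (W.Idx x) (V.Idx x) :=
  gaugeMap (fun y => ((H p.1).toEquiv y).symm.toLinearMap) x x p.2

variable {H : ℝ → V.Iso W}

theorem isoFamInv_comp_isoFam {x : M} {p : ℝ × E} (hp : p.2 ∈ transDom V W x x) :
    (isoFamInv H x p).comp (isoFam H x p) = .id ℂ _ := by
  ext1 c
  change V.coord x _ (((H p.1).toEquiv _).symm (W.symm x _ (W.coord x _ _))) = c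
  rw [W.symm_coord x _ hp.2.2.2]
  change V.coord x _ (((H p.1).toEquiv _).symm ((H p.1).toEquiv _ _)) = c
  rw [LinearEquiv.symm_apply_apply, V.coord_symm x _ hp.1.2]

theorem isoFam_comp_isoFamInv {x : M} {p : ℝ × E} (hp : p.2 ∈ transDom V W x x) :
    (isoFam H x p).comp (isoFamInv H x p) = .id ℂ _ := by
  ext1 c
  change W.coord x _ (((H p.1).toEquiv _) (V.symm x _ (V.coord x _ _))) = c
  rw [V.symm_coord x _ hp.1.2]
  change W.coord x _ (((H p.1).toEquiv _) (((H p.1).toEquiv _).symm _)) = c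
  rw [LinearEquiv.apply_symm_apply, W.coord_symm x _ hp.2.2.2]

variable [IsManifold 𝓘(ℝ, E) ∞ M]

/-- An isotopy can be reparametrized, in the opposite direction, by the real line. -/
theorem smoothIsoFamily_of_isotopy {h : ℝ → V.Iso W}
    (hh : ∀ t ∈ Icc (0 : ℝ) 1, ∀ (x : M) (c : V.Idx x → ℂ),
      ContMDiffWithinAt (𝓘(ℝ, ℝ).prod 𝓘(ℝ, E)) 𝓘(ℝ, W.Idx x → ℂ) ∞
        (fun p : ℝ × M => W.coord x p.2 ((h p.1).toEquiv p.2 (V.symm x p.2 c)))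
        (Icc (0 : ℝ) 1 ×ˢ univ) (t, x)) :
    SmoothIsoFamily fun t => h (1 - Real.smoothTransition t) := by
  intro t x c
  have hI : ∀ t, 1 - Real.smoothTransition t ∈ Icc (0 : ℝ) 1 := fun t =>
    ⟨sub_nonneg.2 (smoothTransition_mem t).2, sub_le_self _ (smoothTransition_mem t).1⟩
  have h1 : ContMDiffAt 𝓘(ℝ, ℝ × E) 𝓘(ℝ, ℝ) ∞ (fun p : ℝ × E => 1 - Real.smoothTransition p.1)
      (t, chartAt E x x) :=
    (contDiff_const.sub (Real.smoothTransition.contDiff.comp contDiff_fst)).contDiffAt.contMDiffAt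
  have h2 : ContMDiffAt 𝓘(ℝ, ℝ × E) 𝓘(ℝ, E) ∞ (fun p : ℝ × E => (chartAt E x).symm p.2)
      (t, chartAt E x x) :=
    ContMDiffAt.comp (f := (Prod.snd : ℝ × E → E)) (t, chartAt E x x)
      ((contMDiffOn_chart_symm (I := 𝓘(ℝ, E)) (n := ∞) (x := x)).contMDiffAt
        ((chartAt E x).open_target.mem_nhds (mem_chart_target E x)))
      (contDiff_snd (𝕜 := ℝ) (E := ℝ) (F := E) (n := ∞)).contDiffAt.contMDiffAt
  have h3 := (h1.prodMk h2).contMDiffWithinAt (s := univ)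
  have h4 := hh (1 - Real.smoothTransition t) (hI t) x c
  have h5 : (1 - Real.smoothTransition t, x) =
      (fun p : ℝ × E => (1 - Real.smoothTransition p.1, (chartAt E x).symm p.2)) (t, chartAt E x x) :=
    Prod.ext rfl ((chartAt E x).left_inv (mem_chart_source E x)).symm
  rw [h5] at h4
  have h6 := ContMDiffWithinAt.comp (t, chartAt E x x) h4 h3
    (show MapsTo _ univ (Icc (0 : ℝ) 1 ×ˢ univ) from fun p _ => ⟨hI p.1, mem_univ _⟩)
  exact contMDiffAt_iff_contDiffAt.1 (contMDiffWithinAt_univ.1 h6)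

theorem isoFam_chartChange (x₀ x₁ : M) {p : ℝ × E}
    (h : p.2 ∈ chartOverlap x₀ x₁) (h' : chartChange x₀ x₁ p.2 ∈ transDom V W x₁ x₁) :
    isoFam H x₀ p = ((gaugeMap (fun y => (LinearMap.id : W.Fib y →ₗ[ℂ] W.Fib y)) x₁ x₀
      (chartChange x₀ x₁ p.2)).comp (isoFam H x₁ (p.1, chartChange x₀ x₁ p.2))).comp
        (gaugeMap (fun y => (LinearMap.id : V.Fib y →ₗ[ℂ] V.Fib y)) x₀ x₁ p.2) := by
  have e := symm_chartChange h
  have hV := h'.1.2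
  have hW := h'.2.2.2
  ext1 c
  simp only [ContinuousLinearMap.comp_apply, isoFam, gaugeMap_apply, LinearMap.id_apply,
    mem_preimage] at hV hW ⊢
  rw [e] at hV hW ⊢
  rw [V.symm_coord x₁ _ hV, W.symm_coord x₁ _ hW]

theorem isoFamInv_chartChange (x₀ x₁ : M) {p : ℝ × E} (hp : p.2 ∈ transDom V W x₀ x₀)
    (h : p.2 ∈ chartOverlap x₀ x₁) :
    (gaugeMap (fun y => (LinearMap.id : V.Fib y →ₗ[ℂ] V.Fib y)) x₀ x₁ p.2).comp
      ((isoFamInv H x₀ p).comp (gaugeMap (fun y => (LinearMap.id : W.Fib y →ₗ[ℂ] W.Fib y)) x₁ x₀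
      (chartChange x₀ x₁ p.2))) = isoFamInv H x₁ (p.1, chartChange x₀ x₁ p.2) := by
  have e := symm_chartChange h
  ext1 c
  simp only [ContinuousLinearMap.comp_apply, isoFamInv, gaugeMap_apply, LinearMap.id_apply]
  rw [e, V.symm_coord x₀ _ hp.1.2, W.symm_coord x₀ _ hp.2.2.2]

theorem mem_transDom_chartChange {V W : SmoothBundle E M} {x₀ x₁ : M} {z : E}
    (h : z ∈ chartOverlap x₀ x₁) (hV : (chartAt E x₀).symm z ∈ V.dom x₁)
    (hW : (chartAt E x₀).symm z ∈ W.dom x₀) :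
    chartChange x₀ x₁ z ∈ transDom V W x₁ x₀ := by
  have e := symm_chartChange h
  refine ⟨⟨chartChange_mem_target h, ?_⟩, ⟨chartChange_mem_target h, ?_⟩,
    chartChange_mem_target h, ?_⟩
  · rwa [mem_preimage, e]
  · rw [mem_preimage, e]
    exact (chartAt E x₀).map_target h.1
  · rwa [mem_preimage, e]

theorem SmoothIsoFamily.contDiffOn_isoFam (hH : SmoothIsoFamily H) (x₀ : M) :
    ContDiffOn ℝ ∞ (isoFam H x₀) (univ ×ˢ transDom V W x₀ x₀) := by
  rintro ⟨t, z⟩ ⟨-, hz⟩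
  let x := (chartAt E x₀).symm z
  have hov : z ∈ chartOverlap x₀ x := ⟨hz.1.1, mem_chart_source E x⟩
  have hφ : ContDiffAt ℝ ∞ (chartChange (E := E) x₀ x) z :=
    (contDiffOn_chartChange x₀ x).contDiffAt ((isOpen_chartOverlap x₀ x).mem_nhds hov)
  have hφ2 : ContDiffAt ℝ ∞ (fun p : ℝ × E => chartChange (E := E) x₀ x p.2) (t, z) :=
    hφ.comp (f := Prod.snd) (t, z) contDiffAt_snd
  have h1 : ContDiffAt ℝ ∞ (fun p : ℝ × E =>
      gaugeMap (fun y => (LinearMap.id : V.Fib y →ₗ[ℂ] V.Fib y)) x₀ x p.2) (t, z) :=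
    ContDiffAt.comp (f := (Prod.snd : ℝ × E → E)) (t, z)
      ((contDiffOn_gaugeMap V.smoothHom_id x₀ x).contDiffAt
        ((isOpen_transDom V V x₀ x).mem_nhds (mem_transDom_symm hz.1))) contDiffAt_snd
  have h2 : ContDiffAt ℝ ∞ (fun p : ℝ × E =>
      gaugeMap (fun y => (LinearMap.id : W.Fib y →ₗ[ℂ] W.Fib y)) x x₀ (chartChange x₀ x p.2))
      (t, z) :=
    ContDiffAt.comp (f := fun p : ℝ × E => chartChange x₀ x p.2) (t, z)
      ((contDiffOn_gaugeMap W.smoothHom_id x x₀).contDiffAt ((isOpen_transDom W W x x₀).mem_nhds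
        (mem_transDom_chartChange hov (W.mem_dom x) hz.2.2.2))) hφ2
  have h3 : ContDiffAt ℝ ∞ (fun p : ℝ × E => isoFam H x (p.1, chartChange x₀ x p.2)) (t, z) := by
    refine ContDiffAt.comp (g := isoFam H x) (f := fun p : ℝ × E => (p.1, chartChange x₀ x p.2))
      (t, z) ?_ (contDiffAt_fst.prodMk hφ2)
    rw [← contDiffWithinAt_univ]
    exact contDiffWithinAt_homC fun c => (hH t x c).contDiffWithinAt
  have h4 := (((compR _ _ _).contDiff.contDiffAt.comp (t, z) (((compR _ _ _).contDiff.contDiffAt.comp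
    (t, z) h2).clm_apply h3)).clm_apply h1)
  refine (h4.congr_of_eventuallyEq ?_).contDiffWithinAt
  have hn : ∀ᶠ p : ℝ × E in nhds (t, z), p.2 ∈ transDom V W x₀ x₀ ∩
      (transDom V V x₀ x ∩ transDom W W x₀ x) := by
    refine continuousAt_snd.eventually (Filter.inter_mem ?_ (Filter.inter_mem ?_ ?_))
    · exact (isOpen_transDom V W x₀ x₀).mem_nhds hz
    · exact (isOpen_transDom V V x₀ x).mem_nhds (mem_transDom_symm hz.1)
    · exact (isOpen_transDom W W x₀ x).mem_nhds (mem_transDom_symm ⟨hz.1.1, hz.2.2.2⟩)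
  filter_upwards [hn] with p hp
  exact isoFam_chartChange x₀ x hp.2.1.2.1 (by
    have h5 := chartChange_mem_trivDom hp.2.1
    have h6 := chartChange_mem_trivDom hp.2.2
    exact ⟨h5, ⟨h5.1, (chartAt E x).map_target h5.1⟩, h6⟩)

theorem SmoothIsoFamily.contDiffOn_isoFamInv (hH : SmoothIsoFamily H) (x : M) :
    ContDiffOn ℝ ∞ (isoFamInv H x) (univ ×ˢ transDom V W x x) := by
  intro p hp
  let e : (V.Idx x → ℂ) ≃L[ℂ] (W.Idx x → ℂ) :=
    ContinuousLinearEquiv.equivOfInverse (isoFam H x p) (isoFamInv H x p)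
      (fun c => DFunLike.congr_fun (isoFamInv_comp_isoFam hp.2) c)
      (fun c => DFunLike.congr_fun (isoFam_comp_isoFamInv hp.2) c)
  have h1 : ContDiffAt ℝ ∞ (ContinuousLinearMap.inverse : HomC (V.Idx x) (W.Idx x) → _)
      (isoFam H x p) := (contDiffAt_map_inverse (n := ∞) e).restrict_scalars ℝ
  refine (h1.comp_contDiffWithinAt p (hH.contDiffOn_isoFam x p hp)).congr (fun q hq => ?_) ?_
  · exact (ContinuousLinearMap.inverse_eq (isoFam_comp_isoFamInv hq.2)
      (isoFamInv_comp_isoFam hq.2)).symm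
  · exact (ContinuousLinearMap.inverse_eq (isoFam_comp_isoFamInv hp.2)
      (isoFamInv_comp_isoFam hp.2)).symm

/-- The path of connections obtained by pulling back a connection by a smooth family of
isomorphisms. -/
def SmoothIsoFamily.path (hH : SmoothIsoFamily H) (D : Connection W) {D₀ D₁ : Connection V}
    (h₀ : (D.pullback (H 0)).Same D₀) (h₁ : (D.pullback (H 1)).Same D₁) : ConnPath D₀ D₁ where
  conn t := D.pullback (H t)
  source := h₀
  target := h₁
  smooth U hU σ hσ x hx w t ht := by
    refine ContDiffAt.contDiffWithinAt ?_
    have hz := mem_transDom_self V W x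
    have hO : IsOpen ((univ : Set ℝ) ×ˢ transDom V W x x) :=
      isOpen_univ.prod (isOpen_transDom V W x x)
    have hn : (univ : Set ℝ) ×ˢ transDom V W x x ∈ nhds (t, chartAt E x x) :=
      hO.mem_nhds ⟨mem_univ _, hz⟩
    have hxU : (chartAt E x).symm (chartAt E x x) ∈ U := by
      rwa [(chartAt E x).left_inv (mem_chart_source E x)]
    have hK := (hH.contDiffOn_isoFam x).contDiffAt hn
    have hL := (hH.contDiffOn_isoFamInv x).contDiffAt hn
    have hσ' : ContDiffAt ℝ ∞ (fun p : ℝ × E => V.coord x ((chartAt E x).symm p.2)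
        (σ ((chartAt E x).symm p.2))) (t, chartAt E x x) :=
      ContDiffAt.comp (f := (Prod.snd : ℝ × E → E)) (t, chartAt E x x)
        (contDiffAt_chart_symm (hσ x hx)) contDiffAt_snd
    have hKσ := hK.homC_apply hσ'
    have hdKσ : ContDiffAt ℝ ∞ (fun p : ℝ × E => fderiv ℝ (fun q : ℝ × E => isoFam H x q
        (V.coord x ((chartAt E x).symm q.2) (σ ((chartAt E x).symm q.2)))) p (0, w))
        (t, chartAt E x x) := (hKσ.fderiv_right (m := ∞) (by simp)).clm_apply contDiffAt_const
    have hA : ContDiffAt ℝ ∞ (fun p : ℝ × E => D.connForm x p.2 w) (t, chartAt E x x) :=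
      ContDiffAt.clm_apply (ContDiffAt.comp (f := (Prod.snd : ℝ × E → E)) (t, chartAt E x x)
        ((D.contDiffOn_connForm x).contDiffAt ((isOpen_trivDom W x).mem_nhds (mem_trivDom W x)))
        contDiffAt_snd) contDiffAt_const
    have hfin := hL.homC_apply (hdKσ.add (hA.homC_apply hKσ))
    have hU' : ∀ᶠ p : ℝ × E in nhds (t, chartAt E x x), (chartAt E x).symm p.2 ∈ U := by
      have h1 : ContinuousAt (fun p : ℝ × E => (chartAt E x).symm p.2) (t, chartAt E x x) :=
        ContinuousAt.comp (f := (Prod.snd : ℝ × E → E))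
          ((chartAt E x).continuousAt_symm (mem_chart_target E x)) continuousAt_snd
      exact h1.eventually (hU.mem_nhds hxU)
    have hdiff : ∀ᶠ p : ℝ × E in nhds (t, chartAt E x x), DifferentiableAt ℝ
        (fun q : ℝ × E => isoFam H x q (V.coord x ((chartAt E x).symm q.2)
          (σ ((chartAt E x).symm q.2)))) p := by
      filter_upwards [(hKσ.of_le (m := 1) (by simp)).eventually (by simp)] with p hp
      exact hp.differentiableAt (by simp)
    refine hfin.congr_of_eventuallyEq ?_
    filter_upwards [hn, hU', hdiff] with p hp hpU hpd
    have hval : ∀ q ∈ transDom V W x x, W.coord x ((chartAt E x).symm q)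
        ((H p.1).toEquiv _ (σ ((chartAt E x).symm q))) = isoFam H x (p.1, q)
          (V.coord x ((chartAt E x).symm q) (σ ((chartAt E x).symm q))) := by
      intro q hq
      rw [isoFam, gaugeMap_apply, V.symm_coord x _ hq.1.2]
      rfl
    have h1 := D.coord_toFun hU ((H p.1).smooth.smoothOn hσ) hp.2.2.1 hpU hp.2.2.2.2 w
    rw [chartChange_self hp.2.1.1, fderiv_chartChange_self hp.2.1.1] at h1
    have h2 : (fun y => W.coord x ((chartAt E x).symm y)
        (((H p.1).toEquiv _).toLinearMap (σ ((chartAt E x).symm y)))) =ᶠ[nhds p.2] fun y =>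
          isoFam H x (p.1, y) (V.coord x ((chartAt E x).symm y) (σ ((chartAt E x).symm y))) := by
      filter_upwards [(isOpen_transDom V W x x).mem_nhds hp.2] with y hy using hval y hy
    have h3 : fderiv ℝ (fun y => isoFam H x (p.1, y) (V.coord x ((chartAt E x).symm y)
        (σ ((chartAt E x).symm y)))) p.2 w = fderiv ℝ (fun q : ℝ × E => isoFam H x q
        (V.coord x ((chartAt E x).symm q.2) (σ ((chartAt E x).symm q.2)))) p (0, w) := by
      have h4 := HasFDerivAt.comp (f := Prod.mk p.1) p.2 hpd.hasFDerivAt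
        (hasFDerivAt_prodMk_right p.1 p.2)
      exact DFunLike.congr_fun h4.fderiv w
    rw [h2.fderiv_eq, h3] at h1
    have h5 : ∀ e : W.Fib ((chartAt E x).symm p.2),
        V.coord x ((chartAt E x).symm p.2) (((H p.1).toEquiv _).symm e) =
          isoFamInv H x p (W.coord x ((chartAt E x).symm p.2) e) := by
      intro e
      rw [isoFamInv, gaugeMap_apply, W.symm_coord x _ hp.2.2.2.2]
      rfl
    refine (h5 _).trans (congrArg (isoFamInv H x p) (h1.trans ?_))
    congr 1
    exact congrArg (D.connForm x p.2 w) (hval p.2 hp.2)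

end Isotopy

section IsotopyClass

variable {E : Type*} [NormedAddCommGroup E] [NormedSpace ℝ E] [FiniteDimensional ℝ E]
  {M : Type*} [TopologicalSpace M] [ChartedSpace E M] [IsManifold 𝓘(ℝ, E) ∞ M]
  {V W : SmoothBundle E M} {H : ℝ → V.Iso W}

theorem deriv_slice {Y : Type*} [NormedAddCommGroup Y] [NormedSpace ℝ Y] {f : ℝ × E → Y} {t : ℝ}
    {z : E} (hf : DifferentiableAt ℝ f (t, z)) :
    HasDerivAt (fun s => f (s, z)) (fderiv ℝ f (t, z) (1, 0)) t :=
  hf.hasFDerivAt.comp_hasDerivAt t ((hasDerivAt_id t).prodMk (hasDerivAt_const t z))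

theorem SmoothIsoFamily.differentiableAt (hH : SmoothIsoFamily H) {x : M} {z : E}
    (hz : z ∈ transDom V W x x) (t : ℝ) : DifferentiableAt ℝ (isoFam H x) (t, z) :=
  ((hH.contDiffOn_isoFam x).contDiffAt ((isOpen_univ.prod (isOpen_transDom V W x x)).mem_nhds
    ⟨mem_univ _, hz⟩)).differentiableAt (by simp)

theorem SmoothIsoFamily.contDiffOn_logForm (hH : SmoothIsoFamily H) (x : M) :
    ContDiffOn ℝ ∞ (logForm (isoFam H x) (isoFamInv H x)) (univ ×ˢ transDom V W x x) :=
  RelKTheory.contDiffOn_logForm (isOpen_univ.prod (isOpen_transDom V W x x))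
    (hH.contDiffOn_isoFam x) (hH.contDiffOn_isoFamInv x)

theorem SmoothIsoFamily.logForm_chartChange (hH : SmoothIsoFamily H) {x₀ x₁ : M} {z : E}
    (hz : z ∈ transDom V W x₀ x₀) (h : z ∈ chartOverlap x₀ x₁)
    (h' : chartChange x₀ x₁ z ∈ transDom V W x₁ x₁) (t : ℝ) :
    traceC _ ((isoFamInv H x₀ (t, z)).comp (fderiv ℝ (isoFam H x₀) (t, z) (1, 0))) =
      traceC _ ((isoFamInv H x₁ (t, chartChange x₀ x₁ z)).comp
        (fderiv ℝ (isoFam H x₁) (t, chartChange x₀ x₁ z) (1, 0))) := by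
  set T := gaugeMap (fun y => (LinearMap.id : W.Fib y →ₗ[ℂ] W.Fib y)) x₁ x₀ (chartChange x₀ x₁ z)
  set S := gaugeMap (fun y => (LinearMap.id : V.Fib y →ₗ[ℂ] V.Fib y)) x₀ x₁ z
  set φz := chartChange x₀ x₁ z
  have d0 := deriv_slice (hH.differentiableAt hz t)
  have d1 := deriv_slice (hH.differentiableAt h' t)
  have e1 : (fun s => isoFam H x₀ (s, z)) = fun s =>
      compR _ _ _ (compR _ _ _ T (isoFam H x₁ (s, φz))) S :=
    funext fun s => isoFam_chartChange x₀ x₁ (p := (s, z)) h h'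
  have d2 := ((compR _ _ _).flip S).hasFDerivAt.comp_hasDerivAt t
    ((compR _ _ _ T).hasFDerivAt.comp_hasDerivAt t d1)
  have e2 : fderiv ℝ (isoFam H x₀) (t, z) (1, 0) =
      (T.comp (fderiv ℝ (isoFam H x₁) (t, φz) (1, 0))).comp S := d0.unique (e1 ▸ d2)
  have hzV : z ∈ transDom V V x₀ x₁ := mem_transDom_of_chartChange hz.1 h h'.1
  obtain ⟨S', hS1, hS2⟩ := gaugeMap_id_invertible hzV
  refine traceC_conj (G := S) (H := S') hS1 hS2 ?_
  have e3 : S.comp ((isoFamInv H x₀ (t, z)).comp T) = isoFamInv H x₁ (t, φz) :=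
    isoFamInv_chartChange x₀ x₁ (p := (t, z)) hz h
  rw [e2, ← e3]
  rfl

/-- The function `∫ Tr (H_t⁻¹ ∂H_t/∂t) dt` of a smooth family `H` of isomorphisms, up to a
constant. -/
def isoPrim (hH : SmoothIsoFamily H) : LocalForms E M 0 where
  toFun x z := -(2 * (Real.pi : ℂ) * Complex.I)⁻¹ •
    fibreIntegral (logForm (isoFam H x) (isoFamInv H x)) z
  dom x := transDom V W x x
  isOpen_dom x := isOpen_transDom V W x x
  mem_dom x := mem_transDom_self V W x
  smooth x := (contDiffOn_fibreIntegral (isOpen_transDom V W x x)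
    (hH.contDiffOn_logForm x)).const_smul _
  compat x₀ x₁ z hz h h' := by
    ext v
    rw [ContinuousAlternatingMap.compContinuousLinearMap_apply, ContinuousAlternatingMap.smul_apply,
      ContinuousAlternatingMap.smul_apply, fibreIntegral_apply (hH.contDiffOn_logForm x₀) hz,
      fibreIntegral_apply (hH.contDiffOn_logForm x₁) h']
    refine congrArg _ (intervalIntegral.integral_congr fun t _ => ?_)
    exact hH.logForm_chartChange hz h h' t

theorem extDeriv_isoPrim (hH : SmoothIsoFamily H) {x : M} {z : E} (hz : z ∈ transDom V W x x)
    (v : Fin 1 → E) : extDeriv ((isoPrim hH).toFun x) z v = -(2 * (Real.pi : ℂ) * Complex.I)⁻¹ *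
      (traceC _ ((isoFamInv H x (1, z)).comp (fderiv ℝ (isoFam H x) (1, z) (0, v 0))) -
        traceC _ ((isoFamInv H x (0, z)).comp (fderiv ℝ (isoFam H x) (0, z) (0, v 0)))) := by
  have hU := isOpen_transDom V W x x
  have hd : DifferentiableAt ℝ (fibreIntegral (logForm (isoFam H x) (isoFamInv H x))) z :=
    ((contDiffOn_fibreIntegral hU (hH.contDiffOn_logForm x)).contDiffAt
      (hU.mem_nhds hz)).differentiableAt (by simp)
  have h1 := extDeriv_fibreIntegral hU (hH.contDiffOn_logForm x) (fun t y hy =>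
    extDeriv_logForm (isOpen_univ.prod hU) (hH.contDiffOn_isoFam x) (hH.contDiffOn_isoFamInv x)
      (fun p hp => isoFamInv_comp_isoFam hp.2) (fun p hp => isoFam_comp_isoFamInv hp.2)
      (p := (t, y)) ⟨mem_univ _, hy⟩) hz
  change extDeriv (fun y => -(2 * (Real.pi : ℂ) * Complex.I)⁻¹ •
    fibreIntegral (logForm (isoFam H x) (isoFamInv H x)) y) z v = _
  rw [extDeriv] at h1 ⊢
  rw [fderiv_fun_const_smul hd, ContinuousAlternatingMap.alternatizeUncurryFin_smul, h1]
  rfl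

/-- The trace of the connection form of a pulled back connection. -/
theorem traceC_connForm_pullback (hH : SmoothIsoFamily H) (D : Connection W) {x : M} {z : E}
    (hz : z ∈ transDom V W x x) (t : ℝ) (u : E) :
    traceC _ ((D.pullback (H t)).connForm x z u) =
      traceC _ ((isoFamInv H x (t, z)).comp (fderiv ℝ (isoFam H x) (t, z) (0, u))) +
        traceC _ (D.connForm x z u) := by
  have hp : (t, z).2 ∈ transDom V W x x := hz
  have hLK := isoFamInv_comp_isoFam (H := H) hp
  have hKL := isoFam_comp_isoFamInv (H := H) hp
  have h1 := connForm_gauge (H t).smooth (D.parallel_pullback (H t)) hz u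
  rw [chartChange_self hz.1.1, fderiv_chartChange_self hz.1.1] at h1
  have h2 : fderiv ℝ (gaugeMap (fun y => ((H t).toEquiv y).toLinearMap) x x) z u =
      fderiv ℝ (isoFam H x) (t, z) (0, u) := by
    have h4 := HasFDerivAt.comp (f := Prod.mk t) z (hH.differentiableAt hz t).hasFDerivAt
      (hasFDerivAt_prodMk_right t z)
    exact DFunLike.congr_fun h4.fderiv u
  rw [h2] at h1
  change (isoFam H x (t, z)).comp _ = _ + (D.connForm x z u).comp (isoFam H x (t, z)) at h1
  have h3 := congrArg (fun B => (isoFamInv H x (t, z)).comp B) h1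
  rw [← ContinuousLinearMap.comp_assoc, hLK, ContinuousLinearMap.id_comp,
    ContinuousLinearMap.comp_add] at h3
  rw [h3, map_add]
  congr 1
  refine traceC_conj hLK hKL ?_
  rw [← ContinuousLinearMap.comp_assoc, hKL, ContinuousLinearMap.id_comp]

/-- The Chern-Simons forms of the path obtained by pulling back a flat connection by a smooth family
of isomorphisms are exact. -/
theorem SmoothIsoFamily.csForm_path_mem_exactForms (hH : SmoothIsoFamily H) {D : Connection W}
    (hD : D.Flat) {D₀ D₁ : Connection V} (h₀ : (D.pullback (H 0)).Same D₀)
    (h₁ : (D.pullback (H 1)).Same D₁) (k : ℕ) :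
    (hH.path D h₀ h₁).csForm k ∈ exactForms E M (2 * k + 1) := by
  cases k with
  | zero =>
    refine ⟨(isoPrim hH).glue, LocalForms.smooth_glue _, ?_⟩
    funext x
    rw [LocalForms.d_glue, ConnPath.csForm_eq_glue]
    have hz := mem_transDom_self V W x
    have e : extDeriv ((isoPrim hH).toFun x) (chartAt E x x) =
        localCS (reparam (connFam (hH.path D h₀ h₁).conn x)) 0 (chartAt E x x) := by
      ext v
      rw [extDeriv_isoPrim hH hz, localCS_zero_apply (isOpen_trivDom V x)
        ((hH.path D h₀ h₁).smoothFamily.contDiffOn_reparam x) (mem_trivDom V x),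
        RelKTheory.reparam_zero, RelKTheory.reparam_one]
      change _ = _ * (traceC _ ((D.pullback (H 1)).connForm x _ (v 0)) -
        traceC _ ((D.pullback (H 0)).connForm x _ (v 0)))
      rw [traceC_connForm_pullback hH D hz, traceC_connForm_pullback hH D hz, add_sub_add_right_eq_sub]
    change (extDeriv ((isoPrim hH).toFun x) (chartAt E x x)).compContinuousLinearMap _ =
      (localCS (reparam (connFam (hH.path D h₀ h₁).conn x)) 0
        (chartAt E x x)).compContinuousLinearMap _
    rw [e]
  | succ k =>
    have e : (hH.path D h₀ h₁).csForm (k + 1) = 0 := by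
      funext x
      have hc : ∀ t, ((hH.path D h₀ h₁).conn t).curvForm x (chartAt E x x) = 0 := fun t =>
        hD.localCurv_pullback (H t) (mem_trivDom V x)
      rw [ConnPath.csForm, intervalIntegral.integral_congr (g := fun _ => 0),
        intervalIntegral.integral_zero]
      · rfl
      · intro t _
        exact csDensity_eq_zero (hc t) fun h => absurd h (Nat.succ_ne_zero k)
    rw [e]
    exact zero_mem _

end IsotopyClass

/-! ### The class of a quintuple -/

section Classes

variable {E : Type*} [NormedAddCommGroup E] [NormedSpace ℝ E] [FiniteDimensional ℝ E]
  {M : Type*} [TopologicalSpace M] [ChartedSpace E M] [IsManifold 𝓘(ℝ, E) ∞ M]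

theorem Quintuple.csForm_mem_closedForms (Q : Quintuple E M) (P : Q.Path) (k : ℕ) :
    P.csForm k ∈ closedForms E M (2 * k + 1) :=
  ConnPath.csForm_mem_closedForms (fun _ _ hz => Q.src.flat.localCurv hz)
    (fun _ _ hz => Q.tgt.flat.localCurv_pullback Q.iso hz) P k

/-- The affine path from `∇_E` to `f^* ∇_F`. -/
def Quintuple.affinePath (Q : Quintuple E M) : Q.Path := ConnPath.affine _ _

/-- The class of the Chern-Simons form of a quintuple. -/
def Quintuple.csClass (Q : Quintuple E M) : HOdd E M :=
  oddClass (fun k => Q.affinePath.csForm k) (Q.csForm_mem_closedForms _)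

theorem oddClass_eq_iff {α β : ∀ k : ℕ, Form E M (2 * k + 1)}
    (hα : ∀ k, α k ∈ closedForms E M (2 * k + 1)) (hβ : ∀ k, β k ∈ closedForms E M (2 * k + 1)) :
    oddClass α hα = oddClass β hβ ↔ ∀ k, α k - β k ∈ exactForms E M (2 * k + 1) := by
  refine funext_iff.trans (forall_congr' fun k => ?_)
  exact Submodule.Quotient.eq _

theorem oddClass_eq_zero {α : ∀ k : ℕ, Form E M (2 * k + 1)}
    (hα : ∀ k, α k ∈ closedForms E M (2 * k + 1)) (h : ∀ k, α k ∈ exactForms E M (2 * k + 1)) :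
    oddClass α hα = 0 :=
  funext fun k => (Submodule.Quotient.mk_eq_zero _).2 (h k)

theorem Quintuple.oddClass_path (Q : Quintuple E M) (P : Q.Path) :
    oddClass (fun k => P.csForm k) (Q.csForm_mem_closedForms P) = Q.csClass :=
  (oddClass_eq_iff _ _).2 fun k =>
    ConnPath.csForm_sub_mem_exactForms (fun _ _ hz => Q.src.flat.localCurv hz)
      (fun _ _ hz => Q.tgt.flat.localCurv_pullback Q.iso hz) Q.affinePath P k

theorem Quintuple.csClass_sum (Q Q' : Quintuple E M) :
    (Q.sum Q').csClass = Q.csClass + Q'.csClass := by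
  let P : (Q.sum Q').Path := Q.affinePath.sum Q'.affinePath
    (Connection.same_sum_pullback Q.tgt.conn Q'.tgt.conn Q.iso Q'.iso)
  rw [← (Q.sum Q').oddClass_path P]
  funext k
  refine congrArg Submodule.Quotient.mk (Subtype.ext ?_)
  exact ConnPath.csForm_sum _ _ _ k

theorem Quintuple.csClass_eq_zero_of_isotopic (Q : Quintuple E M) (g : Q.src.bundle.Iso Q.tgt.bundle)
    (hg : Q.src.conn.Parallel Q.tgt.conn fun x => (g.toEquiv x).toLinearMap)
    (h : Q.iso.Isotopic g) : Q.csClass = 0 := by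
  obtain ⟨h, h0, h1, hs⟩ := h
  have hH := smoothIsoFamily_of_isotopy hs
  have e0 : ((Q.tgt.conn).pullback (h (1 - Real.smoothTransition 0))).Same Q.src.conn := by
    rw [Real.smoothTransition.zero, sub_zero]
    intro U hU σ hσ x hx
    ext w
    change ((h 1).toEquiv x).symm (Q.tgt.conn.toFun (fun y => (h 1).toEquiv y (σ y)) x w) = _
    simp only [h1]
    rw [LinearEquiv.symm_apply_eq, h1]
    exact hg U hU σ hσ x hx w
  have e1 : ((Q.tgt.conn).pullback (h (1 - Real.smoothTransition 1))).Same
      (Q.tgt.conn.pullback Q.iso) := by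
    rw [Real.smoothTransition.one, sub_self]
    intro U hU σ hσ x hx
    ext w
    change ((h 0).toEquiv x).symm (Q.tgt.conn.toFun (fun y => (h 0).toEquiv y (σ y)) x w) =
      (Q.iso.toEquiv x).symm (Q.tgt.conn.toFun (fun y => Q.iso.toEquiv y (σ y)) x w)
    simp only [h0]
    rw [LinearEquiv.symm_apply_eq, h0, LinearEquiv.apply_symm_apply]
  let P : Q.Path := hH.path Q.tgt.conn e0 e1
  rw [← Q.oddClass_path P]
  exact oddClass_eq_zero _ (hH.csForm_path_mem_exactForms Q.tgt.flat e0 e1)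

theorem Quintuple.csClass_eq_zero_of_shortExact {E' E₀ E'' : FlatBundle E M}
    {i : ∀ x, E'.bundle.Fib x →ₗ[ℂ] E₀.bundle.Fib x}
    {p : ∀ x, E₀.bundle.Fib x →ₗ[ℂ] E''.bundle.Fib x} (h : ShortExact E' E₀ E'' i p)
    {s : ∀ x, E₀.bundle.Fib x →ₗ[ℂ] E'.bundle.Fib x} (hsi : ∀ x e, s x (i x e) = e)
    {f : E₀.bundle.Iso (E'.bundle.sum E''.bundle)} (hf : ∀ x e, f.toEquiv x e = (s x e, p x e)) :
    (⟨E₀, E'.sum E'', f⟩ : Quintuple E M).csClass = 0 := by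
  have hfi : ∀ x e, f.toEquiv x (i x e) = (e, 0) := fun x e => by
    rw [hf, hsi, (h.exact x).apply_apply_eq_zero]
  have hpf : ∀ x e, p x ((f.toEquiv x).symm e) = e.2 := fun x e => by
    refine (congrArg Prod.snd (hf x ((f.toEquiv x).symm e))).symm.trans ?_
    rw [LinearEquiv.apply_symm_apply]
  -- `i` and `p` are also parallel for the pull-back of the direct sum connection.
  have hi₁ : E'.conn.Parallel ((E'.sum E'').conn.pullback f) i := by
    intro U hU σ hσ x hx w
    change (f.toEquiv x).symm ((E'.conn.toFun (fun y => (f.toEquiv y (i y (σ y))).1) x w),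
      (E''.conn.toFun (fun y => (f.toEquiv y (i y (σ y))).2) x w)) = _
    simp only [hfi]
    rw [LinearEquiv.symm_apply_eq, hfi]
    exact congrArg (Prod.mk _) (LinearMap.congr_fun (E''.conn.toFun_zero x) w)
  have hp₁ : ((E'.sum E'').conn.pullback f).Parallel E''.conn p := by
    intro U hU σ hσ x hx w
    change _ = p x ((f.toEquiv x).symm ((E'.conn.toFun (fun y => (f.toEquiv y (σ y)).1) x w),
      (E''.conn.toFun (fun y => (f.toEquiv y (σ y)).2) x w)))
    rw [hpf]
    simp only [hf]
  refine oddClass_eq_zero _ fun k => ?_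
  have e : (Quintuple.affinePath ⟨E₀, E'.sum E'', f⟩).csForm k = 0 :=
    csForm_affine_eq_zero (fun _ _ hz => E₀.flat.localCurv hz)
      (fun _ _ hz => (E'.sum E'').flat.localCurv_pullback f hz)
      (connForm_sub_mul_sub_eq_zero h.smooth_i h.smooth_p h.parallel_i hi₁ h.parallel_p hp₁
        h.exact) k
  rw [e]
  exact zero_mem _

/-- The morphism on the relative K-group which is induced by the class of the Chern-Simons form. -/
def KRel.csHom : KRel E M →+ HOdd E M :=
  QuotientAddGroup.lift _ (FreeAbelianGroup.lift Quintuple.csClass) <| by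
    rw [AddSubgroup.closure_le]
    intro a ha
    change FreeAbelianGroup.lift Quintuple.csClass a = 0
    cases ha with
    | parallel Q g hg h =>
      rw [FreeAbelianGroup.lift_apply_of]
      exact Q.csClass_eq_zero_of_isotopic g hg h
    | sum Q Q' =>
      rw [map_sub, map_add, FreeAbelianGroup.lift_apply_of, FreeAbelianGroup.lift_apply_of,
        FreeAbelianGroup.lift_apply_of, Q.csClass_sum, sub_self]
    | exact E' E₀ E'' i p h s hs hsi f hf =>
      rw [FreeAbelianGroup.lift_apply_of]
      exact Quintuple.csClass_eq_zero_of_shortExact h hsi hf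

theorem KRel.csHom_mk (Q : Quintuple E M) : KRel.csHom (KRel.mk Q) = Q.csClass :=
  FreeAbelianGroup.lift_apply_of _ _

theorem KRel.hom_ext {A : Type*} [AddCommGroup A] {f g : KRel E M →+ A}
    (h : ∀ Q, f (KRel.mk Q) = g (KRel.mk Q)) : f = g := by
  exact QuotientAddGroup.addMonoidHom_ext _ (FreeAbelianGroup.lift_ext _ _ h)

end Classes

end RelKTheory

end

theorem mainTheorem3 {E : Type*} [NormedAddCommGroup E] [NormedSpace ℝ E] [FiniteDimensional ℝ E]
    {M : Type*} [TopologicalSpace M] [ChartedSpace E M] [IsManifold 𝓘(ℝ, E) ∞ M]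
    [T2Space M] [SigmaCompactSpace M] :
    (∀ Q : Quintuple E M, Nonempty Q.Path) ∧
    ∃ hclosed : ∀ (Q : Quintuple E M) (P : Q.Path) (k : ℕ),
        P.csForm k ∈ closedForms E M (2 * k + 1),
      ∃! N : KRel E M →+ HOdd E M,
        ∀ (Q : Quintuple E M) (P : Q.Path),
          N (KRel.mk Q) = oddClass (fun k => P.csForm k) (hclosed Q P) := by
  refine ⟨fun Q => ⟨Q.affinePath⟩, Quintuple.csForm_mem_closedForms, KRel.csHom,
    fun Q P => (KRel.csHom_mk Q).trans (Q.oddClass_path P).symm, fun N hN => ?_⟩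
  exact KRel.hom_ext fun Q => (hN Q Q.affinePath).trans
    ((Q.oddClass_path _).trans (KRel.csHom_mk Q).symm)
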